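/- Let $T>0$, $\beta\in(1/4,1/2)$ and $2\le p<1/(1-2\beta)$. Let $G(t,x)=\frac1{\sqrt{4\pi t}}e^{-x^2/4t}$ and, for $t>0$, $$(\bar G(t,\cdot)*_Df)(x)=\int_0^\infty\big(G(t,x-y)-G(t,x+y)\big)f(y)\,dy,$$ with the convention $\bar G(0,\cdot)*_Df=f$. For $\psi\in C^\beta([0,T])$ with $\psi(0)=0$ let $$\tilde u(t,x)=-2\int_0^t\partial_xG(t-\tau,x)\,\psi(\tau)\,d\tau$$ be the solution of the heat equation on the half-line $\mathbb R_+=(0,\infty)$ with zero initial value and boundary value $\psi$. Then there is a constant $C>0$, depending only on $T,\beta,p$, such that the following holds for all $\psi\in C^\beta([0,T])$ with $\psi(0)=0$, all $b\in L^\infty([0,T],L^2(\mathbb R_+))$, all $\tilde\gamma\in L^\infty([0,T]\times\mathbb R_+)$ and all $v_0\in W^{1,p}(\mathbb R_+)$ with $v_0(0)=0$ (continuous representative). The problem $$\partial_t\tilde v=\partial_x^2\tilde v+b\,\partial_x\tilde v+\tilde\gamma\,\tilde v+b\,\partial_x\tilde u+\tilde\gamma\,\tilde u,\qquad \tilde v(t,0)=0,\qquad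 \tilde v(0,\cdot)=v_0,$$ has a unique mild solution $\tilde v\in L^\infty([0,T],W^{1,p}(\mathbb R_+))$, that is, a unique $\tilde v$ in this space such that for every $t\in[0,T]$ $$\tilde v(t,\cdot)=\bar G(t,\cdot)*_Dv_0+\int_0^t\bar G(t-\tau,\cdot)*_D\big(b\,\partial_x\tilde v+\tilde\gamma\,\tilde v\big)(\tau,\cdot)\,d\tau+\int_0^t\bar G(t-\tau,\cdot)*_D\big(b\,\partial_x\tilde u+\tilde\gamma\,\tilde u\big)(\tau,\cdot)\,d\tau$$ almost everywhere on $\mathbb R_+$ (two mild solutions coincide in $W^{1,p}(\mathbb R_+)$ for every $t\in[0,T]$). Moreover, with $M=\|b\|_{L^\infty([0,T],L^2(\mathbb R_+))}+\|\tilde\gamma\|_{L^\infty([0,T]\times\mathbb R_+)}$, $$\sup_{t\in[0,T]}\|\tilde v(t,\cdot)\|_{W^{1,p}(\mathbb R_+)}\le C\,e^{C M^4}\Big(\|v_0\|_{W^{1,p}(\mathbb R_+)}+M\,\|\psi\|_{C^\beta([0,T])}\Big).$$ -/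

import Mathlib

open MeasureTheory Set Filter Topology
open scoped ENNReal NNReal ContDiff

noncomputable section

namespace HalfLineHeat

/-- Lebesgue measure on the half-line `(0, ∞)`. -/
abbrev halfLine : Measure ℝ := volume.restrict (Ioi 0)

/-- Lebesgue measure on the time interval `[0, T]`. -/
abbrev timeInterval (T : ℝ) : Measure ℝ := volume.restrict (Icc 0 T)

/-- Lebesgue measure on `[0, T] × (0, ∞)`. -/
abbrev timeSpace (T : ℝ) : Measure (ℝ × ℝ) := volume.restrict (Icc 0 T ×ˢ Ioi 0)

/-! ### Sobolev spaces on the half-line -/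

/-- `g` is the weak derivative of `f` on `(0, ∞)`. -/
def IsWeakDeriv (f g : ℝ → ℝ) : Prop :=
  ∀ φ : ℝ → ℝ, ContDiff ℝ ∞ φ → HasCompactSupport φ → tsupport φ ⊆ Ioi 0 →
    ∫ x in Ioi 0, f x * deriv φ x = - ∫ x in Ioi 0, g x * φ x

/-- An `L^p` function times a continuous compactly supported function is integrable. -/
theorem integrable_mul_test {p : ℝ≥0∞} [Fact (1 ≤ p)] (f : Lp ℝ p halfLine) {φ : ℝ → ℝ}
    (hφ : Continuous φ) (hc : HasCompactSupport φ) :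
    Integrable (fun x => f x * φ x) halfLine := by
  have hf : LocallyIntegrable (f : ℝ → ℝ) halfLine :=
    (Lp.memLp f).locallyIntegrable Fact.out
  simpa [smul_eq_mul] using hf.integrable_smul_right_of_hasCompactSupport hφ hc

/-- The Sobolev space `W^{1,p}(0, ∞)`: pairs `(f, f')` in `L^p × L^p` such that `f'` is the weak
derivative of `f`, with the norm `(‖f‖_p ^ p + ‖f'‖_p ^ p) ^ (1 / p)` for `p < ∞`. -/
def W1p (p : ℝ≥0∞) [Fact (1 ≤ p)] :
    Submodule ℝ (WithLp p (Lp ℝ p halfLine × Lp ℝ p halfLine)) where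
  carrier := {z | IsWeakDeriv z.fst z.snd}
  zero_mem' := by
    intro φ _ _ _
    have h0 := Lp.coeFn_zero ℝ p halfLine
    have h1 : (fun x => (0 : Lp ℝ p halfLine) x * deriv φ x) =ᵐ[halfLine] fun _ => 0 := by
      filter_upwards [h0] with x hx
      rw [hx, Pi.zero_apply, zero_mul]
    have h2 : (fun x => (0 : Lp ℝ p halfLine) x * φ x) =ᵐ[halfLine] fun _ => 0 := by
      filter_upwards [h0] with x hx
      rw [hx, Pi.zero_apply, zero_mul]
    simp only [WithLp.zero_fst, WithLp.zero_snd]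
    rw [integral_congr_ae h1, integral_congr_ae h2]
    simp
  add_mem' := by
    intro z w hz hw φ h1 h2 h3
    have hd : Continuous (deriv φ) := h1.continuous_deriv (by simp)
    have e1 : (fun x => (z + w).fst x * deriv φ x) =ᵐ[halfLine]
        fun x => z.fst x * deriv φ x + w.fst x * deriv φ x := by
      filter_upwards [Lp.coeFn_add z.fst w.fst] with x hx
      rw [WithLp.add_fst, hx, Pi.add_apply, add_mul]
    have e2 : (fun x => (z + w).snd x * φ x) =ᵐ[halfLine]
        fun x => z.snd x * φ x + w.snd x * φ x := by
      filter_upwards [Lp.coeFn_add z.snd w.snd] with x hx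
      rw [WithLp.add_snd, hx, Pi.add_apply, add_mul]
    rw [integral_congr_ae e1, integral_congr_ae e2,
      integral_add (integrable_mul_test _ hd h2.deriv) (integrable_mul_test _ hd h2.deriv),
      integral_add (integrable_mul_test _ h1.continuous h2)
        (integrable_mul_test _ h1.continuous h2), hz φ h1 h2 h3, hw φ h1 h2 h3]
    ring
  smul_mem' := by
    intro c z hz φ h1 h2 h3
    have e1 : (fun x => (c • z).fst x * deriv φ x) =ᵐ[halfLine]
        fun x => c * (z.fst x * deriv φ x) := by
      filter_upwards [Lp.coeFn_smul c z.fst] with x hx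
      rw [WithLp.smul_fst, hx, Pi.smul_apply, smul_eq_mul, mul_assoc]
    have e2 : (fun x => (c • z).snd x * φ x) =ᵐ[halfLine]
        fun x => c * (z.snd x * φ x) := by
      filter_upwards [Lp.coeFn_smul c z.snd] with x hx
      rw [WithLp.smul_snd, hx, Pi.smul_apply, smul_eq_mul, mul_assoc]
    rw [integral_congr_ae e1, integral_congr_ae e2, integral_const_mul, integral_const_mul,
      hz φ h1 h2 h3]
    ring

/-- A representative of an element of `W^{1,p}(0, ∞)`. -/
def toFun {p : ℝ≥0∞} [Fact (1 ≤ p)] (f : W1p p) : ℝ → ℝ := f.1.fst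

/-- The weak derivative `∂ₓ f` of an element of `W^{1,p}(0, ∞)`. -/
def dx {p : ℝ≥0∞} [Fact (1 ≤ p)] (f : W1p p) : ℝ → ℝ := f.1.snd

/-- `f(0) = 0`, in the sense of the continuous representative of `f` on `[0, ∞)`. -/
def VanishesAtZero {p : ℝ≥0∞} [Fact (1 ≤ p)] (f : W1p p) : Prop :=
  ∃ g : ℝ → ℝ, ContinuousOn g (Ici 0) ∧ toFun f =ᵐ[halfLine] g ∧ g 0 = 0

/-! ### Hölder functions on `[0, T]` -/

/-- `ψ ∈ C^β([0, T])`. -/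
def MemCHolder (T : ℝ) (β : ℝ≥0) (ψ : ℝ → ℝ) : Prop := MemHolder β ((Icc 0 T).domRestrict ψ)

/-- `‖ψ‖_{C^β([0, T])}`: the supremum norm plus the Hölder seminorm. -/
def cHolderNorm (T : ℝ) (β : ℝ≥0) (ψ : ℝ → ℝ) : ℝ :=
  (⨆ t : Icc 0 T, |ψ t|) + nnHolderNorm β ((Icc 0 T).domRestrict ψ)

/-! ### Heat kernels -/

/-- The heat kernel `G(t, x)` of `∂ₜ - ∂ₓ²` on the line, for `t > 0`. -/
def heatKernel (t x : ℝ) : ℝ := 1 / √(4 * Real.pi * t) * Real.exp (-x ^ 2 / (4 * t))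

/-- Convolution with the Dirichlet heat kernel on the half-line, for `t > 0`. -/
def dirichletConv (t : ℝ) (f : ℝ → ℝ) (x : ℝ) : ℝ :=
  ∫ y in Ioi 0, (heatKernel t (x - y) - heatKernel t (x + y)) * f y

/-- The Dirichlet heat semigroup for `t ≥ 0`; at `t = 0` it is the identity. -/
def dirichletSemigroup (t : ℝ) (f : ℝ → ℝ) (x : ℝ) : ℝ :=
  if t = 0 then f x else dirichletConv t f x

/-- The solution `ũ` of `∂ₜ u = ∂ₓ² u`, `u(0, x) = 0`, `u(t, 0) = ψ(t)` given by the
boundary potential `-2 ∫₀ᵗ ∂ₓG(t - τ, x) ψ(τ) dτ`. It is smooth in `x > 0`. -/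
def boundaryHeat (ψ : ℝ → ℝ) (t x : ℝ) : ℝ :=
  -2 * ∫ τ in (0)..t, deriv (fun z => heatKernel (t - τ) z) x * ψ τ

/-! ### Mild solutions -/

/-- `v` is a mild solution in `L^∞([0, T], W^{1,p}(0, ∞))` of
`∂ₜ v = ∂ₓ² v + b ∂ₓ v + γ v + b ∂ₓ ũ + γ ũ`, `v(t, 0) = 0`, `v(0, ·) = v₀`. -/
structure IsMildSolution {p : ℝ≥0∞} [Fact (1 ≤ p)] (T : ℝ) (ψ : ℝ → ℝ)
    (b : ℝ → Lp ℝ 2 halfLine) (γ : ℝ × ℝ → ℝ) (v₀ : W1p p) (v : ℝ → W1p p) : Prop where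
  memLp : MemLp v ∞ (timeInterval T)
  eq : ∀ t ∈ Icc 0 T, ∀ᵐ x ∂halfLine,
    toFun (v t) x = dirichletSemigroup t (toFun v₀) x
      + (∫ τ in (0)..t, dirichletConv (t - τ)
          (fun y => b τ y * dx (v τ) y + γ (τ, y) * toFun (v τ) y) x)
      + ∫ τ in (0)..t, dirichletConv (t - τ)
          (fun y => b τ y * deriv (boundaryHeat ψ τ) y + γ (τ, y) * boundaryHeat ψ τ y) x

/-- `‖b‖_{L^∞([0,T], L²(0,∞))} + ‖γ‖_{L^∞([0,T] × (0,∞))}`. -/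
def coeffNorm (T : ℝ) (b : ℝ → Lp ℝ 2 halfLine) (γ : ℝ × ℝ → ℝ) : ℝ :=
  (eLpNorm b ∞ (timeInterval T)).toReal + (eLpNorm γ ∞ (timeSpace T)).toReal

end HalfLineHeat

end

/-!
# Mild solutions of a perturbed heat equation on the half-line

The proof treats the mild formulation as a linear Volterra equation for the pair `(v, ∂ₓv)` in
`L^p × L^p`, namely `z(t) = F(t) + ∫₀ᵗ R(t - τ, τ) z(τ) dτ`, where `R(s, τ)(f, g)` is the pair
`(S(s)h, ∂ₓS(s)h)` with `h = b(τ) g + γ(τ) f` and `S` the Dirichlet heat semigroup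
(`duhamelKernel`). Because `b(τ) g` lies only in `L^r` with `1 / r = 1 / 2 + 1 / p`, Young's
inequality (`eLpNorm_halfConv_le`) is used with the `L²` norm of `∂ₓG(s, ·)`, which is of order
`s ^ (-3/4)`. All other contributions are less singular, so that
`‖R(s, τ)‖ ≤ A M s ^ (-3/4)` (`exists_norm_duhamelKernel_le`).

For such a kernel the Volterra operator has norm `O(A M l ^ (-1/4))` in the weighted norm
`sup e^{-lt}‖z(t)‖` (`SingularKernel.weighted_bound`). With `l` of the order of `M ^ 4` it is a
contraction by `1 / 2`; this gives existence, uniqueness and a bound by `e^{lT}` times the size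
of `F`, hence the factor `exp (C M ^ 4)`.

The forcing term `F` is the sum of the semigroup on the initial value and of the Volterra operator
applied to the boundary potential `ũ`.
* For an initial value with `v₀(0) = 0` one has `∂ₓ S(t) v₀ = N(t) ∂ₓv₀` with the Neumann semigroup
  `N` (`halfConv_heatKernelDx_eq`), so that `S(t)` is bounded on these functions. The identity is an
  integration by parts against a test function that does not vanish at the origin, reached by
  cut-offs (`integral_mul_deriv_of_vanishes`).
* The potential satisfies `|ũ| + |∂ₓũ| ≤ C ‖ψ‖ x ^ (-2a) exp (-x² / 16T)` for any `a > 1 / 2 - β`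
  (`exists_abs_timeConv_le`), because `∂ₓ²G = ∂ₜG` allows `ψ(t)` to be subtracted inside the
  singular integral. This majorant belongs to `L^p` for some such `a` exactly when
  `p (1 - 2β) < 1`.

The integrals over time are Bochner integrals in `L^p × L^p`. Their measurability, and their
agreement with the pointwise integrals of the mild formula, rest on jointly measurable
representatives of measurable maps into `L^p` (`exists_measurable_representative`,
`stronglyMeasurable_Lp_of_ae_eq`, `coeFn_integral_Lp_ae_eq`).
-/

noncomputable section

namespace HalfLineHeat

/-! ### Derivatives of the heat kernel and Gaussian bounds -/

/-- The first derivative `∂ₓG(s, x)` of the heat kernel; it is `0` for `s ≤ 0`. -/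
def heatKernelDx (s x : ℝ) : ℝ := -x / (2 * s) * heatKernel s x

/-- The second derivative `∂ₓ²G(s, x)` of the heat kernel; it is `0` for `s ≤ 0`. -/
def heatKernelDxx (s x : ℝ) : ℝ := (x ^ 2 / (4 * s ^ 2) - 1 / (2 * s)) * heatKernel s x

theorem heatKernel_of_nonpos {s : ℝ} (hs : s ≤ 0) (x : ℝ) : heatKernel s x = 0 := by
  have : √(4 * Real.pi * s) = 0 :=
    Real.sqrt_eq_zero_of_nonpos (mul_nonpos_of_nonneg_of_nonpos (by positivity) hs)
  simp [heatKernel, this]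

theorem heatKernelDx_of_nonpos {s : ℝ} (hs : s ≤ 0) (x : ℝ) : heatKernelDx s x = 0 := by
  simp [heatKernelDx, heatKernel_of_nonpos hs]

theorem hasDerivAt_heatKernel (s x : ℝ) :
    HasDerivAt (heatKernel s) (heatKernelDx s x) x := by
  have h1 : HasDerivAt (fun x : ℝ => -x ^ 2 / (4 * s)) (-(2 * x) / (4 * s)) x := by
    simpa using ((hasDerivAt_pow 2 x).neg.div_const (4 * s))
  have h2 := (h1.exp).const_mul (1 / √(4 * Real.pi * s))
  refine h2.congr_deriv ?_
  unfold heatKernelDx heatKernel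
  ring

theorem hasDerivAt_heatKernelDx (s x : ℝ) :
    HasDerivAt (heatKernelDx s) (heatKernelDxx s x) x := by
  have h1 : HasDerivAt (fun x : ℝ => -x / (2 * s)) (-1 / (2 * s)) x :=
    (hasDerivAt_id x).neg.div_const (2 * s)
  have h2 := h1.mul (hasDerivAt_heatKernel s x)
  refine h2.congr_deriv ?_
  unfold heatKernelDxx heatKernelDx
  ring

theorem deriv_heatKernel (s : ℝ) : deriv (fun z => heatKernel s z) = heatKernelDx s :=
  funext fun x => (hasDerivAt_heatKernel s x).deriv

/-- The heat equation for the heat kernel. -/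
theorem hasDerivAt_heatKernel_time {s : ℝ} (hs : 0 < s) (x : ℝ) :
    HasDerivAt (fun s => heatKernel s x) (heatKernelDxx s x) s := by
  have hpi := Real.pi_pos
  have h4 : 0 < 4 * Real.pi * s := by positivity
  have h1 : HasDerivAt (fun s : ℝ => 4 * Real.pi * s) (4 * Real.pi) s := by
    simpa using (hasDerivAt_id s).const_mul (4 * Real.pi)
  have h2 := (h1.sqrt h4.ne').inv (Real.sqrt_pos.2 h4).ne'
  have h3 : HasDerivAt (fun s : ℝ => -x ^ 2 / (4 * s)) (x ^ 2 / (4 * s ^ 2)) s := by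
    have h := ((hasDerivAt_id' s).const_mul 4).inv (by positivity : (4 : ℝ) * s ≠ 0)
    have h := h.const_mul (-x ^ 2)
    refine h.congr_deriv ?_
    field_simp
  have h5 := h2.mul h3.exp
  have e : (fun s => heatKernel s x)
      = (fun s : ℝ => √(4 * Real.pi * s))⁻¹ * fun s => Real.exp (-x ^ 2 / (4 * s)) := by
    funext s
    simp [heatKernel]
  rw [e]
  refine h5.congr_deriv ?_
  unfold heatKernelDxx heatKernel
  have hq : √(4 * Real.pi * s) ^ 2 = 4 * Real.pi * s := Real.sq_sqrt h4.le
  have hne : √(4 * Real.pi * s) ≠ 0 := (Real.sqrt_pos.2 h4).ne'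
  rw [hq]
  simp only [Pi.inv_apply]
  field_simp
  ring

theorem measurable_heatKernel : Measurable fun q : ℝ × ℝ => heatKernel q.1 q.2 := by
  unfold heatKernel
  fun_prop

theorem measurable_heatKernelDx : Measurable fun q : ℝ × ℝ => heatKernelDx q.1 q.2 := by
  unfold heatKernelDx
  exact ((measurable_snd.neg).div (measurable_fst.const_mul 2)).mul measurable_heatKernel

theorem measurable_heatKernelDxx : Measurable fun q : ℝ × ℝ => heatKernelDxx q.1 q.2 := by
  unfold heatKernelDxx
  refine Measurable.mul ?_ measurable_heatKernel
  fun_prop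

theorem continuous_heatKernel (s : ℝ) : Continuous (heatKernel s) :=
  continuous_iff_continuousAt.2 fun x => (hasDerivAt_heatKernel s x).continuousAt

theorem continuous_heatKernelDx (s : ℝ) : Continuous (heatKernelDx s) :=
  continuous_iff_continuousAt.2 fun x => (hasDerivAt_heatKernelDx s x).continuousAt

theorem heatKernel_nonneg (s x : ℝ) : 0 ≤ heatKernel s x := by
  unfold heatKernel; positivity

theorem heatKernel_le {s : ℝ} (hs : 0 < s) (x : ℝ) :
    heatKernel s x ≤ 2⁻¹ * (s ^ (-(1 / 2) : ℝ) * Real.exp (-x ^ 2 / (4 * s))) := by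
  have h : √(4 * Real.pi * s) ≥ 2 * √s := by
    have : (2 : ℝ) * √s = √(4 * s) := by
      rw [Real.sqrt_mul (by norm_num) s, show (4 : ℝ) = 2 ^ 2 by norm_num,
        Real.sqrt_sq (by norm_num)]
    rw [this]
    apply Real.sqrt_le_sqrt
    nlinarith [Real.pi_gt_three]
  have h0 : 0 < √s := Real.sqrt_pos.2 hs
  rw [Real.rpow_neg hs.le, ← Real.sqrt_eq_rpow, ← mul_assoc, ← mul_inv, ← one_div]
  unfold heatKernel
  gcongr

theorem exp_quarter_split {s : ℝ} (x : ℝ) :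
    Real.exp (-x ^ 2 / (4 * s))
      = Real.exp (-(x ^ 2 / (8 * s))) * Real.exp (-(x ^ 2 / (8 * s))) := by
  rw [← Real.exp_add]; congr 1; ring

theorem abs_heatKernel_le {s : ℝ} (hs : 0 < s) (x : ℝ) :
    |heatKernel s x| ≤ s ^ (-(1 / 2) : ℝ) * Real.exp (-(x ^ 2 / (8 * s))) := by
  rw [abs_of_nonneg (heatKernel_nonneg s x)]
  refine (heatKernel_le hs x).trans ?_
  rw [exp_quarter_split]
  have h1 : Real.exp (-(x ^ 2 / (8 * s))) ≤ 1 := Real.exp_le_one_iff.2 (by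
    have : 0 ≤ x ^ 2 / (8 * s) := by positivity
    linarith)
  have h2 := Real.exp_pos (-(x ^ 2 / (8 * s)))
  have h3 : 0 < s ^ (-(1 / 2) : ℝ) := Real.rpow_pos_of_pos hs _
  have h4 := mul_le_mul_of_nonneg_left h1 h2.le
  have h5 := mul_le_mul_of_nonneg_left h4 h3.le
  nlinarith [mul_pos h3 h2]

theorem mul_exp_neg_le_one (u : ℝ) : (1 + u) * Real.exp (-u) ≤ 1 := by
  have := Real.add_one_le_exp u
  rw [Real.exp_neg, ← div_eq_mul_inv, div_le_one (Real.exp_pos u)]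
  linarith

theorem abs_heatKernelDx_le {s : ℝ} (hs : 0 < s) (x : ℝ) :
    |heatKernelDx s x| ≤ s ^ (-1 : ℝ) * Real.exp (-(x ^ 2 / (8 * s))) := by
  unfold heatKernelDx
  rw [abs_mul, abs_of_nonneg (heatKernel_nonneg s x), abs_div, abs_neg,
    abs_of_pos (by positivity : 0 < 2 * s)]
  have h := heatKernel_le hs x
  rw [exp_quarter_split] at h
  set E := Real.exp (-(x ^ 2 / (8 * s))) with hE
  have hEp : 0 < E := Real.exp_pos _
  have h0 : 0 < √s := Real.sqrt_pos.2 hs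
  have hsq : √s ^ 2 = s := Real.sq_sqrt hs.le
  have h1 : (1 + x ^ 2 / (8 * s)) * E ≤ 1 := mul_exp_neg_le_one _
  have h2 : |x| / (2 * √s) * E ≤ 2 := by
    have : |x| / (2 * √s) ≤ 2 * (1 + x ^ 2 / (8 * s)) := by
      have e : x ^ 2 / (8 * s) = (|x| / (2 * √s)) ^ 2 / 2 := by
        rw [div_pow, mul_pow, hsq, sq_abs]; ring
      rw [e]
      nlinarith [sq_nonneg (|x| / (2 * √s) - 1)]
    calc _ ≤ 2 * (1 + x ^ 2 / (8 * s)) * E := by gcongr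
      _ ≤ 2 := by linarith
  have e2 : s ^ (-(1 / 2) : ℝ) = (√s)⁻¹ := by
    rw [Real.rpow_neg hs.le, ← Real.sqrt_eq_rpow]
  rw [e2] at h
  calc |x| / (2 * s) * heatKernel s x ≤ |x| / (2 * s) * (2⁻¹ * ((√s)⁻¹ * (E * E))) := by gcongr
    _ = (|x| / (2 * √s) * E) * (2⁻¹ * s⁻¹ * E) := by field_simp
    _ ≤ 2 * (2⁻¹ * s⁻¹ * E) := by gcongr
    _ = s ^ (-1 : ℝ) * E := by rw [Real.rpow_neg_one]; ring

theorem abs_heatKernelDxx_le {s : ℝ} (hs : 0 < s) (x : ℝ) :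
    |heatKernelDxx s x| ≤ s ^ (-(3 / 2) : ℝ) * Real.exp (-(x ^ 2 / (8 * s))) := by
  unfold heatKernelDxx
  rw [abs_mul, abs_of_nonneg (heatKernel_nonneg s x)]
  have h := heatKernel_le hs x
  rw [exp_quarter_split] at h
  set E := Real.exp (-(x ^ 2 / (8 * s))) with hE
  have hEp : 0 < E := Real.exp_pos _
  have h1 : (1 + x ^ 2 / (8 * s)) * E ≤ 1 := mul_exp_neg_le_one _
  have hx : 0 ≤ x ^ 2 / (8 * s) := by positivity
  have h2 : |x ^ 2 / (4 * s ^ 2) - 1 / (2 * s)| ≤ 2 * s⁻¹ * (1 + x ^ 2 / (8 * s)) := by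
    have e1 : x ^ 2 / (4 * s ^ 2) = 2 * s⁻¹ * (x ^ 2 / (8 * s)) := by field_simp; ring
    have e2 : 1 / (2 * s) = 2⁻¹ * s⁻¹ := by field_simp
    have hs' : 0 < s⁻¹ := inv_pos.2 hs
    rw [e1, e2, abs_le]
    constructor <;> nlinarith [mul_nonneg hs'.le hx]
  have e3 : s ^ (-(3 / 2) : ℝ) = s⁻¹ * s ^ (-(1 / 2) : ℝ) := by
    rw [← Real.rpow_neg_one, ← Real.rpow_add hs]; norm_num
  have hp : 0 < s ^ (-(1 / 2) : ℝ) := Real.rpow_pos_of_pos hs _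
  calc _ ≤ (2 * s⁻¹ * (1 + x ^ 2 / (8 * s))) * (2⁻¹ * (s ^ (-(1 / 2) : ℝ) * (E * E))) :=
        mul_le_mul h2 h (heatKernel_nonneg s x) (by positivity)
    _ = ((1 + x ^ 2 / (8 * s)) * E) * (s⁻¹ * s ^ (-(1 / 2) : ℝ) * E) := by ring
    _ ≤ 1 * (s⁻¹ * s ^ (-(1 / 2) : ℝ) * E) := by gcongr
    _ = _ := by rw [e3, one_mul]

/-! ### Lebesgue norms of the heat kernel -/

theorem eLpNorm_gaussian {s q : ℝ} (hs : 0 < s) (hq : 0 < q) :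
    eLpNorm (fun x : ℝ => Real.exp (-(x ^ 2 / (8 * s)))) (ENNReal.ofReal q) volume
      = ENNReal.ofReal ((8 * Real.pi * s / q) ^ (1 / (2 * q))) := by
  have hi : Integrable (fun x : ℝ => Real.exp (-(q / (8 * s)) * x ^ 2)) :=
    integrable_exp_neg_mul_sq (by positivity)
  rw [eLpNorm_eq_lintegral_rpow_enorm_toReal (by simpa using hq) ENNReal.ofReal_ne_top,
    ENNReal.toReal_ofReal hq.le]
  have e : ∀ x : ℝ, ‖Real.exp (-(x ^ 2 / (8 * s)))‖ₑ ^ q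
      = ENNReal.ofReal (Real.exp (-(q / (8 * s)) * x ^ 2)) := by
    intro x
    rw [Real.enorm_eq_ofReal (Real.exp_pos _).le, ENNReal.ofReal_rpow_of_pos (Real.exp_pos _),
      ← Real.exp_mul]
    congr 2; ring
  simp_rw [e]
  rw [← ofReal_integral_eq_lintegral_ofReal hi (ae_of_all _ fun x => (Real.exp_pos _).le),
    integral_gaussian, ENNReal.ofReal_rpow_of_nonneg (by positivity) (by positivity),
    Real.sqrt_eq_rpow, ← Real.rpow_mul (by positivity)]
  congr 2
  · field_simp
  · field_simp

theorem eLpNorm_le_of_gaussian_bound {k : ℝ → ℝ} {s q A : ℝ} (hs : 0 < s) (hq : 0 < q)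
    (hA : 0 ≤ A) (h : ∀ x, |k x| ≤ A * Real.exp (-(x ^ 2 / (8 * s)))) :
    eLpNorm k (ENNReal.ofReal q) volume
      ≤ ENNReal.ofReal (A * (8 * Real.pi * s / q) ^ (1 / (2 * q))) := by
  rw [ENNReal.ofReal_mul hA, ← eLpNorm_gaussian hs hq]
  refine eLpNorm_le_mul_eLpNorm_of_ae_le_mul (ae_of_all _ fun x => ?_) _
  rw [Real.norm_eq_abs, Real.norm_eq_abs, abs_of_pos (Real.exp_pos _)]
  exact h x

theorem memLp_of_gaussian_bound {k : ℝ → ℝ} {s A : ℝ} (hs : 0 < s) (hk : Continuous k)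
    (hA : 0 ≤ A) (h : ∀ x, |k x| ≤ A * Real.exp (-(x ^ 2 / (8 * s)))) (q : ℝ≥0∞) :
    MemLp k q volume := by
  rcases eq_or_ne q 0 with rfl | h0
  · exact memLp_zero_iff_aestronglyMeasurable.2 hk.aestronglyMeasurable
  rcases eq_or_ne q ∞ with rfl | ht
  · refine memLp_top_of_bound hk.aestronglyMeasurable A (ae_of_all _ fun x => ?_)
    refine (h x).trans (mul_le_of_le_one_right hA (Real.exp_le_one_iff.2 ?_))
    have : 0 ≤ x ^ 2 / (8 * s) := by positivity
    linarith
  · refine ⟨hk.aestronglyMeasurable, ?_⟩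
    have := eLpNorm_le_of_gaussian_bound hs (ENNReal.toReal_pos h0 ht) hA h
    rw [ENNReal.ofReal_toReal ht] at this
    exact this.trans_lt ENNReal.ofReal_lt_top

theorem memLp_heatKernel (s : ℝ) (q : ℝ≥0∞) : MemLp (heatKernel s) q volume := by
  rcases le_or_gt s 0 with hs | hs
  · rw [show heatKernel s = 0 from funext (heatKernel_of_nonpos hs)]
    exact MemLp.zero
  · exact memLp_of_gaussian_bound hs (continuous_heatKernel s) (by positivity)
      (abs_heatKernel_le hs) q

theorem memLp_heatKernelDx (s : ℝ) (q : ℝ≥0∞) : MemLp (heatKernelDx s) q volume := by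
  rcases le_or_gt s 0 with hs | hs
  · rw [show heatKernelDx s = 0 from funext (heatKernelDx_of_nonpos hs)]
    exact MemLp.zero
  · exact memLp_of_gaussian_bound hs (continuous_heatKernelDx s) (by positivity)
      (abs_heatKernelDx_le hs) q

/-- The `L^q` norms of a function dominated by `s ^ (-a) * exp (-x² / 8s)` on a bounded time
interval: they are `O(s ^ (-3/4))` whenever `a - 1 / (2q) ≤ 3/4`. -/
theorem exists_eLpNorm_le_rpow (T : ℝ) {a q : ℝ} (hT : 0 < T) (hq : 0 < q)
    (haq : a - 1 / (2 * q) ≤ 3 / 4) :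
    ∃ A : ℝ, 0 < A ∧ ∀ s ∈ Ioc 0 T, ∀ k : ℝ → ℝ,
      (∀ x, |k x| ≤ s ^ (-a) * Real.exp (-(x ^ 2 / (8 * s)))) →
      eLpNorm k (ENNReal.ofReal q) volume ≤ ENNReal.ofReal (A * s ^ (-(3 / 4) : ℝ)) := by
  have hpi := Real.pi_pos
  refine ⟨(8 * Real.pi / q) ^ (1 / (2 * q)) * T ^ (3 / 4 - (a - 1 / (2 * q))), by positivity,
    fun s hs k hk => ?_⟩
  have h0 := hs.1
  refine (eLpNorm_le_of_gaussian_bound hs.1 hq (by positivity) hk).trans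
    (ENNReal.ofReal_le_ofReal ?_)
  have e1 : 8 * Real.pi * s / q = (8 * Real.pi / q) * s := by ring
  rw [e1, Real.mul_rpow (by positivity) h0.le]
  have e2 : s ^ (-a) * s ^ (1 / (2 * q))
      = s ^ (3 / 4 - (a - 1 / (2 * q))) * s ^ (-(3 / 4) : ℝ) := by
    rw [← Real.rpow_add h0, ← Real.rpow_add h0]; congr 1; ring
  calc s ^ (-a) * ((8 * Real.pi / q) ^ (1 / (2 * q)) * s ^ (1 / (2 * q)))
      = (8 * Real.pi / q) ^ (1 / (2 * q)) * (s ^ (-a) * s ^ (1 / (2 * q))) := by ring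
    _ = (8 * Real.pi / q) ^ (1 / (2 * q)) *
        (s ^ (3 / 4 - (a - 1 / (2 * q))) * s ^ (-(3 / 4) : ℝ)) := by rw [e2]
    _ ≤ (8 * Real.pi / q) ^ (1 / (2 * q)) *
        (T ^ (3 / 4 - (a - 1 / (2 * q))) * s ^ (-(3 / 4) : ℝ)) := by
        gcongr
        exact hs.2
    _ = _ := by ring

/-- On a bounded time interval, the `L¹` and `L²` norms of `G(s, ·)` and `∂ₓG(s, ·)` are
`O(s ^ (-3/4))`. The worst of the four is the `L²` norm of `∂ₓG(s, ·)`. -/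
theorem exists_eLpNorm_heatKernel_le (T : ℝ) (hT : 0 < T) :
    ∃ A : ℝ, 0 < A ∧ ∀ s ∈ Ioc 0 T, ∀ q : ℝ≥0∞, q = 1 ∨ q = 2 →
      eLpNorm (heatKernel s) q volume ≤ ENNReal.ofReal (A * s ^ (-(3 / 4) : ℝ)) ∧
      eLpNorm (heatKernelDx s) q volume ≤ ENNReal.ofReal (A * s ^ (-(3 / 4) : ℝ)) := by
  obtain ⟨A1, p1, h1⟩ := exists_eLpNorm_le_rpow T (a := 1 / 2) hT one_pos (by norm_num)
  obtain ⟨A2, p2, h2⟩ := exists_eLpNorm_le_rpow T (a := 1) hT one_pos (by norm_num)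
  obtain ⟨A3, p3, h3⟩ := exists_eLpNorm_le_rpow T (a := 1 / 2) hT two_pos (by norm_num)
  obtain ⟨A4, p4, h4⟩ := exists_eLpNorm_le_rpow T (a := 1) hT two_pos (by norm_num)
  rw [ENNReal.ofReal_one] at h1 h2
  rw [ENNReal.ofReal_ofNat] at h3 h4
  refine ⟨A1 + A2 + A3 + A4, by positivity, fun s hs q hq => ?_⟩
  have hs0 := hs.1
  have hp : 0 ≤ s ^ (-(3 / 4) : ℝ) := by positivity
  rcases hq with rfl | rfl
  · exact ⟨(h1 s hs _ (abs_heatKernel_le hs0)).trans (ENNReal.ofReal_le_ofReal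
        (mul_le_mul_of_nonneg_right (by linarith) hp)),
      (h2 s hs _ (abs_heatKernelDx_le hs0)).trans (ENNReal.ofReal_le_ofReal
        (mul_le_mul_of_nonneg_right (by linarith) hp))⟩
  · exact ⟨(h3 s hs _ (abs_heatKernel_le hs0)).trans (ENNReal.ofReal_le_ofReal
        (mul_le_mul_of_nonneg_right (by linarith) hp)),
      (h4 s hs _ (abs_heatKernelDx_le hs0)).trans (ENNReal.ofReal_le_ofReal
        (mul_le_mul_of_nonneg_right (by linarith) hp))⟩

/-- The heat kernel has `L¹` norm at most a constant, uniformly in time. -/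
theorem exists_eLpNorm_one_heatKernel_le :
    ∃ A : ℝ, 0 < A ∧ ∀ s, eLpNorm (heatKernel s) 1 volume ≤ ENNReal.ofReal A := by
  have hpi := Real.pi_pos
  refine ⟨(8 * Real.pi) ^ (1 / 2 : ℝ), by positivity, fun s => ?_⟩
  rcases le_or_gt s 0 with hs | hs
  · rw [show heatKernel s = 0 from funext (heatKernel_of_nonpos hs), eLpNorm_zero]
    exact zero_le
  · have := eLpNorm_le_of_gaussian_bound hs one_pos (by positivity) (abs_heatKernel_le hs)
    rw [ENNReal.ofReal_one] at this
    refine this.trans_eq (congrArg _ ?_)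
    rw [div_one, mul_one, Real.mul_rpow (by positivity) hs.le, mul_left_comm,
      ← Real.rpow_add hs]
    norm_num

/-! ### Functions with values in `L^e` and their jointly measurable representatives -/

/-- Integration against a function lying in all Lebesgue spaces is a continuous functional. -/
theorem exists_clm_integral_mul {α : Type*} [MeasurableSpace α] {μ : Measure α} (e : ℝ≥0∞)
    [Fact (1 ≤ e)] {g : α → ℝ} (hg : ∀ q, MemLp g q μ) :
    ∃ L : Lp ℝ e μ →L[ℝ] ℝ, ∀ h, L h = ∫ x, g x * h x ∂μ := by
  have hc : ENNReal.HolderConjugate (ENNReal.conjExponent e) e :=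
    (ENNReal.HolderConjugate.conjExponent Fact.out).symm
  have : Fact (1 ≤ ENNReal.conjExponent e) := ⟨ENNReal.HolderConjugate.one_le _ e⟩
  refine ⟨(ContinuousLinearMap.mul ℝ ℝ).lpPairing μ _ e ((hg (ENNReal.conjExponent e)).toLp g),
    fun h => ?_⟩
  rw [ContinuousLinearMap.lpPairing_eq_integral]
  refine integral_congr_ae ?_
  filter_upwards [(hg (ENNReal.conjExponent e)).coeFn_toLp] with x hx
  simp [hx]

theorem memLp_indicator_one {α : Type*} [MeasurableSpace α] {μ : Measure α} {s : Set α}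
    (hs : MeasurableSet s) (hμ : μ s < ⊤) (q : ℝ≥0∞) :
    MemLp (s.indicator fun _ => (1 : ℝ)) q μ :=
  memLp_indicator_const q hs 1 (Or.inr hμ.ne)

theorem exists_clm_setIntegral {α : Type*} [MeasurableSpace α] {μ : Measure α} (e : ℝ≥0∞)
    [Fact (1 ≤ e)] {s : Set α} (hs : MeasurableSet s) (hμ : μ s < ⊤) :
    ∃ L : Lp ℝ e μ →L[ℝ] ℝ, ∀ h, L h = ∫ x in s, h x ∂μ := by
  obtain ⟨L, hL⟩ := exists_clm_integral_mul e (memLp_indicator_one hs hμ)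
  refine ⟨L, fun h => ?_⟩
  rw [hL, ← integral_indicator hs]
  refine integral_congr_ae (ae_of_all _ fun x => ?_)
  by_cases hx : x ∈ s <;> simp [hx]

/-- A map into a separable metric space is measurable as soon as its distances to all points are. -/
theorem stronglyMeasurable_of_measurable_edist {Ω E : Type*} [MeasurableSpace Ω]
    [PseudoEMetricSpace E] [SecondCountableTopology E] {F : Ω → E}
    (h : ∀ g, Measurable fun a => edist (F a) g) : StronglyMeasurable F := by
  borelize E
  refine Measurable.stronglyMeasurable (measurable_of_isOpen fun U hU => ?_)
  let S : Set (Set E) := {B | ∃ g r, B = Metric.eball g r ∧ B ⊆ U}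
  have hS : ⋃₀ S = U := by
    refine subset_antisymm (sUnion_subset fun B ⟨g, r, _, hB⟩ => hB) fun x hx => ?_
    obtain ⟨r, hr, hb⟩ := EMetric.mem_nhds_iff.1 (hU.mem_nhds hx)
    exact ⟨_, ⟨x, r, rfl, hb⟩, Metric.mem_eball_self hr⟩
  obtain ⟨C, hC, hCS, hCU⟩ := TopologicalSpace.isOpen_sUnion_countable S (by
    rintro B ⟨g, r, rfl, _⟩
    exact Metric.isOpen_eball)
  rw [← hS, ← hCU, sUnion_eq_biUnion, preimage_iUnion₂]
  refine MeasurableSet.biUnion hC fun B hB => ?_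
  obtain ⟨g, r, rfl, _⟩ := hCS hB
  exact measurableSet_lt (h g) measurable_const

/-- A family of elements of `L^e` with a jointly measurable representative is measurable. -/
theorem stronglyMeasurable_Lp_of_ae_eq {Ω α : Type*} [MeasurableSpace Ω] [MeasurableSpace α]
    [MeasurableSpace.CountablyGenerated α] {μ : Measure α} [SFinite μ]
    {e : ℝ≥0∞} [Fact (1 ≤ e)] (he : e ≠ ⊤) {F : Ω → Lp ℝ e μ} {G : Ω × α → ℝ}
    (hG : Measurable G) (h : ∀ a, F a =ᵐ[μ] fun x => G (a, x)) : StronglyMeasurable F := by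
  have : Fact (e ≠ ⊤) := ⟨he⟩
  refine stronglyMeasurable_of_measurable_edist fun g => ?_
  have h0 : e ≠ 0 := (zero_lt_one.trans_le (Fact.out : 1 ≤ e)).ne'
  have e1 : (fun a => edist (F a) g)
      = fun a => (∫⁻ x, ‖G (a, x) - g x‖ₑ ^ e.toReal ∂μ) ^ (1 / e.toReal) := by
    funext a
    rw [Lp.edist_def, eLpNorm_eq_lintegral_rpow_enorm_toReal h0 he]
    congr 1
    refine lintegral_congr_ae ?_
    filter_upwards [h a] with x hx
    simp [hx]
  rw [e1]
  refine Measurable.pow_const ?_ _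
  refine Measurable.lintegral_prod_right' (f := fun q : Ω × α => ‖G q - g q.2‖ₑ ^ e.toReal) ?_
  exact ((hG.sub ((Lp.stronglyMeasurable g).measurable.comp measurable_snd)).enorm).pow_const _

/-- A measurable map into `L^e(0, ∞)` has a jointly measurable representative: the limit of the
averages over shrinking intervals, by Lebesgue's differentiation theorem. -/
theorem exists_measurable_representative {Ω : Type*} [MeasurableSpace Ω] {e : ℝ≥0∞}
    [Fact (1 ≤ e)] (he : e ≠ ⊤) {z : Ω → Lp ℝ e halfLine} (hz : StronglyMeasurable z) :
    ∃ G : Ω × ℝ → ℝ, Measurable G ∧ ∀ a, z a =ᵐ[halfLine] fun x => G (a, x) := by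
  have : Fact (e ≠ ⊤) := ⟨he⟩
  borelize ↥(Lp ℝ e halfLine)
  let δ : ℕ → ℝ := fun n => 1 / ((n : ℝ) + 1)
  have hδ : ∀ n, 0 < δ n := fun n => by positivity
  let A : ℕ → Lp ℝ e halfLine → ℝ → ℝ := fun n h x =>
    (volume.real (Metric.closedBall x (δ n)))⁻¹ *
      ∫ y in Metric.closedBall x (δ n), h y ∂halfLine
  have hball : ∀ x r, halfLine (Metric.closedBall x r) < ⊤ := fun x r =>
    (Measure.restrict_apply_le _ _).trans_lt measure_closedBall_lt_top
  have hA : ∀ n, Measurable (Function.uncurry (A n)) := by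
    intro n
    refine (stronglyMeasurable_uncurry_of_continuous_of_stronglyMeasurable
      (fun x => ?_) fun h => ?_).measurable
    · obtain ⟨L, hL⟩ := exists_clm_setIntegral e
        (Metric.isClosed_closedBall (x := x) (ε := δ n)).measurableSet (hball x (δ n))
      simp only [A, ← hL]
      exact continuous_const.mul L.continuous
    · refine Measurable.stronglyMeasurable (Measurable.mul ?_ ?_)
      · simp [measureReal_def, Real.volume_closedBall]
      · have e1 : (fun x => ∫ y in Metric.closedBall x (δ n), h y ∂halfLine)
            = fun x => ∫ y, ({q : ℝ × ℝ | dist q.2 q.1 ≤ δ n}.indicator (fun q => h q.2)) (x, y)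
              ∂halfLine := by
          funext x
          rw [← integral_indicator Metric.isClosed_closedBall.measurableSet]
          rfl
        rw [e1]
        refine (StronglyMeasurable.integral_prod_right (f := fun x y =>
          ({q : ℝ × ℝ | dist q.2 q.1 ≤ δ n}.indicator (fun q => h q.2)) (x, y)) ?_).measurable
        refine StronglyMeasurable.indicator
          ((Lp.stronglyMeasurable h).comp_measurable measurable_snd) ?_
        exact measurableSet_le (measurable_snd.dist measurable_fst) measurable_const
  have hAdef : ∀ n h x, A n h x = (volume.real (Metric.closedBall x (δ n)))⁻¹ *
      ∫ y in Metric.closedBall x (δ n), h y ∂halfLine := fun _ _ _ => rfl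
  clear_value A
  refine ⟨fun q => limsup (fun n => A n (z q.1) q.2) atTop, ?_, fun a => ?_⟩
  · refine Measurable.limsup fun n => ?_
    have hzm : Measurable fun q : Ω × ℝ => (z q.1, q.2) :=
      (hz.measurable.comp measurable_fst).prodMk measurable_snd
    exact Measurable.comp (g := Function.uncurry (A n)) (hA n) hzm
  · have hl : LocallyIntegrable ((Ioi (0 : ℝ)).indicator (z a)) volume := by
      intro x
      obtain ⟨U, hU, hi⟩ := ((Lp.memLp (z a)).locallyIntegrable Fact.out) x
      refine ⟨U, hU, (integrable_indicator_iff measurableSet_Ioi).2 ?_⟩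
      rw [IntegrableOn, Measure.restrict_comm measurableSet_Ioi]
      exact hi
    have := IsUnifLocDoublingMeasure.ae_tendsto_average volume hl 1
    refine (ae_restrict_iff' measurableSet_Ioi).2 ?_
    filter_upwards [this] with x hx hx0
    have h1 := hx (fun _ : ℕ => x) δ (tendsto_nhdsWithin_iff.2
      ⟨tendsto_one_div_add_atTop_nhds_zero_nat, Eventually.of_forall fun n => hδ n⟩)
      (Eventually.of_forall fun n => by simpa using (hδ n).le)
    rw [indicator_of_mem hx0] at h1
    refine (Tendsto.limsup_eq ?_).symm
    refine h1.congr fun n => ?_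
    rw [hAdef, setAverage_eq, smul_eq_mul, setIntegral_indicator measurableSet_Ioi,
      Measure.restrict_restrict Metric.isClosed_closedBall.measurableSet]

/-- Bochner integrals in `L^e` are computed pointwise: `(∫ H dν)(x) = ∫ H(τ)(x) dν(τ)`. -/
theorem coeFn_integral_Lp_ae_eq {Ω α : Type*} [MeasurableSpace Ω] [MeasurableSpace α]
    {μ : Measure α} [SigmaFinite μ] {ν : Measure Ω} [SFinite ν] {e : ℝ≥0∞} [Fact (1 ≤ e)]
    {H : Ω → Lp ℝ e μ} (hH : Integrable H ν) {G : Ω × α → ℝ} (hG : Measurable G)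
    (h : ∀ᵐ τ ∂ν, H τ =ᵐ[μ] fun x => G (τ, x)) :
    (∫ τ, H τ ∂ν : Lp ℝ e μ) =ᵐ[μ] fun x => ∫ τ, G (τ, x) ∂ν := by
  have key : ∀ s, MeasurableSet s → μ s < ⊤ → Integrable G (ν.prod (μ.restrict s)) := by
    intro s hs hμ
    obtain ⟨L, hL⟩ := exists_clm_setIntegral e hs hμ
    have hi : ∀ f : Lp ℝ e μ, Integrable f (μ.restrict s) := fun f => by
      have : IsFiniteMeasure (μ.restrict s) := ⟨by simpa using hμ⟩
      exact ((Lp.memLp f).restrict s).integrable Fact.out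
    rw [integrable_prod_iff hG.aestronglyMeasurable]
    constructor
    · filter_upwards [h] with τ hτ
      exact (hi (H τ)).congr (ae_restrict_of_ae hτ)
    · refine Integrable.mono' (hH.norm.const_mul ‖L‖) ?_ ?_
      · exact hG.norm.stronglyMeasurable.integral_prod_right.aestronglyMeasurable
      · filter_upwards [h] with τ hτ
        rw [Real.norm_of_nonneg (integral_nonneg fun _ => norm_nonneg _)]
        have e1 : ∫ x in s, ‖G (τ, x)‖ ∂μ = L |H τ| := by
          rw [hL]
          refine integral_congr_ae (ae_restrict_of_ae ?_)
          filter_upwards [hτ, Lp.coeFn_abs (H τ)] with x h1 h2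
          rw [h2, h1, Real.norm_eq_abs]
        rw [e1]
        refine (le_abs_self _).trans ((L.le_opNorm _).trans_eq ?_)
        rw [norm_abs_eq_norm]
  refine ae_eq_of_forall_setIntegral_eq_of_sigmaFinite (fun s hs hμ => ?_) (fun s hs hμ => ?_)
    fun s hs hμ => ?_
  · have : IsFiniteMeasure (μ.restrict s) := ⟨by simpa using hμ⟩
    exact ((Lp.memLp _).restrict s).integrable Fact.out
  · exact (key s hs hμ).integral_prod_right
  · obtain ⟨L, hL⟩ := exists_clm_setIntegral e hs hμ
    rw [← hL, ← L.integral_comp_comm hH,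
      integral_integral_swap (f := fun x τ => G (τ, x)) (key s hs hμ).swap]
    refine integral_congr_ae ?_
    filter_upwards [h] with τ hτ
    rw [hL]
    exact integral_congr_ae (ae_restrict_of_ae hτ)

/-! ### Schur's test -/

/-- Schur's test: a kernel whose rows and columns are bounded in `L^q` maps `L^e` to `L^p` when
`1 / q + 1 / e = 1 + 1 / p`. -/
theorem lintegral_rpow_kernel_le {α γ : Type*} [MeasurableSpace α] [MeasurableSpace γ]
    {μ : Measure α} {ν : Measure γ} [SFinite μ] [SFinite ν] {κ : α → γ → ℝ≥0∞} {h : γ → ℝ≥0∞}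
    (hκ : Measurable (Function.uncurry κ)) (hh : AEMeasurable h ν) {p q e : ℝ}
    (hp : 1 ≤ p) (hq : 1 ≤ q) (he : 1 ≤ e) (hpqe : 1 / q + 1 / e = 1 + 1 / p) {A : ℝ≥0∞}
    (h1 : ∀ x, ∫⁻ y, κ x y ^ q ∂ν ≤ A ^ q) (h2 : ∀ y, ∫⁻ x, κ x y ^ q ∂μ ≤ A ^ q) :
    (∫⁻ x, (∫⁻ y, κ x y * h y ∂ν) ^ p ∂μ) ^ (1 / p) ≤ A * (∫⁻ y, h y ^ e ∂ν) ^ (1 / e) := by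
  have hp0 : 0 < p := by linarith
  have hq0 : 0 < q := by linarith
  have he0 : 0 < e := by linarith
  have hx : ∀ x, Measurable (κ x) := fun x => hκ.of_uncurry_left
  have hq1 : 0 ≤ 1 - 1 / q := by rw [sub_nonneg, div_le_one hq0]; exact hq
  have he1 : 0 ≤ 1 - 1 / e := by rw [sub_nonneg, div_le_one he0]; exact he
  have hp1 : 0 ≤ 1 / p := by positivity
  set N := ∫⁻ y, h y ^ e ∂ν with hN
  -- Hölder with weights `1 / p`, `1 - 1 / e`, `1 - 1 / q` for a fixed `x`.
  have step : ∀ x, ∫⁻ y, κ x y * h y ∂ν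
      ≤ (∫⁻ y, κ x y ^ q * h y ^ e ∂ν) ^ (1 / p) * (A ^ q) ^ (1 - 1 / e) * N ^ (1 - 1 / q) := by
    intro x
    have e1 : ∀ y, κ x y * h y
        = (κ x y ^ q * h y ^ e) ^ (1 / p) *
          ∏ i : Fin 2, (![fun y => κ x y ^ q, fun y => h y ^ e] i y) ^
            (![1 - 1 / e, 1 - 1 / q] i) := by
      intro y
      simp only [Fin.prod_univ_two, Matrix.cons_val_zero, Matrix.cons_val_one]
      rw [ENNReal.mul_rpow_of_nonneg _ _ hp1]
      simp only [← ENNReal.rpow_mul]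
      have a1 : κ x y = κ x y ^ (q * (1 / p)) * κ x y ^ (q * (1 - 1 / e)) := by
        rw [← ENNReal.rpow_add_of_nonneg _ _ (by positivity) (by positivity), ← mul_add,
          show 1 / p + (1 - 1 / e) = 1 / q by linarith, mul_one_div_cancel hq0.ne',
          ENNReal.rpow_one]
      have a2 : h y = h y ^ (e * (1 / p)) * h y ^ (e * (1 - 1 / q)) := by
        rw [← ENNReal.rpow_add_of_nonneg _ _ (by positivity) (by positivity), ← mul_add,
          show 1 / p + (1 - 1 / q) = 1 / e by linarith, mul_one_div_cancel he0.ne',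
          ENNReal.rpow_one]
      calc κ x y * h y = (κ x y ^ (q * (1 / p)) * κ x y ^ (q * (1 - 1 / e))) *
            (h y ^ (e * (1 / p)) * h y ^ (e * (1 - 1 / q))) := by rw [← a1, ← a2]
        _ = _ := by ring
    simp_rw [e1]
    refine (ENNReal.lintegral_mul_prod_norm_pow_le Finset.univ
      (((hx x).pow_const q).aemeasurable.mul (hh.pow_const e)) ?_ (1 / p) ?_ hp1 ?_).trans ?_
    · intro i _
      fin_cases i
      · exact ((hx x).pow_const q).aemeasurable
      · exact hh.pow_const e
    · simp only [Fin.sum_univ_two, Matrix.cons_val_zero, Matrix.cons_val_one]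
      linarith
    · intro i _
      fin_cases i
      · exact he1
      · exact hq1
    · simp only [Fin.prod_univ_two, Matrix.cons_val_zero, Matrix.cons_val_one]
      rw [← mul_assoc]
      refine mul_le_mul_left (mul_le_mul_right ?_ _) _
      exact ENNReal.rpow_le_rpow (h1 x) he1
  have tonelli : ∫⁻ x, ∫⁻ y, κ x y ^ q * h y ^ e ∂ν ∂μ ≤ A ^ q * N := by
    rw [lintegral_lintegral_swap]
    · calc ∫⁻ y, ∫⁻ x, κ x y ^ q * h y ^ e ∂μ ∂ν
          = ∫⁻ y, (∫⁻ x, κ x y ^ q ∂μ) * h y ^ e ∂ν := by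
            refine lintegral_congr fun y => ?_
            rw [lintegral_mul_const _ (hκ.of_uncurry_right.pow_const q)]
        _ ≤ ∫⁻ y, A ^ q * h y ^ e ∂ν := lintegral_mono fun y => by gcongr; exact h2 y
        _ = A ^ q * N := by rw [lintegral_const_mul'' _ (hh.pow_const e)]
    · exact (hκ.pow_const q).aemeasurable.mul ((hh.pow_const e).comp_snd)
  have meas : AEMeasurable (fun x => ∫⁻ y, κ x y ^ q * h y ^ e ∂ν) μ :=
    AEMeasurable.lintegral_prod_right' (f := fun z : α × γ => κ z.1 z.2 ^ q * h z.2 ^ e)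
      ((hκ.pow_const q).aemeasurable.mul ((hh.pow_const e).comp_snd))
  calc (∫⁻ x, (∫⁻ y, κ x y * h y ∂ν) ^ p ∂μ) ^ (1 / p)
      ≤ (∫⁻ x, ((∫⁻ y, κ x y ^ q * h y ^ e ∂ν) ^ (1 / p) * (A ^ q) ^ (1 - 1 / e) *
          N ^ (1 - 1 / q)) ^ p ∂μ) ^ (1 / p) := by
        gcongr with x
        exact step x
    _ = (∫⁻ x, (∫⁻ y, κ x y ^ q * h y ^ e ∂ν) *
          ((A ^ q) ^ (1 - 1 / e) * N ^ (1 - 1 / q)) ^ p ∂μ) ^ (1 / p) := by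
        congr 2
        funext x
        rw [mul_assoc, ENNReal.mul_rpow_of_nonneg _ _ hp0.le, ← ENNReal.rpow_mul,
          one_div_mul_cancel hp0.ne', ENNReal.rpow_one]
    _ = ((∫⁻ x, ∫⁻ y, κ x y ^ q * h y ^ e ∂ν ∂μ) *
          ((A ^ q) ^ (1 - 1 / e) * N ^ (1 - 1 / q)) ^ p) ^ (1 / p) := by
        rw [lintegral_mul_const'' _ meas]
    _ ≤ ((A ^ q * N) * ((A ^ q) ^ (1 - 1 / e) * N ^ (1 - 1 / q)) ^ p) ^ (1 / p) := by gcongr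
    _ = A * N ^ (1 / e) := by
        rw [ENNReal.mul_rpow_of_nonneg _ _ hp1, ← ENNReal.rpow_mul, mul_one_div_cancel hp0.ne',
          ENNReal.rpow_one, ENNReal.mul_rpow_of_nonneg _ _ hp1]
        have a1 : (A ^ q) ^ (1 / p) * (A ^ q) ^ (1 - 1 / e) = A := by
          rw [← ENNReal.rpow_add_of_nonneg _ _ hp1 he1, ← ENNReal.rpow_mul,
            show 1 / p + (1 - 1 / e) = 1 / q by linarith, mul_one_div_cancel hq0.ne',
            ENNReal.rpow_one]
        have a2 : N ^ (1 / p) * N ^ (1 - 1 / q) = N ^ (1 / e) := by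
          rw [← ENNReal.rpow_add_of_nonneg _ _ hp1 hq1]
          congr 1; linarith
        calc _ = ((A ^ q) ^ (1 / p) * (A ^ q) ^ (1 - 1 / e)) *
              (N ^ (1 / p) * N ^ (1 - 1 / q)) := by ring
          _ = _ := by rw [a1, a2]

/-! ### Reflected convolutions on the half-line -/

/-- The kernel `k(x - y) + c k(x + y)`: the reflected translate of `k`, which is the Dirichlet
kernel for `c = -1` and the Neumann kernel for `c = 1`. -/
def halfKernel (c : ℝ) (k : ℝ → ℝ) (x y : ℝ) : ℝ := k (x - y) + c * k (x + y)

/-- The reflected convolution `∫₀^∞ (k(x - y) + c k(x + y)) h(y) dy`. -/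
def halfConv (c : ℝ) (k h : ℝ → ℝ) (x : ℝ) : ℝ := ∫ y in Ioi 0, halfKernel c k x y * h y

theorem dirichletConv_eq_halfConv (t : ℝ) (f : ℝ → ℝ) :
    dirichletConv t f = halfConv (-1) (heatKernel t) f := by
  funext x
  simp only [dirichletConv, halfConv, halfKernel, neg_one_mul, sub_eq_add_neg]

section Convolution

variable {c : ℝ} {k : ℝ → ℝ} {e q p : ℝ≥0∞}

theorem measurable_halfKernel (hk : Measurable k) :
    Measurable (Function.uncurry (halfKernel c k)) := by
  unfold halfKernel Function.uncurry
  fun_prop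

theorem memLp_halfKernel_right (hk : MemLp k q volume) (x : ℝ) :
    MemLp (halfKernel c k x) q halfLine := by
  have h1 :=
    (hk.comp_measurePreserving (Measure.measurePreserving_sub_left volume x)).restrict (Ioi 0)
  have h2 := (hk.comp_measurePreserving (measurePreserving_add_left volume x)).restrict (Ioi 0)
  exact h1.add (h2.const_mul c)

theorem eLpNorm_add_mul_le {α : Type*} [MeasurableSpace α] {μ : Measure α} {f g : α → ℝ}
    (hf : AEStronglyMeasurable f μ) (hg : AEStronglyMeasurable g μ) (hc : |c| ≤ 1) (hq : 1 ≤ q) :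
    eLpNorm (fun x => f x + c * g x) q μ ≤ eLpNorm f q μ + eLpNorm g q μ := by
  refine (eLpNorm_add_le hf (hg.const_mul c) hq).trans ?_
  gcongr
  refine eLpNorm_mono fun x => ?_
  rw [norm_mul]
  exact mul_le_of_le_one_left (norm_nonneg _) hc

theorem eLpNorm_halfKernel_right_le (hk : AEStronglyMeasurable k volume) (hc : |c| ≤ 1)
    (hq : 1 ≤ q) (x : ℝ) :
    eLpNorm (halfKernel c k x) q halfLine ≤ 2 * eLpNorm k q volume := by
  have m1 := Measure.measurePreserving_sub_left (volume : Measure ℝ) x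
  have m2 := measurePreserving_add_left (volume : Measure ℝ) x
  refine (eLpNorm_mono_measure _ Measure.restrict_le_self).trans ?_
  refine (eLpNorm_add_mul_le (hk.comp_measurePreserving m1) (hk.comp_measurePreserving m2)
    hc hq).trans_eq ?_
  rw [eLpNorm_comp_measurePreserving hk m1, eLpNorm_comp_measurePreserving hk m2, two_mul]

theorem eLpNorm_halfKernel_left_le (hk : AEStronglyMeasurable k volume) (hc : |c| ≤ 1)
    (hq : 1 ≤ q) (y : ℝ) :
    eLpNorm (fun x => halfKernel c k x y) q halfLine ≤ 2 * eLpNorm k q volume := by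
  have m1 := measurePreserving_sub_right (volume : Measure ℝ) y
  have m2 := measurePreserving_add_right (volume : Measure ℝ) y
  refine (eLpNorm_mono_measure _ Measure.restrict_le_self).trans ?_
  refine (eLpNorm_add_mul_le (hk.comp_measurePreserving m1) (hk.comp_measurePreserving m2)
    hc hq).trans_eq ?_
  rw [eLpNorm_comp_measurePreserving hk m1, eLpNorm_comp_measurePreserving hk m2, two_mul]

theorem exists_integral_halfKernel_mul_le (hk : ∀ q, MemLp k q volume) (hc : |c| ≤ 1) (he : 1 ≤ e)
    {h : ℝ → ℝ} (hh : MemLp h e halfLine) :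
    ∃ C, ∀ x, Integrable (fun y => halfKernel c k x y * h y) halfLine ∧
      ∫ y in Ioi 0, ‖halfKernel c k x y * h y‖ ≤ C := by
  have hconj : ENNReal.HolderConjugate (ENNReal.conjExponent e) e :=
    (ENNReal.HolderConjugate.conjExponent he).symm
  have he' : 1 ≤ ENNReal.conjExponent e := ENNReal.HolderConjugate.one_le _ e
  refine ⟨(2 * eLpNorm k (ENNReal.conjExponent e) volume * eLpNorm h e halfLine).toReal,
    fun x => ?_⟩
  have hi : Integrable (fun y => halfKernel c k x y * h y) halfLine :=
    (memLp_halfKernel_right (hk (ENNReal.conjExponent e)) x).integrable_mul hh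
  refine ⟨hi, ?_⟩
  rw [integral_norm_eq_lintegral_enorm hi.aestronglyMeasurable]
  refine ENNReal.toReal_mono ?_ ?_
  · exact ENNReal.mul_ne_top (ENNReal.mul_ne_top (by norm_num) (hk _).eLpNorm_ne_top)
      hh.eLpNorm_ne_top
  · rw [← eLpNorm_one_eq_lintegral_enorm]
    refine (eLpNorm_smul_le_mul_eLpNorm (p := ENNReal.conjExponent e) (q := e) (r := 1)
      (φ := halfKernel c k x) hh.1
      (memLp_halfKernel_right (hk (ENNReal.conjExponent e)) x).1).trans ?_
    gcongr
    exact eLpNorm_halfKernel_right_le (hk 1).1 hc he' x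

theorem integrable_halfKernel_mul (hk : ∀ q, MemLp k q volume) (he : 1 ≤ e)
    {h : ℝ → ℝ} (hh : MemLp h e halfLine) (x : ℝ) :
    Integrable (fun y => halfKernel c k x y * h y) halfLine := by
  have hconj : ENNReal.HolderConjugate (ENNReal.conjExponent e) e :=
    (ENNReal.HolderConjugate.conjExponent he).symm
  exact (memLp_halfKernel_right (hk (ENNReal.conjExponent e)) x).integrable_mul hh

theorem halfConv_congr_ae {h h' : ℝ → ℝ} (H : h =ᵐ[halfLine] h') :
    halfConv c k h = halfConv c k h' := by
  funext x
  refine integral_congr_ae ?_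
  filter_upwards [H] with y hy
  rw [hy]

theorem halfConv_add {e' : ℝ≥0∞} (hk : ∀ q, MemLp k q volume) (he : 1 ≤ e) (he' : 1 ≤ e')
    {h h' : ℝ → ℝ} (hh : MemLp h e halfLine) (hh' : MemLp h' e' halfLine) (x : ℝ) :
    halfConv c k (fun y => h y + h' y) x = halfConv c k h x + halfConv c k h' x := by
  unfold halfConv
  rw [← integral_add (integrable_halfKernel_mul hk he hh x)
    (integrable_halfKernel_mul hk he' hh' x)]
  simp only [mul_add]

theorem halfConv_sub (hk : ∀ q, MemLp k q volume) (he : 1 ≤ e)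
    {h h' : ℝ → ℝ} (hh : MemLp h e halfLine) (hh' : MemLp h' e halfLine) (x : ℝ) :
    halfConv c k (fun y => h y - h' y) x = halfConv c k h x - halfConv c k h' x := by
  unfold halfConv
  rw [← integral_sub (integrable_halfKernel_mul hk he hh x)
    (integrable_halfKernel_mul hk he hh' x)]
  simp only [mul_sub]

theorem measurable_halfConv_param {Ω : Type*} [MeasurableSpace Ω] {K : Ω → ℝ → ℝ}
    (hK : Measurable (Function.uncurry K)) {H : Ω × ℝ → ℝ} (hH : Measurable H) :
    Measurable fun q : Ω × ℝ => halfConv c (K q.1) (fun y => H (q.1, y)) q.2 := by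
  unfold halfConv halfKernel
  refine StronglyMeasurable.measurable (StronglyMeasurable.integral_prod_right
    (f := fun (q : Ω × ℝ) (y : ℝ) => (K q.1 (q.2 - y) + c * K q.1 (q.2 + y)) * H (q.1, y)) ?_)
  refine Measurable.stronglyMeasurable ?_
  have a1 : Measurable fun q : (Ω × ℝ) × ℝ => K q.1.1 (q.1.2 - q.2) :=
    hK.comp (measurable_fst.fst.prodMk (measurable_fst.snd.sub measurable_snd))
  have a2 : Measurable fun q : (Ω × ℝ) × ℝ => K q.1.1 (q.1.2 + q.2) :=
    hK.comp (measurable_fst.fst.prodMk (measurable_fst.snd.add measurable_snd))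
  exact (a1.add (a2.const_mul c)).mul (hH.comp (measurable_fst.fst.prodMk measurable_snd))

theorem measurable_halfConv (hk : Measurable k) {h : ℝ → ℝ} (hh : AEMeasurable h halfLine) :
    Measurable (halfConv c k h) := by
  rw [halfConv_congr_ae hh.ae_eq_mk]
  exact (measurable_halfConv_param (Ω := Unit) (K := fun _ => k) (hk.comp measurable_snd)
    (hh.measurable_mk.comp measurable_snd)).comp (measurable_const (a := ()).prodMk measurable_id)

/-- Exponents admissible in Young's inequality `L^q * L^e → L^p`. -/
structure YoungExponents (q e p : ℝ≥0∞) : Prop where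
  one_le_q : 1 ≤ q
  one_le_e : 1 ≤ e
  one_le_p : 1 ≤ p
  q_ne_top : q ≠ ⊤
  e_ne_top : e ≠ ⊤
  p_ne_top : p ≠ ⊤
  sum_eq : 1 / q.toReal + 1 / e.toReal = 1 + 1 / p.toReal

/-- Young's inequality for reflected convolutions. -/
theorem eLpNorm_halfConv_le (Y : YoungExponents q e p) (hk : Measurable k) (hc : |c| ≤ 1)
    {h : ℝ → ℝ} (hh : AEMeasurable h halfLine) :
    eLpNorm (halfConv c k h) p halfLine ≤ 2 * eLpNorm k q volume * eLpNorm h e halfLine := by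
  have tp : 1 ≤ p.toReal := by simpa using ENNReal.toReal_mono Y.p_ne_top Y.one_le_p
  have tq : 1 ≤ q.toReal := by simpa using ENNReal.toReal_mono Y.q_ne_top Y.one_le_q
  have te : 1 ≤ e.toReal := by simpa using ENNReal.toReal_mono Y.e_ne_top Y.one_le_e
  have p0 : p ≠ 0 := (zero_lt_one.trans_le Y.one_le_p).ne'
  have q0 : q ≠ 0 := (zero_lt_one.trans_le Y.one_le_q).ne'
  have e0 : e ≠ 0 := (zero_lt_one.trans_le Y.one_le_e).ne'
  have conv : ∀ f : ℝ → ℝ, eLpNorm f q halfLine ≤ 2 * eLpNorm k q volume →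
      ∫⁻ y, ‖f y‖ₑ ^ q.toReal ∂halfLine ≤ (2 * eLpNorm k q volume) ^ q.toReal := by
    intro f hf
    rw [lintegral_rpow_enorm_eq_rpow_eLpNorm' (by linarith), ← eLpNorm_eq_eLpNorm' q0 Y.q_ne_top]
    exact ENNReal.rpow_le_rpow hf (by linarith)
  have := lintegral_rpow_kernel_le (μ := halfLine) (ν := halfLine)
    (κ := fun x y => ‖halfKernel c k x y‖ₑ) (h := fun y => ‖h y‖ₑ)
    (measurable_halfKernel hk).enorm hh.enorm tp tq te Y.sum_eq (A := 2 * eLpNorm k q volume)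
    (fun x => conv _ (eLpNorm_halfKernel_right_le hk.aestronglyMeasurable hc Y.one_le_q x))
    (fun y => conv _ (eLpNorm_halfKernel_left_le hk.aestronglyMeasurable hc Y.one_le_q y))
  rw [eLpNorm_eq_lintegral_rpow_enorm_toReal e0 Y.e_ne_top,
    eLpNorm_eq_lintegral_rpow_enorm_toReal p0 Y.p_ne_top]
  refine le_trans ?_ this
  gcongr with x
  refine (enorm_integral_le_lintegral_enorm _).trans_eq ?_
  simp only [enorm_mul]

theorem memLp_halfConv (Y : YoungExponents q e p) (hk : Measurable k) (hkq : MemLp k q volume)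
    (hc : |c| ≤ 1) {h : ℝ → ℝ} (hh : MemLp h e halfLine) : MemLp (halfConv c k h) p halfLine := by
  refine ⟨(measurable_halfConv hk hh.1.aemeasurable).aestronglyMeasurable, ?_⟩
  refine (eLpNorm_halfConv_le Y hk hc hh.1.aemeasurable).trans_lt ?_
  exact ENNReal.mul_lt_top (ENNReal.mul_lt_top (by norm_num) hkq.2) hh.2

/-- Differentiating the Dirichlet convolution in `x` puts the derivative on the kernel. -/
theorem isWeakDeriv_halfConv {k' : ℝ → ℝ} (hk : ∀ q, MemLp k q volume)
    (hk' : ∀ q, MemLp k' q volume) (hd : ∀ x, HasDerivAt k (k' x) x) (hkc : Continuous k')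
    (hc : |c| ≤ 1) (he : 1 ≤ e) {h : ℝ → ℝ} (hh : MemLp h e halfLine) :
    IsWeakDeriv (halfConv c k h) (halfConv c k' h) := by
  have hkm : Continuous k := continuous_iff_continuousAt.2 fun x => (hd x).continuousAt
  intro φ h1 h2 h3
  have hφ' : Continuous (deriv φ) := h1.continuous_deriv (by simp)
  -- Fubini's theorem for a bounded continuous kernel against a test function.
  have fub : ∀ κ g : ℝ → ℝ, Continuous κ → (∀ q, MemLp κ q volume) → Continuous g →
      HasCompactSupport g → ∫ x in Ioi 0, halfConv c κ h x * g x
        = ∫ y in Ioi 0, (∫ x in Ioi 0, halfKernel c κ x y * g x) * h y := by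
    intro κ g hκc hκ hg hgs
    obtain ⟨C, hC⟩ := exists_integral_halfKernel_mul_le hκ hc he hh
    have hgi : Integrable g halfLine := (hg.integrable_of_hasCompactSupport hgs).restrict
    have hm : AEStronglyMeasurable (fun z : ℝ × ℝ => halfKernel c κ z.1 z.2 * h z.2 * g z.1)
        (halfLine.prod halfLine) :=
      ((measurable_halfKernel hκc.measurable).aestronglyMeasurable.mul hh.1.comp_snd).mul
        hg.aestronglyMeasurable.comp_fst
    have hI : Integrable (fun z : ℝ × ℝ => halfKernel c κ z.1 z.2 * h z.2 * g z.1)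
        (halfLine.prod halfLine) := by
      rw [integrable_prod_iff hm]
      refine ⟨ae_of_all _ fun x => (hC x).1.mul_const (g x), ?_⟩
      refine Integrable.mono' (hgi.norm.const_mul C) hm.norm.integral_prod_right' ?_
      refine ae_of_all _ fun x => ?_
      rw [Real.norm_of_nonneg (integral_nonneg fun _ => norm_nonneg _)]
      simp only [norm_mul (_ * _)]
      rw [integral_mul_const]
      exact mul_le_mul_of_nonneg_right (hC x).2 (norm_nonneg _)
    calc ∫ x in Ioi 0, halfConv c κ h x * g x
        = ∫ x in Ioi 0, ∫ y in Ioi 0, halfKernel c κ x y * h y * g x := by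
          simp only [halfConv, integral_mul_const]
      _ = ∫ y in Ioi 0, ∫ x in Ioi 0, halfKernel c κ x y * h y * g x :=
          integral_integral_swap (f := fun x y => halfKernel c κ x y * h y * g x) hI
      _ = _ := by
          refine integral_congr_ae (ae_of_all _ fun y => ?_)
          simp only
          rw [← integral_mul_const]
          refine integral_congr_ae (ae_of_all _ fun x => ?_)
          simp only
          ring
  rw [fub k _ hkm hk hφ' h2.deriv, fub k' _ hkc hk' h1.continuous h2, ← integral_neg]
  refine integral_congr_ae (ae_of_all _ fun y => ?_)
  simp only
  rw [← neg_mul]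
  congr 1
  have z1 : ∀ x, x ∉ Ioi (0 : ℝ) → halfKernel c k x y * deriv φ x = 0 := fun x hx => by
    rw [image_eq_zero_of_notMem_tsupport (f := deriv φ)
      (fun hx' => hx (h3 (tsupport_deriv_subset hx'))), mul_zero]
  have z2 : ∀ x, x ∉ Ioi (0 : ℝ) → halfKernel c k' x y * φ x = 0 := fun x hx => by
    rw [image_eq_zero_of_notMem_tsupport (fun hx' => hx (h3 hx')), mul_zero]
  rw [setIntegral_eq_integral_of_forall_compl_eq_zero z1,
    setIntegral_eq_integral_of_forall_compl_eq_zero z2]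
  have dK : ∀ x, HasDerivAt (fun x => halfKernel c k x y) (halfKernel c k' x y) x := fun x =>
    ((hd (x - y)).comp_sub_const x y).add (((hd (x + y)).comp_add_const x y).const_mul c)
  have cK : Continuous fun x => halfKernel c k x y := by unfold halfKernel; fun_prop
  have cK' : Continuous fun x => halfKernel c k' x y := by unfold halfKernel; fun_prop
  refine integral_mul_deriv_eq_deriv_mul_of_integrable (fun x _ => dK x)
    (fun x _ => (h1.differentiable (by simp) x).hasDerivAt) ?_ ?_ ?_
  · exact (cK.mul hφ').integrable_of_hasCompactSupport h2.deriv.mul_left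
  · exact (cK'.mul h1.continuous).integrable_of_hasCompactSupport h2.mul_left
  · exact (cK.mul h1.continuous).integrable_of_hasCompactSupport h2.mul_left

end Convolution

/-! ### The Dirichlet heat semigroup and its derivative as operators `L^e → L^p` -/

section Operators

variable {e p q : ℝ≥0∞}

/-- The class in `L^p` of the reflected convolution with `k`, and `0` if it is not in `L^p`. -/
def halfConvLp (p : ℝ≥0∞) (c : ℝ) (k : ℝ → ℝ) (h : Lp ℝ e halfLine) : Lp ℝ p halfLine :=
  open Classical in if H : MemLp (halfConv c k h) p halfLine then H.toLp _ else 0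

theorem coeFn_halfConvLp (Y : YoungExponents q e p) {c : ℝ} {k : ℝ → ℝ} (hk : Measurable k)
    (hkq : MemLp k q volume) (hc : |c| ≤ 1) (h : Lp ℝ e halfLine) :
    halfConvLp p c k h =ᵐ[halfLine] halfConv c k h := by
  have H := memLp_halfConv Y hk hkq hc (Lp.memLp h)
  rw [halfConvLp, dif_pos H]
  exact H.coeFn_toLp

theorem norm_halfConvLp_le (Y : YoungExponents q e p) {c : ℝ} {k : ℝ → ℝ} (hk : Measurable k)
    (hkq : MemLp k q volume) (hc : |c| ≤ 1) {B : ℝ} (hB : 0 ≤ B)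
    (hkB : eLpNorm k q volume ≤ ENNReal.ofReal B) (h : Lp ℝ e halfLine) :
    ‖halfConvLp p c k h‖ ≤ 2 * B * ‖h‖ := by
  rw [Lp.norm_def, Lp.norm_def, eLpNorm_congr_ae (coeFn_halfConvLp Y hk hkq hc h)]
  have h1 := (eLpNorm_halfConv_le Y hk hc (Lp.memLp h).1.aemeasurable).trans
    (mul_le_mul_left (mul_le_mul_right hkB 2) _)
  refine (ENNReal.toReal_mono ?_ h1).trans_eq ?_
  · exact ENNReal.mul_ne_top (ENNReal.mul_ne_top (by norm_num) ENNReal.ofReal_ne_top)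
      (Lp.eLpNorm_ne_top h)
  · simp [ENNReal.toReal_ofReal hB]

theorem halfConvLp_sub (Y : YoungExponents q e p) {c : ℝ} {k : ℝ → ℝ} (hk : Measurable k)
    (hkq : ∀ q, MemLp k q volume) (hc : |c| ≤ 1) (h h' : Lp ℝ e halfLine) :
    halfConvLp p c k (h - h') = halfConvLp p c k h - halfConvLp p c k h' := by
  refine Lp.ext ?_
  filter_upwards [coeFn_halfConvLp Y hk (hkq q) hc (h - h'), coeFn_halfConvLp Y hk (hkq q) hc h,
    coeFn_halfConvLp Y hk (hkq q) hc h',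
    Lp.coeFn_sub (halfConvLp p c k h) (halfConvLp p c k h')] with x h1 h2 h3 h4
  rw [h1, h4, Pi.sub_apply, h2, h3, halfConv_congr_ae (Lp.coeFn_sub h h')]
  exact halfConv_sub hkq Y.one_le_e (Lp.memLp h) (Lp.memLp h') x

theorem stronglyMeasurable_halfConvLp [Fact (1 ≤ e)] [Fact (1 ≤ p)] (Y : YoungExponents q e p)
    {Ω : Type*} [MeasurableSpace Ω]
    {c : ℝ} (hc : |c| ≤ 1) {K : Ω → ℝ → ℝ} (hK : Measurable (Function.uncurry K))
    (hKq : ∀ a, MemLp (K a) q volume) {h : Ω → Lp ℝ e halfLine} (hh : StronglyMeasurable h) :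
    StronglyMeasurable fun a => halfConvLp p c (K a) (h a) := by
  obtain ⟨H, hH, hHh⟩ := exists_measurable_representative Y.e_ne_top hh
  refine stronglyMeasurable_Lp_of_ae_eq Y.p_ne_top (measurable_halfConv_param (c := c) hK hH)
    fun a => ?_
  refine (coeFn_halfConvLp Y hK.of_uncurry_left (hKq a) hc (h a)).trans ?_
  rw [halfConv_congr_ae (hHh a)]

/-- The pair `(S(s)h, ∂ₓS(s)h)`, where `S` is the Dirichlet heat semigroup. -/
def heatPair (p : ℝ≥0∞) (s : ℝ) (h : Lp ℝ e halfLine) : Lp ℝ p halfLine × Lp ℝ p halfLine :=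
  (halfConvLp p (-1) (heatKernel s) h, halfConvLp p (-1) (heatKernelDx s) h)

theorem heatPair_fst_ae (Y : YoungExponents q e p) (s : ℝ) (h : Lp ℝ e halfLine) :
    (heatPair p s h).1 =ᵐ[halfLine] halfConv (-1) (heatKernel s) h :=
  coeFn_halfConvLp Y measurable_heatKernel.of_uncurry_left (memLp_heatKernel s q) (by simp) h

theorem heatPair_snd_ae (Y : YoungExponents q e p) (s : ℝ) (h : Lp ℝ e halfLine) :
    (heatPair p s h).2 =ᵐ[halfLine] halfConv (-1) (heatKernelDx s) h :=
  coeFn_halfConvLp Y measurable_heatKernelDx.of_uncurry_left (memLp_heatKernelDx s q) (by simp) h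

theorem heatPair_sub (Y : YoungExponents q e p) (s : ℝ) (h h' : Lp ℝ e halfLine) :
    heatPair p s (h - h') = heatPair p s h - heatPair p s h' :=
  Prod.ext
    (halfConvLp_sub Y measurable_heatKernel.of_uncurry_left (memLp_heatKernel s) (by simp) h h')
    (halfConvLp_sub Y measurable_heatKernelDx.of_uncurry_left (memLp_heatKernelDx s) (by simp) h h')

theorem norm_heatPair_le (Y : YoungExponents q e p) {s B : ℝ} (hB : 0 ≤ B)
    (h1 : eLpNorm (heatKernel s) q volume ≤ ENNReal.ofReal B)
    (h2 : eLpNorm (heatKernelDx s) q volume ≤ ENNReal.ofReal B) (h : Lp ℝ e halfLine) :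
    ‖heatPair p s h‖ ≤ 2 * B * ‖h‖ :=
  max_le
    (norm_halfConvLp_le Y measurable_heatKernel.of_uncurry_left (memLp_heatKernel s q) (by simp)
      hB h1 h)
    (norm_halfConvLp_le Y measurable_heatKernelDx.of_uncurry_left (memLp_heatKernelDx s q)
      (by simp) hB h2 h)

theorem stronglyMeasurable_heatPair [Fact (1 ≤ e)] [Fact (1 ≤ p)] (Y : YoungExponents q e p)
    {Ω : Type*} [MeasurableSpace Ω]
    {s : Ω → ℝ} (hs : Measurable s) {h : Ω → Lp ℝ e halfLine} (hh : StronglyMeasurable h) :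
    StronglyMeasurable fun a => heatPair p (s a) (h a) :=
  (stronglyMeasurable_halfConvLp Y (K := fun a => heatKernel (s a)) (by simp)
    (measurable_heatKernel.comp ((hs.comp measurable_fst).prodMk measurable_snd))
    (fun a => memLp_heatKernel (s a) q) hh).prodMk
  (stronglyMeasurable_halfConvLp Y (K := fun a => heatKernelDx (s a)) (by simp)
    (measurable_heatKernelDx.comp ((hs.comp measurable_fst).prodMk measurable_snd))
    (fun a => memLp_heatKernelDx (s a) q) hh)

theorem IsWeakDeriv.congr_ae {f f' g g' : ℝ → ℝ} (h : IsWeakDeriv f g) (hf : f =ᵐ[halfLine] f')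
    (hg : g =ᵐ[halfLine] g') : IsWeakDeriv f' g' := by
  intro φ h1 h2 h3
  have e1 : (fun x => f' x * deriv φ x) =ᵐ[halfLine] fun x => f x * deriv φ x := by
    filter_upwards [hf] with x hx
    rw [hx]
  have e2 : (fun x => g' x * φ x) =ᵐ[halfLine] fun x => g x * φ x := by
    filter_upwards [hg] with x hx
    rw [hx]
  rw [integral_congr_ae e1, integral_congr_ae e2, h φ h1 h2 h3]

theorem isWeakDeriv_heatPair (Y : YoungExponents q e p) (s : ℝ) (h : Lp ℝ e halfLine) :
    IsWeakDeriv (heatPair p s h).1 (heatPair p s h).2 :=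
  (isWeakDeriv_halfConv (memLp_heatKernel s) (memLp_heatKernelDx s) (hasDerivAt_heatKernel s)
    (continuous_heatKernelDx s) (by simp) Y.one_le_e (Lp.memLp h)).congr_ae
    (heatPair_fst_ae Y s h).symm (heatPair_snd_ae Y s h).symm

/-- Multiplication by a function, as a map of `L^p`; it is `0` if the product is not in `L^p`. -/
def mulLp (g : ℝ → ℝ) (f : Lp ℝ p halfLine) : Lp ℝ p halfLine :=
  open Classical in if H : MemLp (fun y => g y * f y) p halfLine then H.toLp _ else 0

theorem memLp_mul_of_bdd {g : ℝ → ℝ} {N : ℝ} (hg : Measurable g) (hN : ∀ y, |g y| ≤ N)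
    (f : Lp ℝ p halfLine) : MemLp (fun y => g y * f y) p halfLine :=
  (Lp.memLp f).of_le_mul (hg.aestronglyMeasurable.mul (Lp.memLp f).1) (c := N)
    (ae_of_all _ fun y => by
      rw [norm_mul]
      exact mul_le_mul_of_nonneg_right (hN y) (norm_nonneg _))

theorem coeFn_mulLp {g : ℝ → ℝ} {N : ℝ} (hg : Measurable g) (hN : ∀ y, |g y| ≤ N)
    (f : Lp ℝ p halfLine) : mulLp g f =ᵐ[halfLine] fun y => g y * f y := by
  have H := memLp_mul_of_bdd hg hN f
  rw [mulLp, dif_pos H]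
  exact H.coeFn_toLp

theorem norm_mulLp_le {g : ℝ → ℝ} {N : ℝ} (hg : Measurable g) (hN : ∀ y, |g y| ≤ N)
    (f : Lp ℝ p halfLine) : ‖mulLp g f‖ ≤ N * ‖f‖ := by
  refine Lp.norm_le_mul_norm_of_ae_le_mul ?_
  filter_upwards [coeFn_mulLp hg hN f] with y hy
  rw [hy, norm_mul]
  exact mul_le_mul_of_nonneg_right (hN y) (norm_nonneg _)

theorem mulLp_sub {g : ℝ → ℝ} {N : ℝ} (hg : Measurable g) (hN : ∀ y, |g y| ≤ N)
    (f f' : Lp ℝ p halfLine) : mulLp g (f - f') = mulLp g f - mulLp g f' := by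
  refine Lp.ext ?_
  filter_upwards [coeFn_mulLp hg hN (f - f'), coeFn_mulLp hg hN f, coeFn_mulLp hg hN f',
    Lp.coeFn_sub f f', Lp.coeFn_sub (mulLp g f) (mulLp g f')] with y h1 h2 h3 h4 h5
  rw [h1, h5, Pi.sub_apply, h2, h3, h4, Pi.sub_apply, mul_sub]

end Operators

/-! ### The first-order perturbation -/

section Perturbation

variable {p r : ℝ≥0∞}

/-- The exponents of the perturbation: `b ∂ₓv ∈ L^r` with `1 / r = 1 / 2 + 1 / p`, to which Young's
inequality with `q = 2` applies, while `γ v ∈ L^p` takes `q = 1`. -/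
structure PerturbationExponents (p r : ℝ≥0∞) : Prop where
  holder : ENNReal.HolderTriple 2 p r
  young_two : YoungExponents 2 r p
  young_one : YoungExponents 1 p p

theorem perturbationExponents (hp : 2 ≤ p) (hp' : p ≠ ⊤) :
    PerturbationExponents p (2⁻¹ + p⁻¹)⁻¹ := by
  have hp0 : p ≠ 0 := (two_pos.trans_le hp).ne'
  have h2 : p⁻¹ ≤ 2⁻¹ := ENNReal.inv_le_inv.2 hp
  have h1p : 1 ≤ p := one_le_two.trans hp
  have hr : (2⁻¹ + p⁻¹ : ℝ≥0∞) ≤ 1 := by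
    calc (2⁻¹ + p⁻¹ : ℝ≥0∞) ≤ 2⁻¹ + 2⁻¹ := by gcongr
      _ = 1 := ENNReal.inv_two_add_inv_two
  have hfin : (2⁻¹ + p⁻¹ : ℝ≥0∞) ≠ 0 := by simp
  have hpi : p⁻¹ ≠ ⊤ := ENNReal.inv_ne_top.2 hp0
  refine ⟨⟨by rw [inv_inv]⟩, ⟨one_le_two, ENNReal.one_le_inv.2 hr, h1p, by norm_num,
    ENNReal.inv_ne_top.2 hfin, hp', ?_⟩, ⟨le_rfl, h1p, h1p, by norm_num, hp', hp', by simp⟩⟩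
  rw [ENNReal.toReal_inv, ENNReal.toReal_add (by norm_num) hpi, ENNReal.toReal_inv,
    ENNReal.toReal_inv]
  simp
  ring

/-- Coefficients normalised so as to be measurable, and bounded at every time and point. -/
structure BoundedCoeff (b : ℝ → Lp ℝ 2 halfLine) (γ : ℝ × ℝ → ℝ) (Nb Nγ : ℝ) : Prop where
  measurable_b : StronglyMeasurable b
  norm_b_le : ∀ τ, ‖b τ‖ ≤ Nb
  measurable_γ : Measurable γ
  abs_γ_le : ∀ z, |γ z| ≤ Nγ

theorem BoundedCoeff.measurable_slice {b : ℝ → Lp ℝ 2 halfLine} {γ : ℝ × ℝ → ℝ} {Nb Nγ : ℝ}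
    (hc : BoundedCoeff b γ Nb Nγ) (τ : ℝ) : Measurable fun y => γ (τ, y) :=
  hc.measurable_γ.comp measurable_prodMk_left

/-- The operator `(f, g) ↦ (S(s)h, ∂ₓS(s)h)` with `h = b(τ) g + γ(τ) f`. -/
def duhamelKernel (r : ℝ≥0∞) [ENNReal.HolderTriple 2 p r]
    (b : ℝ → Lp ℝ 2 halfLine) (γ : ℝ × ℝ → ℝ)
    (s τ : ℝ) (z : Lp ℝ p halfLine × Lp ℝ p halfLine) : Lp ℝ p halfLine × Lp ℝ p halfLine :=
  heatPair p s (b τ • z.2 : Lp ℝ r halfLine) + heatPair p s (mulLp (fun y => γ (τ, y)) z.1)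

variable {b : ℝ → Lp ℝ 2 halfLine} {γ : ℝ × ℝ → ℝ} {Nb Nγ : ℝ} [ENNReal.HolderTriple 2 p r]

theorem duhamelKernel_sub (hE : PerturbationExponents p r) (hc : BoundedCoeff b γ Nb Nγ) (s τ : ℝ)
    (z w : Lp ℝ p halfLine × Lp ℝ p halfLine) :
    duhamelKernel r b γ s τ (z - w) = duhamelKernel r b γ s τ z - duhamelKernel r b γ s τ w := by
  have e1 : (b τ • (z - w).2 : Lp ℝ r halfLine) = b τ • z.2 - b τ • w.2 := by
    rw [Prod.snd_sub, sub_eq_add_neg, Lp.add_smul, Lp.smul_neg, ← sub_eq_add_neg]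
  rw [duhamelKernel, e1, heatPair_sub hE.young_two, Prod.fst_sub,
    mulLp_sub (hc.measurable_slice τ) (fun y => hc.abs_γ_le (τ, y)),
    heatPair_sub hE.young_one]
  unfold duhamelKernel
  abel

/-- The perturbation is a kernel of size `s ^ (-3/4)`, with a constant proportional to the size of
the coefficients. -/
theorem exists_norm_duhamelKernel_le [Fact (1 ≤ p)] (hE : PerturbationExponents p r)
    {T : ℝ} (hT : 0 < T) :
    ∃ A : ℝ, 0 < A ∧ ∀ (b : ℝ → Lp ℝ 2 halfLine) (γ : ℝ × ℝ → ℝ) (Nb Nγ : ℝ),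
      BoundedCoeff b γ Nb Nγ → ∀ s ∈ Ioc 0 T, ∀ τ (z : Lp ℝ p halfLine × Lp ℝ p halfLine),
        ‖duhamelKernel r b γ s τ z‖ ≤ A * (Nb + Nγ) * s ^ (-(3 / 4) : ℝ) * ‖z‖ := by
  obtain ⟨A, hA, h⟩ := exists_eLpNorm_heatKernel_le T hT
  refine ⟨2 * A, by positivity, fun b γ Nb Nγ hc s hs τ z => ?_⟩
  have hs0 := hs.1
  have hB : 0 ≤ A * s ^ (-(3 / 4) : ℝ) := by positivity
  have hNb : 0 ≤ Nb := (norm_nonneg _).trans (hc.norm_b_le 0)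
  have hNγ : 0 ≤ Nγ := (abs_nonneg _).trans (hc.abs_γ_le 0)
  have h1 := norm_heatPair_le hE.young_two hB (h s hs 2 (Or.inr rfl)).1 (h s hs 2 (Or.inr rfl)).2
    (b τ • z.2 : Lp ℝ r halfLine)
  have h2 := norm_heatPair_le hE.young_one hB (h s hs 1 (Or.inl rfl)).1 (h s hs 1 (Or.inl rfl)).2
    (mulLp (fun y => γ (τ, y)) z.1)
  have h3 : ‖(b τ • z.2 : Lp ℝ r halfLine)‖ ≤ Nb * ‖z‖ :=
    (Lp.norm_smul_le _ _).trans (mul_le_mul (hc.norm_b_le τ) (norm_snd_le z) (norm_nonneg _) hNb)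
  have h4 : ‖mulLp (fun y => γ (τ, y)) z.1‖ ≤ Nγ * ‖z‖ :=
    (norm_mulLp_le (hc.measurable_slice τ) (fun y => hc.abs_γ_le (τ, y))
      z.1).trans (mul_le_mul_of_nonneg_left (norm_fst_le z) hNγ)
  calc ‖duhamelKernel r b γ s τ z‖
      ≤ 2 * (A * s ^ (-(3 / 4) : ℝ)) * (Nb * ‖z‖) + 2 * (A * s ^ (-(3 / 4) : ℝ)) * (Nγ * ‖z‖) :=
        (norm_add_le _ _).trans (add_le_add (h1.trans (by gcongr)) (h2.trans (by gcongr)))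
    _ = _ := by ring

theorem BoundedCoeff.stronglyMeasurable_smul [Fact (1 ≤ p)] [Fact (1 ≤ r)]
    (hE : PerturbationExponents p r) (hc : BoundedCoeff b γ Nb Nγ) {g : ℝ → Lp ℝ p halfLine}
    (hg : StronglyMeasurable g) : StronglyMeasurable fun τ => (b τ • g τ : Lp ℝ r halfLine) := by
  obtain ⟨B, hB, hBb⟩ := exists_measurable_representative (by norm_num) hc.measurable_b
  obtain ⟨G, hG, hGg⟩ := exists_measurable_representative hE.young_one.p_ne_top hg
  refine stronglyMeasurable_Lp_of_ae_eq hE.young_two.e_ne_top (hB.mul hG) fun τ => ?_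
  filter_upwards [Lp.coeFn_lpSMul (r := r) (b τ) (g τ), hBb τ, hGg τ] with x h1 h2 h3
  rw [h1, Pi.smul_apply', h2, h3, smul_eq_mul]
  rfl

theorem BoundedCoeff.stronglyMeasurable_mulLp [Fact (1 ≤ p)] (hp : p ≠ ⊤)
    (hc : BoundedCoeff b γ Nb Nγ) {f : ℝ → Lp ℝ p halfLine} (hf : StronglyMeasurable f) :
    StronglyMeasurable fun τ => mulLp (fun y => γ (τ, y)) (f τ) := by
  obtain ⟨F, hF, hFf⟩ := exists_measurable_representative hp hf
  refine stronglyMeasurable_Lp_of_ae_eq hp (hc.measurable_γ.mul hF) fun τ => ?_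
  filter_upwards [coeFn_mulLp (hc.measurable_slice τ) (fun y => hc.abs_γ_le (τ, y)) (f τ),
    hFf τ] with x h1 h2
  rw [h1, h2]
  rfl

theorem stronglyMeasurable_duhamelKernel [Fact (1 ≤ p)] [Fact (1 ≤ r)]
    (hE : PerturbationExponents p r) (hc : BoundedCoeff b γ Nb Nγ)
    {z : ℝ → Lp ℝ p halfLine × Lp ℝ p halfLine} (hz : StronglyMeasurable z) :
    StronglyMeasurable fun q : ℝ × ℝ => duhamelKernel r b γ (q.1 - q.2) q.2 (z q.2) := by
  have hs : Measurable fun q : ℝ × ℝ => q.1 - q.2 := measurable_fst.sub measurable_snd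
  exact (stronglyMeasurable_heatPair hE.young_two hs
      ((hc.stronglyMeasurable_smul hE hz.snd).comp_measurable measurable_snd)).add
    (stronglyMeasurable_heatPair hE.young_one hs
      ((hc.stronglyMeasurable_mulLp hE.young_one.p_ne_top hz.fst).comp_measurable measurable_snd))

end Perturbation

/-! ### Volterra equations with a kernel of order `s ^ (-3/4)` -/

section Volterra

theorem ae_norm_le_of_memLp_top {α E : Type*} [MeasurableSpace α] [NormedAddCommGroup E]
    {μ : Measure α} {f : α → E} (hf : MemLp f ∞ μ) :
    ∀ᵐ x ∂μ, ‖f x‖ ≤ (eLpNorm f ∞ μ).toReal := by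
  filter_upwards [ae_le_eLpNormEssSup (f := f) (μ := μ)] with x h1
  rw [← toReal_enorm]
  refine ENNReal.toReal_mono hf.eLpNorm_ne_top ?_
  rwa [eLpNorm_exponent_top]

theorem integrableOn_singular_kernel {l : ℝ} (hl : 0 < l) :
    IntegrableOn (fun s : ℝ => s ^ (-(3 / 4) : ℝ) * Real.exp (-(l * s))) (Ioi 0) := by
  have := integrableOn_rpow_mul_exp_neg_mul_rpow (s := -(3 / 4)) (p := 1) (b := l) (by norm_num)
    one_pos hl
  simpa using this

theorem intervalIntegrable_singular_kernel {l t : ℝ} (hl : 0 < l) (ht : 0 ≤ t) :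
    IntervalIntegrable (fun τ : ℝ => (t - τ) ^ (-(3 / 4) : ℝ) * Real.exp (-(l * (t - τ))))
      volume 0 t := by
  have h : IntervalIntegrable (fun s : ℝ => s ^ (-(3 / 4) : ℝ) * Real.exp (-(l * s)))
      volume 0 t :=
    (intervalIntegrable_iff_integrableOn_Ioc_of_le ht).2
      ((integrableOn_singular_kernel hl).mono_set Ioc_subset_Ioi_self)
  simpa using (h.comp_sub_left t).symm

theorem integral_singular_kernel_le {l t : ℝ} (hl : 0 < l) (ht : 0 ≤ t) :
    ∫ τ in (0)..t, (t - τ) ^ (-(3 / 4) : ℝ) * Real.exp (-(l * (t - τ)))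
      ≤ Real.Gamma (1 / 4) * (1 / l) ^ (1 / 4 : ℝ) := by
  rw [intervalIntegral.integral_comp_sub_left
    (fun s : ℝ => s ^ (-(3 / 4) : ℝ) * Real.exp (-(l * s))) t, sub_self, sub_zero,
    intervalIntegral.integral_of_le ht, mul_comm (Real.Gamma _),
    ← Real.integral_rpow_mul_exp_neg_mul_Ioi (by norm_num) hl]
  norm_num only
  refine setIntegral_mono_set (integrableOn_singular_kernel hl) ?_
    Ioc_subset_Ioi_self.eventuallyLE
  filter_upwards [ae_restrict_mem measurableSet_Ioi] with s hs
  have : 0 < s := hs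
  positivity

variable {E : Type*} [NormedAddCommGroup E] [NormedSpace ℝ E]

/-- A kernel `R(t - τ, τ)` of additive operators on `E` whose norm is at most
`A (t - τ) ^ (-3/4)`. -/
structure SingularKernel (T A : ℝ) (R : ℝ → ℝ → E → E) : Prop where
  sub : ∀ s τ z w, R s τ (z - w) = R s τ z - R s τ w
  norm_le : ∀ s ∈ Ioc 0 T, ∀ τ z, ‖R s τ z‖ ≤ A * s ^ (-(3 / 4) : ℝ) * ‖z‖
  measurable : ∀ z : ℝ → E, StronglyMeasurable z →
    StronglyMeasurable fun q : ℝ × ℝ => R (q.1 - q.2) q.2 (z q.2)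

/-- The Volterra operator `u ↦ ∫₀ᵗ R(t - τ, τ) u(τ) dτ`. -/
def volterraOp (R : ℝ → ℝ → E → E) (u : ℝ → E) (t : ℝ) : E := ∫ τ in (0)..t, R (t - τ) τ (u τ)

variable {T A : ℝ} {R : ℝ → ℝ → E → E}

theorem ae_Ioc_of_ae_timeInterval {P : ℝ → Prop} (h : ∀ᵐ τ ∂timeInterval T, P τ) {t : ℝ}
    (ht : t ∈ Icc 0 T) : ∀ᵐ τ ∂volume.restrict (Ioc 0 t), P τ :=
  ae_mono (Measure.restrict_mono (Ioc_subset_Icc_self.trans (Icc_subset_Icc_right ht.2)) le_rfl) h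

theorem volterraOp_congr_ae {u u' : ℝ → E} (h : u =ᵐ[timeInterval T] u') {t : ℝ}
    (ht : t ∈ Icc 0 T) : volterraOp R u t = volterraOp R u' t := by
  unfold volterraOp
  rw [intervalIntegral.integral_of_le ht.1, intervalIntegral.integral_of_le ht.1]
  refine integral_congr_ae ?_
  filter_upwards [ae_Ioc_of_ae_timeInterval h ht] with τ hτ
  rw [hτ]

omit [NormedSpace ℝ E] in
theorem SingularKernel.aestronglyMeasurable (hR : SingularKernel T A R) {u : ℝ → E}
    (hu : AEStronglyMeasurable u (timeInterval T)) {t : ℝ} (ht : t ∈ Icc 0 T) :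
    AEStronglyMeasurable (fun τ => R (t - τ) τ (u τ)) (volume.restrict (Ioc 0 t)) := by
  have h1 : StronglyMeasurable fun τ => R (t - τ) τ (hu.mk u τ) :=
    (hR.measurable _ hu.stronglyMeasurable_mk).comp_measurable measurable_prodMk_left
  refine h1.aestronglyMeasurable.congr ?_
  filter_upwards [ae_Ioc_of_ae_timeInterval hu.ae_eq_mk ht] with τ hτ
  rw [hτ]

/-- The basic estimate in the weighted norm `sup e^{-lt}‖u(t)‖`: the singular kernel gains a factor
`l ^ (-1/4)`. -/
theorem SingularKernel.weighted_bound (hR : SingularKernel T A R) (hA : 0 ≤ A) {l N : ℝ}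
    (hl : 0 < l) {u : ℝ → E} (hu : AEStronglyMeasurable u (timeInterval T))
    (hN : ∀ᵐ τ ∂timeInterval T, ‖u τ‖ ≤ Real.exp (l * τ) * N) {t : ℝ} (ht : t ∈ Icc 0 T) :
    IntervalIntegrable (fun τ => R (t - τ) τ (u τ)) volume 0 t ∧
      (0 ≤ N → ‖volterraOp R u t‖
        ≤ Real.exp (l * t) * (A * (Real.Gamma (1 / 4) * (1 / l) ^ (1 / 4 : ℝ)) * N)) := by
  have hb : ∀ᵐ τ ∂volume.restrict (Ioc 0 t), ‖R (t - τ) τ (u τ)‖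
      ≤ (A * N * Real.exp (l * t)) *
        ((t - τ) ^ (-(3 / 4) : ℝ) * Real.exp (-(l * (t - τ)))) := by
    have hne : ∀ᵐ τ ∂volume.restrict (Ioc 0 t), τ ≠ t :=
      ae_restrict_of_ae (Measure.ae_ne volume t)
    filter_upwards [ae_Ioc_of_ae_timeInterval hN ht, hne, ae_restrict_mem measurableSet_Ioc]
      with τ h1 h2 h3
    have hpos : 0 < t - τ := sub_pos.2 (lt_of_le_of_ne h3.2 h2)
    have hs : t - τ ∈ Ioc 0 T := ⟨hpos, by linarith [h3.1, ht.2]⟩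
    calc ‖R (t - τ) τ (u τ)‖ ≤ A * (t - τ) ^ (-(3 / 4) : ℝ) * ‖u τ‖ := hR.norm_le _ hs _ _
      _ ≤ A * (t - τ) ^ (-(3 / 4) : ℝ) * (Real.exp (l * τ) * N) := by gcongr
      _ = _ := by
        rw [show l * τ = l * t + -(l * (t - τ)) by ring, Real.exp_add]
        ring
  have hint := (intervalIntegrable_singular_kernel hl ht.1).const_mul (A * N * Real.exp (l * t))
  have hI : IntervalIntegrable (fun τ => R (t - τ) τ (u τ)) volume 0 t := by
    rw [intervalIntegrable_iff_integrableOn_Ioc_of_le ht.1] at hint ⊢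
    exact Integrable.mono' hint (hR.aestronglyMeasurable hu ht) hb
  refine ⟨hI, fun hN0 => ?_⟩
  calc ‖volterraOp R u t‖
      ≤ ∫ τ in (0)..t, (A * N * Real.exp (l * t)) *
        ((t - τ) ^ (-(3 / 4) : ℝ) * Real.exp (-(l * (t - τ)))) :=
        intervalIntegral.norm_integral_le_of_norm_le ht.1
          ((ae_restrict_iff' measurableSet_Ioc).1 hb) hint
    _ = (A * N * Real.exp (l * t)) *
        ∫ τ in (0)..t, (t - τ) ^ (-(3 / 4) : ℝ) * Real.exp (-(l * (t - τ))) :=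
        intervalIntegral.integral_const_mul _ _
    _ ≤ (A * N * Real.exp (l * t)) * (Real.Gamma (1 / 4) * (1 / l) ^ (1 / 4 : ℝ)) := by
        gcongr
        exact integral_singular_kernel_le hl ht.1
    _ = _ := by ring

theorem SingularKernel.intervalIntegrable (hR : SingularKernel T A R) (hA : 0 ≤ A) {u : ℝ → E}
    (hu : MemLp u ∞ (timeInterval T)) {t : ℝ} (ht : t ∈ Icc 0 T) :
    IntervalIntegrable (fun τ => R (t - τ) τ (u τ)) volume 0 t := by
  refine (hR.weighted_bound hA one_pos hu.1 (N := (eLpNorm u ∞ (timeInterval T)).toReal) ?_ ht).1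
  filter_upwards [ae_norm_le_of_memLp_top hu, ae_restrict_mem measurableSet_Icc] with τ h3 h2
  have h4 : 1 ≤ Real.exp (1 * τ) := Real.one_le_exp (by linarith [h2.1])
  nlinarith [norm_nonneg (u τ)]

theorem SingularKernel.volterraOp_sub (hR : SingularKernel T A R) (hA : 0 ≤ A) {u u' : ℝ → E}
    (hu : MemLp u ∞ (timeInterval T)) (hu' : MemLp u' ∞ (timeInterval T)) {t : ℝ}
    (ht : t ∈ Icc 0 T) :
    volterraOp R (u - u') t = volterraOp R u t - volterraOp R u' t := by
  unfold volterraOp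
  rw [← intervalIntegral.integral_sub (hR.intervalIntegrable hA hu ht)
    (hR.intervalIntegrable hA hu' ht)]
  simp only [Pi.sub_apply, hR.sub]

theorem SingularKernel.aestronglyMeasurable_volterraOp (hR : SingularKernel T A R) {u : ℝ → E}
    (hu : AEStronglyMeasurable u (timeInterval T)) :
    AEStronglyMeasurable (volterraOp R u) (timeInterval T) := by
  have h1 : StronglyMeasurable fun q : ℝ × ℝ =>
      {q : ℝ × ℝ | q.2 ∈ Ioc 0 q.1}.indicator (fun q => R (q.1 - q.2) q.2 (hu.mk u q.2)) q := by
    refine (hR.measurable _ hu.stronglyMeasurable_mk).indicator ?_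
    exact (measurableSet_lt measurable_const measurable_snd).inter
      (measurableSet_le measurable_snd measurable_fst)
  refine (StronglyMeasurable.integral_prod_right (ν := volume) (f := fun t τ =>
    {q : ℝ × ℝ | q.2 ∈ Ioc 0 q.1}.indicator (fun q => R (q.1 - q.2) q.2 (hu.mk u q.2)) (t, τ))
    h1).aestronglyMeasurable.congr ?_
  filter_upwards [ae_restrict_mem measurableSet_Icc] with t ht
  rw [volterraOp_congr_ae hu.ae_eq_mk ht, volterraOp, intervalIntegral.integral_of_le ht.1,
    ← integral_indicator measurableSet_Ioc]
  rfl

theorem ae_norm_le_weight {u : ℝ → E} (l : ℝ)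
    (hu : MemLp (fun t => Real.exp (-(l * t)) • u t) ∞ (timeInterval T)) :
    ∀ᵐ τ ∂timeInterval T, ‖u τ‖ ≤ Real.exp (l * τ) *
      (eLpNorm (fun t => Real.exp (-(l * t)) • u t) ∞ (timeInterval T)).toReal := by
  filter_upwards [ae_norm_le_of_memLp_top hu] with τ h3
  rw [norm_smul, Real.norm_of_nonneg (Real.exp_pos _).le] at h3
  calc ‖u τ‖ = Real.exp (l * τ) * (Real.exp (-(l * τ)) * ‖u τ‖) := by
        rw [← mul_assoc, ← Real.exp_add]; simp
    _ ≤ _ := by gcongr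

theorem memLp_top_weight {u : ℝ → E} (l : ℝ) (hu : MemLp u ∞ (timeInterval T)) :
    MemLp (fun t => Real.exp (l * t) • u t) ∞ (timeInterval T) := by
  have h : MemLp (fun t => Real.exp (l * t)) ∞ (timeInterval T) := by
    refine memLp_top_of_bound (by fun_prop) (Real.exp (|l| * T)) ?_
    filter_upwards [ae_restrict_mem measurableSet_Icc] with t ht
    rw [Real.norm_of_nonneg (Real.exp_pos _).le]
    refine Real.exp_le_exp.2 ?_
    calc l * t ≤ |l| * t := mul_le_mul_of_nonneg_right (le_abs_self l) ht.1
      _ ≤ |l| * T := mul_le_mul_of_nonneg_left ht.2 (abs_nonneg l)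
  exact hu.smul h

omit [NormedSpace ℝ E] in
theorem toReal_eLpNorm_top_le {u : ℝ → E} {C : ℝ} (hC : 0 ≤ C)
    (h : ∀ᵐ t ∂timeInterval T, ‖u t‖ ≤ C) : (eLpNorm u ∞ (timeInterval T)).toReal ≤ C := by
  refine ENNReal.toReal_le_of_le_ofReal hC ?_
  rw [eLpNorm_exponent_top]
  refine eLpNormEssSup_le_of_ae_enorm_bound ?_
  filter_upwards [h] with t ht
  rw [← ofReal_norm]
  exact ENNReal.ofReal_le_ofReal ht

/-- The growth rate that makes the Volterra operator a contraction by `1 / 2`. The fourth power is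
the inverse of the gain `l ^ (-1/4)`; the summand `1` keeps the rate positive when `A = 0`. -/
def growthRate (A : ℝ) : ℝ := 1 + (2 * A * Real.Gamma (1 / 4)) ^ 4

theorem growthRate_pos (A : ℝ) : 0 < growthRate A := by
  have : 0 ≤ (2 * A * Real.Gamma (1 / 4)) ^ 4 := by positivity
  unfold growthRate
  linarith

theorem growthRate_gain (hA : 0 ≤ A) :
    A * (Real.Gamma (1 / 4) * (1 / growthRate A) ^ (1 / 4 : ℝ)) ≤ 1 / 2 := by
  have hG : 0 < Real.Gamma (1 / 4) := Real.Gamma_pos_of_pos (by norm_num)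
  have hl := growthRate_pos A
  have h1 : 2 * A * Real.Gamma (1 / 4) ≤ growthRate A ^ (1 / 4 : ℝ) := by
    have h2 : 0 ≤ 2 * A * Real.Gamma (1 / 4) := by positivity
    calc 2 * A * Real.Gamma (1 / 4)
        = ((2 * A * Real.Gamma (1 / 4)) ^ (4 : ℕ)) ^ (1 / 4 : ℝ) := by
          rw [← Real.rpow_natCast, ← Real.rpow_mul h2]; norm_num
      _ ≤ growthRate A ^ (1 / 4 : ℝ) := by
          refine Real.rpow_le_rpow (by positivity) ?_ (by norm_num)
          unfold growthRate; linarith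
  have h3 : 0 < growthRate A ^ (1 / 4 : ℝ) := by positivity
  rw [Real.div_rpow one_pos.le hl.le, Real.one_rpow, ← mul_assoc, mul_one_div, div_le_iff₀ h3]
  linarith

theorem SingularKernel.norm_volterraOp_le (hR : SingularKernel T A R) (hA : 0 ≤ A) {u : ℝ → E}
    (hu : AEStronglyMeasurable u (timeInterval T)) {N : ℝ} (hN0 : 0 ≤ N)
    (hN : ∀ᵐ τ ∂timeInterval T, ‖u τ‖ ≤ Real.exp (growthRate A * τ) * N) {t : ℝ}
    (ht : t ∈ Icc 0 T) :
    ‖volterraOp R u t‖ ≤ Real.exp (growthRate A * t) * (1 / 2 * N) := by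
  refine ((hR.weighted_bound hA (growthRate_pos A) hu hN ht).2 hN0).trans ?_
  gcongr
  exact growthRate_gain hA

theorem SingularKernel.memLp_volterraOp (hR : SingularKernel T A R) (hA : 0 ≤ A) {u : ℝ → E}
    (hu : MemLp u ∞ (timeInterval T)) : MemLp (volterraOp R u) ∞ (timeInterval T) := by
  have hw := memLp_top_weight (-growthRate A) hu
  simp only [neg_mul] at hw
  refine memLp_top_of_bound (hR.aestronglyMeasurable_volterraOp hu.1) (Real.exp (growthRate A * T) *
    (1 / 2 * (eLpNorm (fun t => Real.exp (-(growthRate A * t)) • u t) ∞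
      (timeInterval T)).toReal)) ?_
  filter_upwards [ae_restrict_mem measurableSet_Icc] with t ht
  refine (hR.norm_volterraOp_le hA hu.1 ENNReal.toReal_nonneg (ae_norm_le_weight _ hw) ht).trans ?_
  have := (growthRate_pos A).le
  gcongr
  exact ht.2

/-- A solution of `u = F + volterraOp R u` is controlled by `F`: half of the weighted norm is
absorbed. -/
theorem SingularKernel.norm_le_of_eq (hR : SingularKernel T A R) (hA : 0 ≤ A) {u F : ℝ → E} {D : ℝ}
    (hD0 : 0 ≤ D) (hu : MemLp u ∞ (timeInterval T)) (hF : ∀ t ∈ Icc 0 T, ‖F t‖ ≤ D)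
    (h : ∀ t ∈ Icc 0 T, u t = F t + volterraOp R u t) {t : ℝ} (ht : t ∈ Icc 0 T) :
    ‖u t‖ ≤ 2 * Real.exp (growthRate A * T) * D := by
  have hw := memLp_top_weight (-growthRate A) hu
  simp only [neg_mul] at hw
  have hl := growthRate_pos A
  set N := (eLpNorm (fun t => Real.exp (-(growthRate A * t)) • u t) ∞ (timeInterval T)).toReal
    with hN
  have key : ∀ t ∈ Icc 0 T, ‖u t‖ ≤ Real.exp (growthRate A * t) * (D + 1 / 2 * N) := by
    intro t ht
    have h1 := hR.norm_volterraOp_le hA hu.1 ENNReal.toReal_nonneg (ae_norm_le_weight _ hw) ht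
    have h2 : 1 ≤ Real.exp (growthRate A * t) := Real.one_le_exp (mul_nonneg hl.le ht.1)
    rw [h t ht]
    calc ‖F t + volterraOp R u t‖ ≤ D + Real.exp (growthRate A * t) * (1 / 2 * N) :=
          (norm_add_le _ _).trans (add_le_add (hF t ht) h1)
      _ ≤ Real.exp (growthRate A * t) * D + Real.exp (growthRate A * t) * (1 / 2 * N) := by
          gcongr; exact le_mul_of_one_le_left hD0 h2
      _ = _ := by ring
  have hN0 : 0 ≤ N := ENNReal.toReal_nonneg
  have hle : N ≤ D + 1 / 2 * N := by
    refine toReal_eLpNorm_top_le (by positivity) ?_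
    filter_upwards [ae_restrict_mem measurableSet_Icc] with t ht
    rw [norm_smul, Real.norm_of_nonneg (Real.exp_pos _).le]
    calc Real.exp (-(growthRate A * t)) * ‖u t‖
        ≤ Real.exp (-(growthRate A * t)) * (Real.exp (growthRate A * t) * (D + 1 / 2 * N)) := by
          gcongr; exact key t ht
      _ = _ := by rw [← mul_assoc, ← Real.exp_add]; simp
  calc ‖u t‖ ≤ Real.exp (growthRate A * t) * (D + 1 / 2 * N) := key t ht
    _ ≤ Real.exp (growthRate A * T) * (2 * D) := by
        gcongr
        · exact ht.2
        · linarith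
    _ = _ := by ring

theorem SingularKernel.eq_of_eq (hR : SingularKernel T A R) (hA : 0 ≤ A) {u w F : ℝ → E}
    (hu : MemLp u ∞ (timeInterval T)) (hw : MemLp w ∞ (timeInterval T))
    (h : ∀ t ∈ Icc 0 T, u t = F t + volterraOp R u t)
    (h' : ∀ t ∈ Icc 0 T, w t = F t + volterraOp R w t) {t : ℝ} (ht : t ∈ Icc 0 T) :
    u t = w t := by
  have := hR.norm_le_of_eq hA (F := 0) le_rfl (hu.sub hw) (by simp) (fun t ht => by
    rw [hR.volterraOp_sub hA hu hw ht, Pi.sub_apply, h t ht, h' t ht]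
    simp) ht
  rw [mul_zero] at this
  exact sub_eq_zero.1 (norm_le_zero_iff.1 this)

/-- Existence for `u = F + volterraOp R u`: the equation is a contraction of `L^∞(0, T; E)` for the
weighted norm, realised as the usual norm of `e^{-lt}u(t)`. -/
theorem SingularKernel.exists_solution [CompleteSpace E] (hR : SingularKernel T A R) (hA : 0 ≤ A)
    {F : ℝ → E} (hF : MemLp F ∞ (timeInterval T)) :
    ∃ u : ℝ → E, MemLp u ∞ (timeInterval T) ∧
      ∀ t ∈ Icc 0 T, u t = F t + volterraOp R u t := by
  set l := growthRate A with hl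
  let P : Lp E ∞ (timeInterval T) → ℝ → E := fun w t =>
    F t + volterraOp R (fun τ => Real.exp (l * τ) • w τ) t
  have hexp : ∀ w : Lp E ∞ (timeInterval T),
      MemLp (fun τ => Real.exp (l * τ) • w τ) ∞ (timeInterval T) :=
    fun w => memLp_top_weight l (Lp.memLp w)
  have hP : ∀ w, MemLp (P w) ∞ (timeInterval T) := fun w =>
    hF.add (hR.memLp_volterraOp hA (hexp w))
  have hP' : ∀ w, MemLp (fun t => Real.exp (-l * t) • P w t) ∞ (timeInterval T) := fun w =>
    memLp_top_weight (-l) (hP w)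
  let Φ : Lp E ∞ (timeInterval T) → Lp E ∞ (timeInterval T) := fun w => (hP' w).toLp _
  have hcontr : ContractingWith (1 / 2) Φ := by
    refine ⟨by rw [← NNReal.coe_lt_coe]; norm_num, LipschitzWith.of_dist_le_mul fun w w' => ?_⟩
    rw [dist_eq_norm, dist_eq_norm, Lp.norm_def]
    refine toReal_eLpNorm_top_le (by positivity) ?_
    filter_upwards [Lp.coeFn_sub (Φ w) (Φ w'), (hP' w).coeFn_toLp, (hP' w').coeFn_toLp,
      ae_restrict_mem measurableSet_Icc] with t h1 h2 h3 ht
    rw [h1, Pi.sub_apply, h2, h3, ← smul_sub, norm_smul, Real.norm_of_nonneg (Real.exp_pos _).le]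
    simp only [P]
    rw [add_sub_add_left_eq_sub, ← hR.volterraOp_sub hA (hexp w) (hexp w') ht]
    have h4 := hR.norm_volterraOp_le hA ((hexp w).sub (hexp w')).1 (norm_nonneg (w - w')) (by
      filter_upwards [Lp.coeFn_sub w w', ae_norm_le_of_memLp_top (Lp.memLp (w - w'))] with τ h5 h6
      rw [Pi.sub_apply, ← smul_sub, norm_smul, Real.norm_of_nonneg (Real.exp_pos _).le]
      gcongr
      rw [Lp.norm_def, ← Pi.sub_apply, ← h5]
      exact h6) ht
    calc _ ≤ Real.exp (-l * t) * (Real.exp (l * t) * (1 / 2 * ‖w - w'‖)) := by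
          gcongr
      _ = (1 / 2) * ‖w - w'‖ := by rw [← mul_assoc, ← Real.exp_add]; simp
      _ = _ := by norm_num
  set w := hcontr.fixedPoint Φ with hw
  have hfix : Φ w = w := hcontr.fixedPoint_isFixedPt
  refine ⟨P w, hP w, fun t ht => ?_⟩
  have hae : (fun τ => Real.exp (l * τ) • w τ) =ᵐ[timeInterval T] P w := by
    have h2 := (hP' w).coeFn_toLp
    change (Φ w : ℝ → E) =ᵐ[timeInterval T] _ at h2
    rw [hfix] at h2
    filter_upwards [h2] with τ h3
    rw [h3, smul_smul, ← Real.exp_add]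
    simp
  rw [← volterraOp_congr_ae hae ht]

end Volterra

/-! ### The boundary potential -/

theorem exp_neg_le_rpow_neg {u a : ℝ} (hu : 0 < u) (ha : 0 ≤ a) (ha1 : a ≤ 1) :
    Real.exp (-u) ≤ u ^ (-a) := by
  have h : u ^ a ≤ Real.exp u := by
    have h1 := Real.add_one_le_exp u
    rcases le_total u 1 with h2 | h2
    · linarith [Real.rpow_le_one hu.le h2 ha]
    · have := Real.rpow_le_rpow_of_exponent_le h2 ha1
      rw [Real.rpow_one] at this
      linarith
  rw [Real.rpow_neg hu.le, Real.exp_neg]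
  exact inv_anti₀ (Real.rpow_pos_of_pos hu a) h

/-- Away from `x = 0`, the Gaussian factor is `O(s²)`. -/
theorem gaussian_le_sq {s x : ℝ} (hs : 0 < s) (hx : 0 < x) :
    Real.exp (-(x ^ 2 / (8 * s))) ≤ 256 / x ^ 4 * s ^ 2 := by
  have h := exp_neg_le_rpow_neg (u := x ^ 2 / (16 * s)) (by positivity) zero_le_one le_rfl
  rw [Real.rpow_neg_one, inv_div] at h
  calc Real.exp (-(x ^ 2 / (8 * s)))
      = Real.exp (-(x ^ 2 / (16 * s))) * Real.exp (-(x ^ 2 / (16 * s))) := by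
        rw [← Real.exp_add]; congr 1; ring
    _ ≤ (16 * s / x ^ 2) * (16 * s / x ^ 2) := by gcongr
    _ = _ := by field_simp; norm_num

/-- The function of `x` that dominates `ũ(t, x)` and `∂ₓũ(t, x)` for `t ≤ T`. The exponent `a` has
to exceed `1 / 2 - β`, for the time integrals to converge, and to be below `1 / (2p)`, for
`boundaryMajorant` to lie in `L^p`. -/
def boundaryMajorant (T a x : ℝ) : ℝ := x ^ (-(2 * a)) * Real.exp (-(x ^ 2 / (16 * T)))

theorem boundaryMajorant_nonneg {T a x : ℝ} (hx : 0 < x) : 0 ≤ boundaryMajorant T a x := by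
  unfold boundaryMajorant; positivity

theorem gaussian_le_majorant {T a s x : ℝ} (ha : 0 ≤ a) (ha1 : a ≤ 1) (hs : s ∈ Ioc 0 T)
    (hx : 0 < x) :
    Real.exp (-(x ^ 2 / (8 * s))) ≤ 16 * s ^ a * boundaryMajorant T a x := by
  have hs0 := hs.1
  have h := exp_neg_le_rpow_neg (u := x ^ 2 / (16 * s)) (by positivity) ha ha1
  have h2 : (x ^ 2 / (16 * s)) ^ (-a) ≤ 16 * s ^ a * x ^ (-(2 * a)) := by
    rw [Real.div_rpow (by positivity) (by positivity), Real.mul_rpow (by norm_num) hs0.le,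
      ← Real.rpow_natCast, ← Real.rpow_mul hx.le, Real.rpow_neg (by norm_num : (0 : ℝ) ≤ 16),
      Real.rpow_neg hs0.le, div_eq_mul_inv, ← mul_inv, inv_inv, mul_comm]
    have h3 : (16 : ℝ) ^ a ≤ 16 := by
      have := Real.rpow_le_rpow_of_exponent_le (by norm_num : (1 : ℝ) ≤ 16) ha1
      rwa [Real.rpow_one] at this
    rw [show ((2 : ℕ) : ℝ) * -a = -(2 * a) by push_cast; ring]
    gcongr
  have h4 : Real.exp (-(x ^ 2 / (16 * s))) ≤ Real.exp (-(x ^ 2 / (16 * T))) := by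
    refine Real.exp_le_exp.2 (neg_le_neg ?_)
    gcongr
    exact hs.2
  calc Real.exp (-(x ^ 2 / (8 * s)))
      = Real.exp (-(x ^ 2 / (16 * s))) * Real.exp (-(x ^ 2 / (16 * s))) := by
        rw [← Real.exp_add]; congr 1; ring
    _ ≤ (16 * s ^ a * x ^ (-(2 * a))) * Real.exp (-(x ^ 2 / (16 * T))) := by
        gcongr; exact h.trans h2
    _ = _ := by unfold boundaryMajorant; ring

theorem memLp_boundaryMajorant {T a : ℝ} {p : ℝ≥0∞} (hT : 0 < T) (hp0 : p ≠ 0) (hp : p ≠ ⊤)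
    (hap : 2 * a * p.toReal < 1) : MemLp (boundaryMajorant T a) p halfLine := by
  have hP : 0 < p.toReal := ENNReal.toReal_pos hp0 hp
  have hm : Measurable (boundaryMajorant T a) := by unfold boundaryMajorant; fun_prop
  rw [← integrable_norm_rpow_iff hm.aestronglyMeasurable hp0 hp]
  have := integrableOn_rpow_mul_exp_neg_mul_sq (b := p.toReal / (16 * T))
    (s := -(2 * a * p.toReal)) (by positivity) (by linarith)
  refine this.congr ?_
  filter_upwards [ae_restrict_mem measurableSet_Ioi] with x hx
  have hx0 : 0 < x := hx
  rw [Real.norm_of_nonneg (boundaryMajorant_nonneg hx0), boundaryMajorant,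
    Real.mul_rpow (by positivity) (Real.exp_pos _).le, ← Real.rpow_mul hx0.le, ← Real.exp_mul]
  congr 2 <;> ring

theorem abs_heatKernel_le_rpow {x : ℝ} (hx : 0 < x) (s : ℝ) :
    |heatKernel s x| ≤ 256 / x ^ 4 * |s| ^ (3 / 2 : ℝ) := by
  rcases le_or_gt s 0 with hs | hs
  · rw [heatKernel_of_nonpos hs, abs_zero]; positivity
  · refine (abs_heatKernel_le hs x).trans ?_
    calc s ^ (-(1 / 2) : ℝ) * Real.exp (-(x ^ 2 / (8 * s)))
        ≤ s ^ (-(1 / 2) : ℝ) * (256 / x ^ 4 * s ^ 2) := by gcongr; exact gaussian_le_sq hs hx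
      _ = 256 / x ^ 4 * (s ^ (-(1 / 2) : ℝ) * s ^ (2 : ℝ)) := by rw [Real.rpow_two]; ring
      _ = _ := by rw [← Real.rpow_add hs, abs_of_pos hs]; norm_num

theorem continuous_heatKernel_time {x : ℝ} (hx : 0 < x) {s : ℝ} (hs : 0 ≤ s) :
    ContinuousAt (fun s => heatKernel s x) s := by
  rcases hs.eq_or_lt with rfl | hs
  · rw [ContinuousAt, heatKernel_of_nonpos le_rfl]
    refine squeeze_zero_norm (abs_heatKernel_le_rpow hx) ?_
    have h : Continuous fun s : ℝ => 256 / x ^ 4 * |s| ^ (3 / 2 : ℝ) :=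
      continuous_const.mul (continuous_abs.rpow_const fun _ => Or.inr (by norm_num))
    simpa using h.tendsto 0
  · exact (hasDerivAt_heatKernel_time hs x).continuousAt

theorem abs_heatKernelDx_le_of_pos {s x : ℝ} (hs : 0 < s) (hx : 0 < x) :
    |heatKernelDx s x| ≤ 256 / x ^ 4 * s := by
  refine (abs_heatKernelDx_le hs x).trans ?_
  calc s ^ (-1 : ℝ) * Real.exp (-(x ^ 2 / (8 * s)))
      ≤ s ^ (-1 : ℝ) * (256 / x ^ 4 * s ^ 2) := by gcongr; exact gaussian_le_sq hs hx
    _ = _ := by rw [Real.rpow_neg_one]; field_simp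

theorem abs_heatKernelDxx_le_of_pos {s x : ℝ} (hs : 0 < s) (hx : 0 < x) :
    |heatKernelDxx s x| ≤ 256 / x ^ 4 * s ^ (1 / 2 : ℝ) := by
  refine (abs_heatKernelDxx_le hs x).trans ?_
  calc s ^ (-(3 / 2) : ℝ) * Real.exp (-(x ^ 2 / (8 * s)))
      ≤ s ^ (-(3 / 2) : ℝ) * (256 / x ^ 4 * s ^ 2) := by gcongr; exact gaussian_le_sq hs hx
    _ = 256 / x ^ 4 * (s ^ (-(3 / 2) : ℝ) * s ^ (2 : ℝ)) := by rw [Real.rpow_two]; ring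
    _ = _ := by rw [← Real.rpow_add hs]; norm_num

theorem integrableOn_heatKernelDx {T x : ℝ} (hx : 0 < x) :
    IntegrableOn (fun s => heatKernelDx s x) (Ioc 0 T) := by
  refine Measure.integrableOn_of_bounded (M := 256 / x ^ 4 * T) (by simp)
    measurable_heatKernelDx.of_uncurry_right.aestronglyMeasurable ?_
  filter_upwards [ae_restrict_mem measurableSet_Ioc] with s hs
  refine (abs_heatKernelDx_le_of_pos hs.1 hx).trans ?_
  gcongr
  exact hs.2

theorem integrableOn_heatKernelDxx {T x : ℝ} (hx : 0 < x) :
    IntegrableOn (fun s => heatKernelDxx s x) (Ioc 0 T) := by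
  refine Measure.integrableOn_of_bounded (M := 256 / x ^ 4 * T ^ (1 / 2 : ℝ)) (by simp)
    measurable_heatKernelDxx.of_uncurry_right.aestronglyMeasurable ?_
  filter_upwards [ae_restrict_mem measurableSet_Ioc] with s hs
  refine (abs_heatKernelDxx_le_of_pos hs.1 hx).trans ?_
  have := hs.1.le
  gcongr
  exact hs.2

/-- Since `∂ₓ²G = ∂ₜG`, the time integral of `∂ₓ²G(·, x)` is `G(T, x)` for `x > 0`. -/
theorem integral_heatKernelDxx {T x : ℝ} (hT : 0 ≤ T) (hx : 0 < x) :
    ∫ s in Ioc 0 T, heatKernelDxx s x = heatKernel T x := by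
  rw [← intervalIntegral.integral_of_le hT]
  rw [intervalIntegral.integral_eq_sub_of_hasDerivAt_of_le hT (f := fun s => heatKernel s x)
    (fun s hs => (continuous_heatKernel_time hx hs.1).continuousWithinAt)
    (fun s hs => hasDerivAt_heatKernel_time hs.1 x)
    ((intervalIntegrable_iff_integrableOn_Ioc_of_le hT).2 (integrableOn_heatKernelDxx hx)),
    heatKernel_of_nonpos le_rfl, sub_zero]

section Boundary

/-- A boundary datum extended to the whole line: it vanishes for negative times, and is globally
Hölder continuous with constant `H`. -/
structure ExtendedDatum (β H : ℝ) (g : ℝ → ℝ) : Prop where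
  continuous : Continuous g
  zero_of_nonpos : ∀ t ≤ 0, g t = 0
  abs_sub_le : ∀ t s, |g t - g s| ≤ H * |t - s| ^ β

variable {β H : ℝ} {g : ℝ → ℝ}

theorem ExtendedDatum.abs_le (hg : ExtendedDatum β H g) (hβ : 0 ≤ β) (hH : 0 ≤ H) {T t : ℝ}
    (ht : t ≤ T) (hT : 0 < T) : |g t| ≤ H * T ^ β := by
  rcases le_or_gt t 0 with h | h
  · rw [hg.zero_of_nonpos t h, abs_zero]; positivity
  · have := hg.abs_sub_le t 0
    rw [hg.zero_of_nonpos 0 le_rfl, sub_zero, sub_zero, abs_of_pos h] at this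
    refine this.trans ?_
    gcongr

/-- The time convolution `-2 ∫₀ᵀ k(s, x) g(t - s) ds`. -/
def timeConv (T : ℝ) (k : ℝ → ℝ → ℝ) (g : ℝ → ℝ) (t x : ℝ) : ℝ :=
  -2 * ∫ s in Ioc 0 T, k s x * g (t - s)

theorem measurable_timeConv (T : ℝ) {k : ℝ → ℝ → ℝ} (hk : Measurable fun q : ℝ × ℝ => k q.1 q.2)
    (hg : Continuous g) : Measurable fun q : ℝ × ℝ => timeConv T k g q.1 q.2 := by
  unfold timeConv
  refine Measurable.const_mul (StronglyMeasurable.measurable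
    (StronglyMeasurable.integral_prod_right
        (f := fun (q : ℝ × ℝ) (s : ℝ) => k s q.2 * g (q.1 - s)) ?_)) _
  refine Measurable.stronglyMeasurable ?_
  have a1 : Measurable fun q : (ℝ × ℝ) × ℝ => k q.2 q.1.2 :=
    hk.comp (measurable_snd.prodMk measurable_fst.snd)
  exact a1.mul (hg.measurable.comp (measurable_fst.fst.sub measurable_snd))

/-- The boundary potential as a convolution over the fixed interval `[0, T]`. -/
theorem boundaryHeat_eq_timeConv {ψ : ℝ → ℝ} {T : ℝ} (hg : ∀ t ≤ 0, g t = 0)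
    (hgψ : ∀ t ∈ Icc 0 T, g t = ψ t) {t : ℝ} (ht : t ∈ Icc 0 T) (x : ℝ) :
    boundaryHeat ψ t x = timeConv T heatKernelDx g t x := by
  unfold boundaryHeat timeConv
  congr 1
  have e1 : ∫ τ in (0)..t, deriv (fun z => heatKernel (t - τ) z) x * ψ τ
      = ∫ τ in (0)..t, heatKernelDx (t - τ) x * g (t - (t - τ)) := by
    refine intervalIntegral.integral_congr fun τ hτ => ?_
    rw [uIcc_of_le ht.1] at hτ
    simp only [deriv_heatKernel, sub_sub_cancel]
    rw [hgψ τ ⟨hτ.1, hτ.2.trans ht.2⟩]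
  rw [e1, intervalIntegral.integral_comp_sub_left (fun s => heatKernelDx s x * g (t - s)) t,
    sub_self, sub_zero, intervalIntegral.integral_of_le ht.1]
  symm
  refine setIntegral_eq_of_subset_of_forall_sdiff_eq_zero measurableSet_Ioc
    (Ioc_subset_Ioc_right ht.2) fun s hs => ?_
  have : t < s := by
    by_contra hc
    exact hs.2 ⟨hs.1.1, not_lt.1 hc⟩
  rw [hg (t - s) (by linarith), mul_zero]

theorem integrableOn_mul_datum {T t x : ℝ} {k : ℝ → ℝ → ℝ}
    (hk : IntegrableOn (fun s => k s x) (Ioc 0 T)) (hg : Continuous g) {B : ℝ}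
    (hB : ∀ s ∈ Ioc 0 T, |g (t - s)| ≤ B) :
    IntegrableOn (fun s => k s x * g (t - s)) (Ioc 0 T) := by
  refine Integrable.mul_bdd (c := B) hk (by fun_prop) ?_
  filter_upwards [ae_restrict_mem measurableSet_Ioc] with s hs
  exact hB s hs

theorem hasDerivAt_timeConv {T t x B : ℝ} (hg : Continuous g)
    (hB : ∀ s ∈ Ioc 0 T, |g (t - s)| ≤ B) (hT : 0 < T) (hx : 0 < x) :
    HasDerivAt (timeConv T heatKernelDx g t) (timeConv T heatKernelDxx g t x) x := by
  have hB0 : 0 ≤ B := (abs_nonneg _).trans (hB T ⟨hT, le_rfl⟩)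
  have key := hasDerivAt_integral_of_dominated_loc_of_deriv_le (μ := volume.restrict (Ioc 0 T))
    (F := fun z s => heatKernelDx s z * g (t - s)) (F' := fun z s => heatKernelDxx s z * g (t - s))
    (x₀ := x) (s := Ioi (x / 2)) (bound := fun _ => 256 / (x / 2) ^ 4 * T ^ (1 / 2 : ℝ) * B)
    (Ioi_mem_nhds (by linarith)) ?_ ?_ ?_ ?_ ?_ ?_
  · exact key.2.const_mul (-2)
  · refine Eventually.of_forall fun z => ?_
    exact (measurable_heatKernelDx.of_uncurry_right.mul
      (hg.measurable.comp (measurable_const.sub measurable_id))).aestronglyMeasurable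
  · exact integrableOn_mul_datum (integrableOn_heatKernelDx hx) hg hB
  · exact (measurable_heatKernelDxx.of_uncurry_right.mul
      (hg.measurable.comp (measurable_const.sub measurable_id))).aestronglyMeasurable
  · filter_upwards [ae_restrict_mem measurableSet_Ioc] with s hs z hz
    have hz' : x / 2 < z := hz
    rw [norm_mul]
    refine mul_le_mul ?_ (hB s hs) (norm_nonneg _) (by positivity)
    refine (abs_heatKernelDxx_le_of_pos hs.1 (by linarith)).trans ?_
    have := hs.1.le
    gcongr
    exact hs.2
  · exact integrable_const _
  · exact ae_of_all _ fun s z _ => (hasDerivAt_heatKernelDx s z).mul_const _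

theorem integrableOn_rpow_Ioc {T m : ℝ} (hT : 0 < T) (hm : -1 < m) :
    IntegrableOn (fun s : ℝ => s ^ m) (Ioc 0 T) :=
  (intervalIntegrable_iff_integrableOn_Ioc_of_le hT.le).1
    (intervalIntegral.intervalIntegrable_rpow' hm)

/-- Integrating a kernel of order `s ^ (m - a) * exp (-x² / 8s)` over `[0, T]` leaves a multiple of
the majorant. -/
theorem norm_setIntegral_le_majorant {T a m B x : ℝ} (hT : 0 < T) (ha : 0 ≤ a) (ha1 : a ≤ 1)
    (hm : -1 < m) (hB : 0 ≤ B) (hx : 0 < x) {f : ℝ → ℝ}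
    (hf : ∀ s ∈ Ioc 0 T, |f s| ≤ B * s ^ (m - a) * Real.exp (-(x ^ 2 / (8 * s)))) :
    |∫ s in Ioc 0 T, f s| ≤ (16 * ∫ s in Ioc 0 T, s ^ m) * B * boundaryMajorant T a x := by
  have hM := boundaryMajorant_nonneg (T := T) (a := a) hx
  have h1 : ∀ᵐ s ∂volume.restrict (Ioc 0 T), ‖f s‖ ≤ (16 * B * boundaryMajorant T a x) * s ^ m := by
    filter_upwards [ae_restrict_mem measurableSet_Ioc] with s hs
    have hs0 := hs.1
    calc |f s| ≤ B * s ^ (m - a) * Real.exp (-(x ^ 2 / (8 * s))) := hf s hs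
      _ ≤ B * s ^ (m - a) * (16 * s ^ a * boundaryMajorant T a x) := by
        gcongr; exact gaussian_le_majorant ha ha1 hs hx
      _ = (16 * B * boundaryMajorant T a x) * (s ^ (m - a) * s ^ a) := by ring
      _ = _ := by rw [← Real.rpow_add hs0, sub_add_cancel]
  refine (norm_integral_le_of_norm_le ((integrableOn_rpow_Ioc hT hm).const_mul _) h1).trans_eq ?_
  rw [integral_const_mul]
  ring

/-- The pointwise bounds on the boundary potential and its derivative. The derivative is split as
`∫ ∂ₓ²G(s) (g(t - s) - g(t)) ds + g(t) G(T)`, where Hölder continuity tames the singularity. -/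
theorem exists_abs_timeConv_le {T a β : ℝ} (hT : 0 < T) (ha : 0 < a) (ha1 : a ≤ 1) (hβ : 0 ≤ β)
    (haβ : 1 / 2 - β < a) :
    ∃ C : ℝ, 0 < C ∧ ∀ (H : ℝ) (g : ℝ → ℝ), 0 ≤ H → ExtendedDatum β H g →
      ∀ t ∈ Icc 0 T, ∀ x, 0 < x →
        |timeConv T heatKernelDx g t x| ≤ C * H * boundaryMajorant T a x ∧
        |timeConv T heatKernelDxx g t x| ≤ C * H * boundaryMajorant T a x := by
  set I1 := ∫ s in Ioc 0 T, s ^ (a - 1) with hI1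
  set I2 := ∫ s in Ioc 0 T, s ^ (a + β - 3 / 2) with hI2
  have hpos : ∀ m : ℝ, 0 ≤ ∫ s in Ioc 0 T, s ^ m := fun m =>
    setIntegral_nonneg measurableSet_Ioc fun s hs => Real.rpow_nonneg hs.1.le m
  have p1 : 0 ≤ I1 := hpos _
  have p2 : 0 ≤ I2 := hpos _
  refine ⟨2 * (16 * I1) * T ^ β + 2 * ((16 * I2) + T ^ β * (T ^ (-(1 / 2) : ℝ) * (16 * T ^ a))),
    by positivity, fun H g hH hg t ht x hx => ?_⟩
  have hM := boundaryMajorant_nonneg (T := T) (a := a) hx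
  have hgB : ∀ s ∈ Ioc 0 T, |g (t - s)| ≤ H * T ^ β := fun s hs =>
    hg.abs_le hβ hH (by linarith [hs.1, ht.2]) hT
  constructor
  · have h := norm_setIntegral_le_majorant (a := a) (m := a - 1) (B := H * T ^ β) (x := x)
      (f := fun s => heatKernelDx s x * g (t - s)) hT ha.le ha1 (by linarith) (by positivity) hx
      (fun s hs => by
        have hs0 := hs.1
        rw [abs_mul, show a - 1 - a = -1 by ring]
        calc _ ≤ (s ^ (-1 : ℝ) * Real.exp (-(x ^ 2 / (8 * s)))) * (H * T ^ β) :=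
              mul_le_mul (abs_heatKernelDx_le hs0 x) (hgB s hs) (abs_nonneg _) (by positivity)
          _ = _ := by ring)
    unfold timeConv
    rw [abs_mul, abs_neg, abs_two]
    calc _ ≤ 2 * ((16 * I1) * (H * T ^ β) * boundaryMajorant T a x) := by gcongr
      _ = (2 * (16 * I1) * T ^ β) * H * boundaryMajorant T a x := by ring
      _ ≤ _ := by
        gcongr
        exact le_add_of_nonneg_right (by positivity)
  · have h := norm_setIntegral_le_majorant (a := a) (m := a + β - 3 / 2) (B := H) (x := x)
      (f := fun s => heatKernelDxx s x * (g (t - s) - g t)) hT ha.le ha1 (by linarith) hH hx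
      (fun s hs => by
        have hs0 := hs.1
        have h1 := hg.abs_sub_le (t - s) t
        rw [show t - s - t = -s by ring, abs_neg, abs_of_pos hs0] at h1
        rw [abs_mul]
        calc _ ≤ (s ^ (-(3 / 2) : ℝ) * Real.exp (-(x ^ 2 / (8 * s)))) * (H * s ^ β) :=
              mul_le_mul (abs_heatKernelDxx_le hs0 x) h1 (abs_nonneg _) (by positivity)
          _ = H * (s ^ (-(3 / 2) : ℝ) * s ^ β) * Real.exp (-(x ^ 2 / (8 * s))) := by ring
          _ = _ := by rw [← Real.rpow_add hs0]; congr 3; ring)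
    have hi1 := integrableOn_mul_datum (t := t) (integrableOn_heatKernelDxx (T := T) hx)
      hg.continuous hgB
    have hi2 := (integrableOn_heatKernelDxx (T := T) hx).mul_const (g t)
    have split : ∫ s in Ioc 0 T, heatKernelDxx s x * g (t - s)
        = (∫ s in Ioc 0 T, heatKernelDxx s x * (g (t - s) - g t)) + heatKernel T x * g t := by
      simp only [mul_sub]
      rw [integral_sub hi1 hi2, integral_mul_const, integral_heatKernelDxx hT.le hx]
      ring
    have hG : |heatKernel T x * g t|
        ≤ (T ^ (-(1 / 2) : ℝ) * (16 * T ^ a * boundaryMajorant T a x)) * (H * T ^ β) := by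
      rw [abs_mul]
      refine mul_le_mul ?_ (hg.abs_le hβ hH ht.2 hT) (abs_nonneg _) (by positivity)
      refine (abs_heatKernel_le hT x).trans ?_
      gcongr
      exact gaussian_le_majorant ha.le ha1 ⟨hT, le_rfl⟩ hx
    unfold timeConv
    rw [abs_mul, abs_neg, abs_two, split]
    calc _ ≤ 2 * ((16 * I2) * H * boundaryMajorant T a x +
          (T ^ (-(1 / 2) : ℝ) * (16 * T ^ a * boundaryMajorant T a x)) * (H * T ^ β)) := by
          gcongr
          exact (abs_add_le _ _).trans (add_le_add h hG)
      _ = (2 * ((16 * I2) + T ^ β * (T ^ (-(1 / 2) : ℝ) * (16 * T ^ a)))) * H *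
          boundaryMajorant T a x := by ring
      _ ≤ _ := by
        gcongr
        exact le_add_of_nonneg_left (by positivity)

theorem exists_extendedDatum {T : ℝ} (hT : 0 < T) {β : ℝ≥0} (hβ : 0 < β) {ψ : ℝ → ℝ}
    (hψ : MemCHolder T β ψ) (hψ0 : ψ 0 = 0) :
    ∃ g : ℝ → ℝ, ExtendedDatum β (cHolderNorm T β ψ) g ∧ ∀ t ∈ Icc 0 T, g t = ψ t := by
  have hh := hψ.holderWith
  have hsup : 0 ≤ ⨆ t : Icc 0 T, |ψ t| := Real.iSup_nonneg fun _ => abs_nonneg _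
  refine ⟨IccExtend hT.le ((Icc 0 T).domRestrict ψ), ⟨?_, fun t ht => ?_, fun t s => ?_⟩,
    fun t ht => ?_⟩
  · exact Continuous.Icc_extend' (hh.continuous hβ)
  · rw [IccExtend_of_le_left hT.le _ ht]
    exact hψ0
  · have h1 := hh.dist_le (projIcc 0 T hT.le t) (projIcc 0 T hT.le s)
    rw [Real.dist_eq] at h1
    have h2 : dist (projIcc 0 T hT.le t) (projIcc 0 T hT.le s) ≤ |t - s| := by
      have := (LipschitzWith.projIcc hT.le).dist_le_mul t s
      simpa [Real.dist_eq] using this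
    refine h1.trans ?_
    unfold cHolderNorm
    gcongr
    exact le_add_of_nonneg_left hsup
  · exact IccExtend_of_mem hT.le _ ht

theorem cHolderNorm_nonneg (T : ℝ) (β : ℝ≥0) (ψ : ℝ → ℝ) : 0 ≤ cHolderNorm T β ψ :=
  add_nonneg (Real.iSup_nonneg fun _ => abs_nonneg _) (NNReal.coe_nonneg _)

/-- The boundary potential is bounded in `W^{1,p}` by the Hölder norm of the boundary value. -/
theorem exists_boundaryPair {T : ℝ} (hT : 0 < T) {β : ℝ≥0} (hβ : 0 < β) {p : ℝ≥0∞}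
    [Fact (1 ≤ p)] (hp : p ≠ ⊤) (hpβ : (1 - 2 * (β : ℝ)) * p.toReal < 1) :
    ∃ C : ℝ, 0 < C ∧ ∀ ψ : ℝ → ℝ, MemCHolder T β ψ → ψ 0 = 0 →
      ∃ U : ℝ → Lp ℝ p halfLine × Lp ℝ p halfLine, StronglyMeasurable U ∧ ∀ t ∈ Icc 0 T,
        ‖U t‖ ≤ C * cHolderNorm T β ψ ∧ (U t).1 =ᵐ[halfLine] boundaryHeat ψ t ∧
        (U t).2 =ᵐ[halfLine] deriv (boundaryHeat ψ t) := by
  have hp1 : (1 : ℝ) ≤ p.toReal := by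
    simpa using ENNReal.toReal_mono hp (Fact.out : 1 ≤ p)
  have hp0 : p ≠ 0 := (zero_lt_one.trans_le (Fact.out : 1 ≤ p)).ne'
  have hβ' : (0 : ℝ) < β := hβ
  obtain ⟨a, ha, ha1, haβ, hap⟩ : ∃ a : ℝ, 0 < a ∧ a ≤ 1 ∧ 1 / 2 - (β : ℝ) < a ∧
      2 * a * p.toReal < 1 := by
    have h1 : max 0 (1 / 2 - (β : ℝ)) < 1 / (2 * p.toReal) := by
      refine max_lt (by positivity) ?_
      rw [lt_div_iff₀ (by positivity)]
      linarith
    obtain ⟨a, h2, h3⟩ := exists_between h1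
    rw [lt_div_iff₀ (by positivity)] at h3
    obtain ⟨h4, h5⟩ := max_lt_iff.1 h2
    exact ⟨a, h4, by nlinarith, h5, by linarith⟩
  obtain ⟨C, hC, hbound⟩ := exists_abs_timeConv_le hT ha ha1 hβ'.le haβ
  have hM := memLp_boundaryMajorant hT hp0 hp hap
  refine ⟨C * ((eLpNorm (boundaryMajorant T a) p halfLine).toReal + 1), by positivity,
    fun ψ hψ hψ0 => ?_⟩
  obtain ⟨g, hg, hgψ⟩ := exists_extendedDatum hT hβ hψ hψ0
  have hH := cHolderNorm_nonneg T β ψ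
  have hb := hbound _ g hH hg
  set N := cHolderNorm T β ψ
  -- A family of functions dominated by the majorant gives a bounded measurable map into `L^p`.
  have main : ∀ k : ℝ → ℝ → ℝ, (Measurable fun q : ℝ × ℝ => k q.1 q.2) →
      (∀ t ∈ Icc 0 T, ∀ x, 0 < x → |timeConv T k g t x| ≤ C * N * boundaryMajorant T a x) →
      ∃ V : ℝ → Lp ℝ p halfLine, StronglyMeasurable V ∧ ∀ t ∈ Icc 0 T,
        ‖V t‖ ≤ C * ((eLpNorm (boundaryMajorant T a) p halfLine).toReal + 1) * N ∧
        V t =ᵐ[halfLine] timeConv T k g t := by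
    intro k hk hkb
    have hjm : Measurable fun q : ℝ × ℝ => (Icc 0 T ×ˢ univ).indicator
        (fun q : ℝ × ℝ => timeConv T k g q.1 q.2) q :=
      (measurable_timeConv T hk hg.continuous).indicator (measurableSet_Icc.prod .univ)
    have hslice : ∀ t, MemLp (fun x => (Icc 0 T ×ˢ univ).indicator
        (fun q : ℝ × ℝ => timeConv T k g q.1 q.2) (t, x)) p halfLine := by
      intro t
      refine hM.of_le_mul (c := C * N) (hjm.comp measurable_prodMk_left).aestronglyMeasurable ?_
      filter_upwards [ae_restrict_mem measurableSet_Ioi] with x hx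
      rw [Real.norm_of_nonneg (boundaryMajorant_nonneg hx)]
      by_cases ht : t ∈ Icc 0 T
      · rw [indicator_of_mem (mk_mem_prod ht (mem_univ x))]
        exact hkb t ht x hx
      · rw [indicator_of_notMem (fun h => ht h.1), norm_zero]
        have := boundaryMajorant_nonneg (T := T) (a := a) hx
        positivity
    refine ⟨fun t => (hslice t).toLp _, stronglyMeasurable_Lp_of_ae_eq hp hjm
      fun t => (hslice t).coeFn_toLp, fun t ht => ?_⟩
    have hae : (hslice t).toLp _ =ᵐ[halfLine] timeConv T k g t := by
      filter_upwards [(hslice t).coeFn_toLp] with x hx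
      rw [hx, indicator_of_mem (mk_mem_prod ht (mem_univ x))]
    refine ⟨?_, hae⟩
    have h1 : ‖(hslice t).toLp _‖ ≤ C * N * ‖hM.toLp _‖ := by
      refine Lp.norm_le_mul_norm_of_ae_le_mul ?_
      filter_upwards [hae, hM.coeFn_toLp, ae_restrict_mem measurableSet_Ioi] with x h2 h3 hx
      rw [h2, h3, Real.norm_of_nonneg (boundaryMajorant_nonneg hx)]
      exact hkb t ht x hx
    rw [Lp.norm_toLp _ hM] at h1
    refine h1.trans ?_
    have : 0 ≤ C * N := by positivity
    nlinarith
  obtain ⟨U, hU, hU'⟩ := main heatKernelDx measurable_heatKernelDx fun t ht x hx => (hb t ht x hx).1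
  obtain ⟨V, hV, hV'⟩ := main heatKernelDxx measurable_heatKernelDxx
    fun t ht x hx => (hb t ht x hx).2
  refine ⟨fun t => (U t, V t), hU.prodMk hV, fun t ht => ⟨max_le (hU' t ht).1 (hV' t ht).1, ?_, ?_⟩⟩
  · have e : boundaryHeat ψ t = timeConv T heatKernelDx g t :=
      funext (boundaryHeat_eq_timeConv hg.zero_of_nonpos hgψ ht)
    rw [e]
    exact (hU' t ht).2
  · have e : boundaryHeat ψ t = timeConv T heatKernelDx g t :=
      funext (boundaryHeat_eq_timeConv hg.zero_of_nonpos hgψ ht)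
    rw [e]
    filter_upwards [(hV' t ht).2, ae_restrict_mem measurableSet_Ioi] with x h1 hx
    rw [h1]
    exact (hasDerivAt_timeConv hg.continuous (fun s hs => hg.abs_le hβ'.le hH
      (by linarith [hs.1, ht.2]) hT) hT hx).deriv.symm

end Boundary

/-! ### The semigroup on initial data vanishing at the origin -/

/-- A smooth cut-off equal to `1` on `[2 / N, N]` and supported in `[1 / N, 2N]`. -/
def cutoff (N y : ℝ) : ℝ :=
  Real.smoothTransition (N * y - 1) * (1 - Real.smoothTransition (y / N - 1))

theorem contDiff_cutoff (N : ℝ) : ContDiff ℝ ∞ (cutoff N) := by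
  have h : ContDiff ℝ ∞ Real.smoothTransition := Real.smoothTransition.contDiff
  exact (h.comp (by fun_prop : ContDiff ℝ ∞ fun y : ℝ => N * y - 1)).mul
    (contDiff_const.sub (h.comp (by fun_prop : ContDiff ℝ ∞ fun y : ℝ => y / N - 1)))

theorem abs_cutoff_le (N y : ℝ) : |cutoff N y| ≤ 1 := by
  have h1 := Real.smoothTransition.nonneg (N * y - 1)
  have h2 := Real.smoothTransition.le_one (N * y - 1)
  have h3 := Real.smoothTransition.nonneg (y / N - 1)
  have h4 := Real.smoothTransition.le_one (y / N - 1)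
  unfold cutoff
  rw [abs_mul, abs_of_nonneg h1, abs_of_nonneg (by linarith)]
  exact mul_le_one₀ h2 (by linarith) (by linarith)

theorem support_cutoff_subset {N : ℝ} (hN : 0 < N) :
    Function.support (cutoff N) ⊆ Icc (1 / N) (2 * N) := by
  intro y hy
  by_contra hc
  refine hy ?_
  unfold cutoff
  rw [mem_Icc, not_and_or, not_le, not_le] at hc
  rcases hc with h | h
  · rw [lt_div_iff₀ hN] at h
    rw [Real.smoothTransition.zero_of_nonpos (by linarith), zero_mul]
  · have : 2 ≤ y / N := by rw [le_div_iff₀ hN]; linarith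
    rw [Real.smoothTransition.one_of_one_le (x := y / N - 1) (by linarith), sub_self, mul_zero]

theorem cutoff_eq_one {N y : ℝ} (hN : 0 < N) (h1 : 2 / N ≤ y) (h2 : y ≤ N) : cutoff N y = 1 := by
  unfold cutoff
  rw [div_le_iff₀ hN] at h1
  have : y / N ≤ 1 := by rwa [div_le_one hN]
  rw [Real.smoothTransition.one_of_one_le (by linarith),
    Real.smoothTransition.zero_of_nonpos (by linarith)]
  norm_num

theorem tendsto_cutoff {y : ℝ} (hy : 0 < y) :
    Tendsto (fun N : ℝ => cutoff N y) atTop (𝓝 1) := by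
  refine tendsto_const_nhds.congr' ?_
  filter_upwards [eventually_ge_atTop y, eventually_ge_atTop (2 / y), eventually_gt_atTop 0]
    with N h1 h2 h3
  refine (cutoff_eq_one h3 ?_ h1).symm
  rw [div_le_iff₀ hy] at h2
  rw [div_le_iff₀ h3]
  linarith

theorem exists_deriv_smoothTransition_bound :
    ∃ B : ℝ, 0 < B ∧ (∀ z, |deriv Real.smoothTransition z| ≤ B) ∧
      ∀ z, z ∉ Icc (0 : ℝ) 1 → deriv Real.smoothTransition z = 0 := by
  have h : ContDiff ℝ ∞ Real.smoothTransition := Real.smoothTransition.contDiff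
  have hc : Continuous (deriv Real.smoothTransition) := h.continuous_deriv (by simp)
  have hz : ∀ z, z ∉ Icc (0 : ℝ) 1 → deriv Real.smoothTransition z = 0 := by
    intro z hz
    rw [mem_Icc, not_and_or, not_le, not_le] at hz
    rcases hz with hz | hz
    · have : Real.smoothTransition =ᶠ[𝓝 z] fun _ => 0 := by
        filter_upwards [Iio_mem_nhds hz] with w hw
        exact Real.smoothTransition.zero_of_nonpos (le_of_lt hw)
      rw [this.deriv_eq, deriv_const]
    · have : Real.smoothTransition =ᶠ[𝓝 z] fun _ => 1 := by
        filter_upwards [Ioi_mem_nhds hz] with w hw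
        exact Real.smoothTransition.one_of_one_le (le_of_lt hw)
      rw [this.deriv_eq, deriv_const]
  obtain ⟨B, hB⟩ := (isCompact_Icc (a := (0 : ℝ)) (b := 1)).exists_bound_of_continuousOn
    hc.continuousOn
  refine ⟨|B| + 1, by positivity, fun z => ?_, hz⟩
  by_cases h : z ∈ Icc (0 : ℝ) 1
  · exact (hB z h).trans (by linarith [le_abs_self B])
  · rw [hz z h, abs_zero]; positivity

/-- The derivative of the cut-off is of size `N` on `[1 / N, 2 / N]` and of size `1 / N`
elsewhere. -/
theorem exists_abs_deriv_cutoff_le : ∃ B : ℝ, 0 < B ∧ ∀ N y : ℝ, 0 < N →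
    |deriv (cutoff N) y| ≤ (Icc (1 / N) (2 / N)).indicator (fun _ => N * B) y + B / N := by
  obtain ⟨B, hB, hb, hz⟩ := exists_deriv_smoothTransition_bound
  refine ⟨B, hB, fun N y hN => ?_⟩
  have hσ : ∀ z, HasDerivAt Real.smoothTransition (deriv Real.smoothTransition z) z := fun z =>
    ((Real.smoothTransition.contDiff (n := 1)).differentiable (by simp) z).hasDerivAt
  have d1 : HasDerivAt (fun y => Real.smoothTransition (N * y - 1))
      (deriv Real.smoothTransition (N * y - 1) * N) y := by
    refine HasDerivAt.comp y (hσ _) ?_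
    simpa using ((hasDerivAt_id y).const_mul N).sub_const 1
  have d2 : HasDerivAt (fun y => 1 - Real.smoothTransition (y / N - 1))
      (-(deriv Real.smoothTransition (y / N - 1) * (1 / N))) y := by
    refine HasDerivAt.const_sub 1 (HasDerivAt.comp y (hσ _) ?_)
    exact ((hasDerivAt_id y).div_const N).sub_const 1
  have d3 : deriv (cutoff N) y = _ := (d1.mul d2).deriv
  rw [d3]
  have s1 := Real.smoothTransition.nonneg (N * y - 1)
  have s2 := Real.smoothTransition.le_one (N * y - 1)
  have s3 := Real.smoothTransition.nonneg (y / N - 1)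
  have s4 := Real.smoothTransition.le_one (y / N - 1)
  refine (abs_add_le _ _).trans (add_le_add ?_ ?_)
  · by_cases hy : y ∈ Icc (1 / N) (2 / N)
    · rw [indicator_of_mem hy, abs_mul, abs_mul, abs_of_pos hN, abs_of_nonneg (sub_nonneg.2 s4),
        mul_comm N B]
      refine (mul_le_of_le_one_right (by positivity) (by linarith)).trans ?_
      gcongr
      exact hb _
    · rw [indicator_of_notMem hy, hz (N * y - 1), zero_mul, zero_mul, abs_zero]
      intro hm
      refine hy ⟨?_, ?_⟩
      · rw [div_le_iff₀ hN]; linarith [hm.1]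
      · rw [le_div_iff₀ hN]; linarith [hm.2]
  · rw [abs_mul, abs_neg, abs_mul, abs_of_nonneg s1, abs_of_pos (by positivity : 0 < 1 / N),
      div_eq_mul_one_div B]
    refine (mul_le_of_le_one_left (by positivity) s2).trans ?_
    gcongr
    exact hb _

/-- The cut-off costs nothing in the limit when tested against a function that is small near the
origin. -/
theorem tendsto_integral_mul_deriv_cutoff {F : ℝ → ℝ} (hF : Integrable F halfLine)
    (h0 : ∀ ε > 0, ∃ δ > 0, ∀ᵐ y ∂halfLine, y < δ → |F y| ≤ ε) :
    Tendsto (fun N : ℝ => ∫ y in Ioi 0, F y * deriv (cutoff N) y) atTop (𝓝 0) := by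
  obtain ⟨B, hB, hb⟩ := exists_abs_deriv_cutoff_le
  rw [Metric.tendsto_nhds]
  intro ε hε
  obtain ⟨δ, hδ, hFδ⟩ := h0 (ε / (3 * B)) (by positivity)
  set I := ∫ y in Ioi 0, |F y| with hI
  have hI0 : 0 ≤ I := integral_nonneg fun _ => abs_nonneg _
  filter_upwards [eventually_gt_atTop 0, eventually_gt_atTop (2 / δ),
    eventually_gt_atTop (3 * B * I / ε)] with N hN0 hN1 hN2
  rw [div_lt_iff₀ hδ] at hN1
  rw [div_lt_iff₀ hε] at hN2
  rw [dist_zero_right]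
  have hind : Integrable ((Icc (1 / N) (2 / N)).indicator fun _ => N * B * (ε / (3 * B)))
      halfLine :=
    (integrable_indicator_iff measurableSet_Icc).2
      (integrableOn_const (C := N * B * (ε / (3 * B))) (s := Icc (1 / N) (2 / N))
        (ne_of_lt ((Measure.restrict_apply_le _ _).trans_lt measure_Icc_lt_top)))
  have hle : ∀ᵐ y ∂halfLine, ‖F y * deriv (cutoff N) y‖ ≤
      (Icc (1 / N) (2 / N)).indicator (fun _ => N * B * (ε / (3 * B))) y + B / N * |F y| := by
    filter_upwards [hFδ] with y hy
    rw [norm_mul, Real.norm_eq_abs, Real.norm_eq_abs]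
    have h1 := mul_le_mul_of_nonneg_left (hb N y hN0) (abs_nonneg (F y))
    refine h1.trans ?_
    rw [mul_add, mul_comm (B / N)]
    refine add_le_add ?_ le_rfl
    by_cases hm : y ∈ Icc (1 / N) (2 / N)
    · rw [indicator_of_mem hm, indicator_of_mem hm, mul_comm]
      have : y < δ := hm.2.trans_lt (by rw [div_lt_iff₀ hN0]; linarith)
      gcongr
      exact hy this
    · rw [indicator_of_notMem hm, indicator_of_notMem hm, mul_zero]
  have hIcc : ∫ y in Ioi 0, (Icc (1 / N) (2 / N)).indicator (fun _ => N * B * (ε / (3 * B))) y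
      ≤ ε / 3 := by
    have hv : (halfLine (Icc (1 / N) (2 / N))).toReal ≤ 1 / N := by
      refine ENNReal.toReal_le_of_le_ofReal (by positivity) ?_
      refine (Measure.restrict_apply_le _ _).trans_eq ?_
      rw [Real.volume_Icc]
      congr 1
      ring
    rw [integral_indicator measurableSet_Icc, setIntegral_const, smul_eq_mul]
    calc _ ≤ 1 / N * (N * B * (ε / (3 * B))) := by gcongr; exact hv
      _ = ε / 3 := by field_simp
  calc ‖∫ y in Ioi 0, F y * deriv (cutoff N) y‖
      ≤ ∫ y in Ioi 0, ((Icc (1 / N) (2 / N)).indicator (fun _ => N * B * (ε / (3 * B))) y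
        + B / N * |F y|) := norm_integral_le_of_norm_le (hind.add (hF.abs.const_mul _)) hle
    _ = (∫ y in Ioi 0, (Icc (1 / N) (2 / N)).indicator (fun _ => N * B * (ε / (3 * B))) y)
        + B / N * I := by rw [integral_add hind (hF.abs.const_mul _), integral_const_mul]
    _ ≤ ε / 3 + ε / 3 := by
        refine add_le_add hIcc ?_
        rw [div_mul_eq_mul_div, div_le_iff₀ hN0]
        linarith
    _ < ε := by linarith

/-- Integration by parts against a test function that need not vanish at the origin, for a function
with a weak derivative and boundary value zero. -/
theorem integral_mul_deriv_of_vanishes {f f' g K K' : ℝ → ℝ} (hw : IsWeakDeriv f f')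
    (hgc : ContinuousOn g (Ici 0)) (hfg : f =ᵐ[halfLine] g) (hg0 : g 0 = 0)
    (hK : ContDiff ℝ ∞ K) (hK' : ∀ y, HasDerivAt K (K' y) y)
    (h1 : Integrable (fun y => f y * K y) halfLine)
    (h2 : Integrable (fun y => f y * K' y) halfLine)
    (h3 : Integrable (fun y => f' y * K y) halfLine) :
    ∫ y in Ioi 0, f y * K' y = - ∫ y in Ioi 0, f' y * K y := by
  have hsmall : ∀ ε > 0, ∃ δ > 0, ∀ᵐ y ∂halfLine, y < δ → |f y * K y| ≤ ε := by
    intro ε hε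
    have hc : ContinuousWithinAt (fun y => g y * K y) (Ici 0) 0 :=
      (hgc 0 self_mem_Ici).mul hK.continuous.continuousWithinAt
    obtain ⟨δ, hδ, hd⟩ := Metric.continuousWithinAt_iff.1 hc ε hε
    refine ⟨δ, hδ, ?_⟩
    filter_upwards [hfg, ae_restrict_mem measurableSet_Ioi] with y hy hy0 hyδ
    have hy0' : 0 < y := hy0
    have := hd (x := y) hy0'.le (by rw [Real.dist_eq, sub_zero, abs_of_pos hy0']; exact hyδ)
    rw [Real.dist_eq, hg0, zero_mul, sub_zero, ← hy] at this
    exact this.le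
  have hχ : ∀ N y, HasDerivAt (cutoff N) (deriv (cutoff N) y) y := fun N y =>
    ((contDiff_cutoff N).differentiable (by simp) y).hasDerivAt
  have hcm : ∀ N, AEStronglyMeasurable (cutoff N) halfLine := fun N =>
    (contDiff_cutoff N).continuous.aestronglyMeasurable
  have hdm : ∀ N, AEStronglyMeasurable (deriv (cutoff N)) halfLine := fun N =>
    ((contDiff_cutoff N).continuous_deriv (by simp)).aestronglyMeasurable
  obtain ⟨B, hB, hb⟩ := exists_abs_deriv_cutoff_le
  have hI : ∀ N > 0, ∀ F : ℝ → ℝ, Integrable F halfLine →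
      Integrable (fun y => F y * cutoff N y) halfLine := fun N _ F hF =>
    hF.mul_bdd (c := 1) (hcm N) (ae_of_all _ fun y => abs_cutoff_le N y)
  have hI' : ∀ N > 0, ∀ F : ℝ → ℝ, Integrable F halfLine →
      Integrable (fun y => F y * deriv (cutoff N) y) halfLine := fun N hN F hF =>
    hF.mul_bdd (c := N * B + B / N) (hdm N) (ae_of_all _ fun y => (hb N y hN).trans (by
      gcongr
      exact indicator_le_self' (fun _ _ => by positivity) y))
  have hlim : ∀ F : ℝ → ℝ, Integrable F halfLine →
      Tendsto (fun N : ℝ => ∫ y in Ioi 0, F y * cutoff N y) atTop (𝓝 (∫ y in Ioi 0, F y)) := by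
    intro F hF
    refine tendsto_integral_filter_of_dominated_convergence (fun y => ‖F y‖)
      (Eventually.of_forall fun N => hF.1.mul (hcm N))
      (Eventually.of_forall fun N => ae_of_all _ fun y => ?_) hF.norm ?_
    · rw [norm_mul]
      exact mul_le_of_le_one_right (norm_nonneg _) (abs_cutoff_le N y)
    · filter_upwards [ae_restrict_mem measurableSet_Ioi] with y hy
      simpa using (tendsto_cutoff hy).const_mul (F y)
  have key : ∀ᶠ N : ℝ in atTop, (∫ y in Ioi 0, (f y * K' y) * cutoff N y)
      + ∫ y in Ioi 0, (f y * K y) * deriv (cutoff N) y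
      = - ∫ y in Ioi 0, (f' y * K y) * cutoff N y := by
    filter_upwards [eventually_gt_atTop 0] with N hN
    have hsupp : Function.support (fun y => K y * cutoff N y) ⊆ Icc (1 / N) (2 * N) :=
      (Function.support_mul_subset_right _ _).trans (support_cutoff_subset hN)
    have htest := hw (fun y => K y * cutoff N y) (hK.mul (contDiff_cutoff N))
      (HasCompactSupport.of_support_subset_isCompact isCompact_Icc hsupp)
      ((closure_minimal hsupp isClosed_Icc).trans fun y hy =>
        (by positivity : 0 < 1 / N).trans_le hy.1)
    have hd : deriv (fun y => K y * cutoff N y)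
        = fun y => K' y * cutoff N y + K y * deriv (cutoff N) y :=
      funext fun y => ((hK' y).mul (hχ N y)).deriv
    rw [hd] at htest
    rw [← integral_add (hI N hN _ h2) (hI' N hN _ h1)]
    simp only [mul_assoc, ← mul_add]
    exact htest
  have l1 := (hlim _ h2).add (tendsto_integral_mul_deriv_cutoff h1 hsmall)
  rw [add_zero] at l1
  exact tendsto_nhds_unique (l1.congr' key) (hlim _ h3).neg

theorem contDiff_heatKernel (s : ℝ) : ContDiff ℝ ∞ (heatKernel s) := by
  unfold heatKernel
  fun_prop

/-- For `f(0) = 0`, differentiating the Dirichlet semigroup gives the Neumann semigroup applied to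
the derivative. -/
theorem halfConv_heatKernelDx_eq {p : ℝ≥0∞} [Fact (1 ≤ p)] (v₀ : W1p p) (h0 : VanishesAtZero v₀)
    (s x : ℝ) :
    halfConv (-1) (heatKernelDx s) (toFun v₀) x = halfConv 1 (heatKernel s) (dx v₀) x := by
  obtain ⟨g, hgc, hfg, hg0⟩ := h0
  have hp1 : 1 ≤ p := Fact.out
  have hf : MemLp (toFun v₀) p halfLine := Lp.memLp v₀.1.fst
  have hf' : MemLp (dx v₀) p halfLine := Lp.memLp v₀.1.snd
  have hd : ∀ y, HasDerivAt (halfKernel 1 (heatKernel s) x)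
      (-halfKernel (-1) (heatKernelDx s) x y) y := by
    intro y
    have a1 := (hasDerivAt_heatKernel s (x - y)).comp_const_sub x y
    have a2 := ((hasDerivAt_heatKernel s (x + y)).comp_const_add x y).const_mul 1
    refine (a1.add a2).congr_deriv ?_
    unfold halfKernel
    ring
  have i1 := integrable_halfKernel_mul (c := 1) (memLp_heatKernel s) hp1 hf x
  have i2 := integrable_halfKernel_mul (c := -1) (memLp_heatKernelDx s) hp1 hf x
  have i3 := integrable_halfKernel_mul (c := 1) (memLp_heatKernel s) hp1 hf' x
  have hK : ContDiff ℝ ∞ (halfKernel 1 (heatKernel s) x) := by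
    have h := contDiff_heatKernel s
    unfold halfKernel
    fun_prop
  have := integral_mul_deriv_of_vanishes (f := toFun v₀) (f' := dx v₀) v₀.2 hgc hfg hg0 hK hd
    (by simpa only [mul_comm] using i1)
    (by simpa only [mul_comm, mul_neg] using i2.fun_neg)
    (by simpa only [mul_comm] using i3)
  simp only [mul_neg, integral_neg, neg_inj] at this
  unfold halfConv
  simp only [mul_comm (halfKernel _ _ _ _)]
  exact this

section Initial

/-- The pair `(S(t)v₀, ∂ₓS(t)v₀)` for initial data vanishing at the origin. -/
def initialPair {p : ℝ≥0∞} [Fact (1 ≤ p)] (v₀ : W1p p) (t : ℝ) :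
    Lp ℝ p halfLine × Lp ℝ p halfLine :=
  if t = 0 then (v₀.1.fst, v₀.1.snd)
  else (halfConvLp p (-1) (heatKernel t) v₀.1.fst, halfConvLp p 1 (heatKernel t) v₀.1.snd)

variable {p : ℝ≥0∞} [Fact (1 ≤ p)]

theorem initialPair_fst_ae (Y : YoungExponents 1 p p) (v₀ : W1p p) (t : ℝ) :
    (initialPair v₀ t).1 =ᵐ[halfLine] dirichletSemigroup t (toFun v₀) := by
  unfold initialPair dirichletSemigroup
  split_ifs with h
  · rfl
  · rw [dirichletConv_eq_halfConv]
    exact coeFn_halfConvLp Y measurable_heatKernel.of_uncurry_left (memLp_heatKernel t 1) (by simp)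
      _

theorem isWeakDeriv_initialPair (Y : YoungExponents 1 p p) (v₀ : W1p p) (h0 : VanishesAtZero v₀)
    (t : ℝ) : IsWeakDeriv (initialPair v₀ t).1 (initialPair v₀ t).2 := by
  unfold initialPair
  split_ifs with h
  · exact v₀.2
  · refine IsWeakDeriv.congr_ae (isWeakDeriv_halfConv (c := -1) (memLp_heatKernel t)
      (memLp_heatKernelDx t) (hasDerivAt_heatKernel t) (continuous_heatKernelDx t) (by simp)
      Y.one_le_e (Lp.memLp v₀.1.fst))
      (coeFn_halfConvLp Y measurable_heatKernel.of_uncurry_left (memLp_heatKernel t 1) (by simp)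
        _).symm ?_
    rw [show halfConv (-1) (heatKernelDx t) v₀.1.fst = halfConv 1 (heatKernel t) v₀.1.snd from
      funext (halfConv_heatKernelDx_eq v₀ h0 t)]
    exact (coeFn_halfConvLp Y measurable_heatKernel.of_uncurry_left (memLp_heatKernel t 1)
      (by simp) _).symm

theorem exists_norm_initialPair_le (Y : YoungExponents 1 p p) :
    ∃ C : ℝ, 0 < C ∧ ∀ (v₀ : W1p p) (t : ℝ), ‖initialPair v₀ t‖ ≤ C * ‖v₀‖ := by
  obtain ⟨A, hA, h⟩ := exists_eLpNorm_one_heatKernel_le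
  refine ⟨2 * A + 1, by positivity, fun v₀ t => ?_⟩
  have n1 : ‖v₀.1.fst‖ ≤ ‖v₀‖ := WithLp.norm_fst_le _ v₀.1
  have n2 : ‖v₀.1.snd‖ ≤ ‖v₀‖ := WithLp.norm_snd_le _ v₀.1
  have n0 : 0 ≤ ‖v₀‖ := norm_nonneg _
  have hkey : ∀ c : ℝ, |c| ≤ 1 → ∀ f : Lp ℝ p halfLine, ‖f‖ ≤ ‖v₀‖ →
      ‖halfConvLp p c (heatKernel t) f‖ ≤ (2 * A + 1) * ‖v₀‖ := by
    intro c hc f hf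
    refine (norm_halfConvLp_le Y measurable_heatKernel.of_uncurry_left (memLp_heatKernel t 1) hc
      hA.le (h t) f).trans ?_
    calc 2 * A * ‖f‖ ≤ 2 * A * ‖v₀‖ := by gcongr
      _ ≤ _ := by gcongr; linarith
  unfold initialPair
  split_ifs
  · exact max_le (n1.trans (le_mul_of_one_le_left n0 (by linarith)))
      (n2.trans (le_mul_of_one_le_left n0 (by linarith)))
  · exact max_le (hkey _ (by simp) _ n1) (hkey _ (by simp) _ n2)

theorem stronglyMeasurable_initialPair (Y : YoungExponents 1 p p) (v₀ : W1p p) :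
    StronglyMeasurable (initialPair v₀) := by
  refine StronglyMeasurable.ite (measurableSet_singleton 0) stronglyMeasurable_const ?_
  exact (stronglyMeasurable_halfConvLp Y (by simp) measurable_heatKernel
    (fun t => memLp_heatKernel t 1) stronglyMeasurable_const).prodMk
    (stronglyMeasurable_halfConvLp Y (by simp) measurable_heatKernel
    (fun t => memLp_heatKernel t 1) stronglyMeasurable_const)

end Initial

/-! ### Pairs of functions and `W^{1,p}` -/

section Sobolev

variable {p : ℝ≥0∞} [Fact (1 ≤ p)]

/-- The defect of the relation `g = f'` against a test function is a continuous functional. -/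
theorem exists_clm_weakDeriv {φ : ℝ → ℝ} (h1 : ContDiff ℝ ∞ φ) (h2 : HasCompactSupport φ) :
    ∃ L : Lp ℝ p halfLine × Lp ℝ p halfLine →L[ℝ] ℝ, ∀ z,
      L z = (∫ x in Ioi 0, z.1 x * deriv φ x) + ∫ x in Ioi 0, z.2 x * φ x := by
  have hφ' : Continuous (deriv φ) := h1.continuous_deriv (by simp)
  obtain ⟨L1, hL1⟩ := exists_clm_integral_mul (μ := halfLine) p
    (fun q => (hφ'.memLp_of_hasCompactSupport (p := q) (μ := halfLine) h2.deriv))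
  obtain ⟨L2, hL2⟩ := exists_clm_integral_mul (μ := halfLine) p
    (fun q => (h1.continuous.memLp_of_hasCompactSupport (p := q) (μ := halfLine) h2))
  refine ⟨L1.comp (ContinuousLinearMap.fst ℝ _ _) + L2.comp (ContinuousLinearMap.snd ℝ _ _),
    fun z => ?_⟩
  simp only [_root_.add_apply, ContinuousLinearMap.comp_apply,
    ContinuousLinearMap.coe_fst', ContinuousLinearMap.coe_snd', hL1, hL2, mul_comm]

theorem isWeakDeriv_add {z w : Lp ℝ p halfLine × Lp ℝ p halfLine} (hz : IsWeakDeriv z.1 z.2)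
    (hw : IsWeakDeriv w.1 w.2) : IsWeakDeriv (z + w).1 (z + w).2 :=
  (W1p p).add_mem (x := WithLp.toLp p z) (y := WithLp.toLp p w) hz hw

/-- Weak differentiability passes to Bochner integrals. -/
theorem isWeakDeriv_integral {Ω : Type*} [MeasurableSpace Ω] {ν : Measure Ω}
    {Z : Ω → Lp ℝ p halfLine × Lp ℝ p halfLine} (hZ : Integrable Z ν)
    (h : ∀ a, IsWeakDeriv (Z a).1 (Z a).2) :
    IsWeakDeriv (∫ a, Z a ∂ν).1 (∫ a, Z a ∂ν).2 := by
  intro φ h1 h2 h3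
  obtain ⟨L, hL⟩ := exists_clm_weakDeriv (p := p) h1 h2
  rw [← add_eq_zero_iff_eq_neg, ← hL, ← L.integral_comp_comm hZ]
  have : ∀ a, L (Z a) = 0 := fun a => by
    rw [hL, add_eq_zero_iff_eq_neg]
    exact h a φ h1 h2 h3
  simp [this]

theorem isWeakDeriv_unique {f : ℝ → ℝ} {g g' : Lp ℝ p halfLine} (h : IsWeakDeriv f g)
    (h' : IsWeakDeriv f g') : g = g' := by
  refine sub_eq_zero.1 (Lp.ext ?_)
  have hloc : LocallyIntegrableOn (g - g' : Lp ℝ p halfLine) (Ioi 0) volume := by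
    intro x hx
    obtain ⟨U, hU, hi⟩ := ((Lp.memLp (g - g')).locallyIntegrable Fact.out) x
    refine ⟨U ∩ Ioi 0, inter_mem (mem_nhdsWithin_of_mem_nhds hU) self_mem_nhdsWithin, ?_⟩
    rwa [IntegrableOn, ← Measure.restrict_restrict' measurableSet_Ioi]
  have hz := isOpen_Ioi.ae_eq_zero_of_integral_contDiff_smul_eq_zero hloc (fun φ h1 h2 h3 => by
    have hg := integrable_mul_test g h1.continuous h2
    have hg' := integrable_mul_test g' h1.continuous h2
    have e0 : ∀ x, x ∉ Ioi (0 : ℝ) → φ x • (g - g' : Lp ℝ p halfLine) x = 0 := fun x hx => by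
      rw [image_eq_zero_of_notMem_tsupport (fun hx' => hx (h3 hx')), zero_smul]
    rw [← setIntegral_eq_integral_of_forall_compl_eq_zero e0]
    have e1 : (fun x => φ x • (g - g' : Lp ℝ p halfLine) x) =ᵐ[halfLine]
        fun x => g x * φ x - g' x * φ x := by
      filter_upwards [Lp.coeFn_sub g g'] with x hx
      rw [hx, Pi.sub_apply, smul_eq_mul]
      ring
    rw [integral_congr_ae e1, integral_sub hg hg', sub_eq_zero, ← neg_inj, ← h φ h1 h2 h3,
      ← h' φ h1 h2 h3])
  filter_upwards [(ae_restrict_iff' measurableSet_Ioi).2 hz, Lp.coeFn_zero ℝ p halfLine]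
    with x h1 h2
  rw [h1, h2, Pi.zero_apply]

/-- The pair `(f, f')` underlying an element of `W^{1,p}`, with the maximum norm. -/
def toPair (f : W1p p) : Lp ℝ p halfLine × Lp ℝ p halfLine := (f.1.fst, f.1.snd)

theorem toPair_injective : Function.Injective (toPair : W1p p → _) := by
  intro f g h
  have h1 := (Prod.ext_iff.1 h).1
  have h2 := (Prod.ext_iff.1 h).2
  refine Subtype.ext ((WithLp.ofLp_injective p) (Prod.ext h1 h2))

theorem continuous_toPair : Continuous (toPair : W1p p → _) :=
  (WithLp.prod_continuous_ofLp p _ _).comp continuous_subtype_val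

theorem norm_toPair_le (f : W1p p) : ‖toPair f‖ ≤ ‖f‖ :=
  max_le (WithLp.norm_fst_le _ f.1) (WithLp.norm_snd_le _ f.1)

/-- The element of `W^{1,p}` with a given pair `(f, f')`. -/
def ofPair (z : Lp ℝ p halfLine × Lp ℝ p halfLine) (hz : IsWeakDeriv z.1 z.2) : W1p p :=
  ⟨WithLp.toLp p z, hz⟩

theorem norm_toLp_le (z : Lp ℝ p halfLine × Lp ℝ p halfLine) : ‖WithLp.toLp p z‖ ≤ 2 * ‖z‖ := by
  have e : WithLp.toLp p z = WithLp.toLp p (z.1, 0) + WithLp.toLp p (0, z.2) := by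
    rw [← WithLp.toLp_add]
    simp
  rw [e]
  refine (norm_add_le _ _).trans ?_
  rw [WithLp.norm_toLp_fst, WithLp.norm_toLp_snd]
  linarith [norm_fst_le z, norm_snd_le z]

end Sobolev

/-! ### The mild formulation as a Volterra equation -/

/-- Coefficients can be normalised to be measurable and bounded everywhere by their norms. -/
theorem exists_boundedCoeff {T : ℝ} {b : ℝ → Lp ℝ 2 halfLine} (hb : MemLp b ∞ (timeInterval T))
    {γ : ℝ × ℝ → ℝ} (hγ : MemLp γ ∞ (timeSpace T)) :
    ∃ (b' : ℝ → Lp ℝ 2 halfLine) (γ' : ℝ × ℝ → ℝ),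
      BoundedCoeff b' γ' (eLpNorm b ∞ (timeInterval T)).toReal
        (eLpNorm γ ∞ (timeSpace T)).toReal ∧
      ∀ᵐ τ ∂timeInterval T, b τ = b' τ ∧
        (fun y => γ (τ, y)) =ᵐ[halfLine] fun y => γ' (τ, y) := by
  set Nb := (eLpNorm b ∞ (timeInterval T)).toReal
  set Nγ := (eLpNorm γ ∞ (timeSpace T)).toReal
  have hNb : 0 ≤ Nb := ENNReal.toReal_nonneg
  have hNγ : 0 ≤ Nγ := ENNReal.toReal_nonneg
  have hbm := hb.1.stronglyMeasurable_mk
  have hγm := hγ.1.stronglyMeasurable_mk.measurable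
  refine ⟨{τ | ‖hb.1.mk b τ‖ ≤ Nb}.indicator (hb.1.mk b), fun z => max (-Nγ) (min Nγ (hγ.1.mk γ z)),
    ⟨hbm.indicator (hbm.norm.measurable measurableSet_Iic), fun τ => ?_, ?_, fun z => ?_⟩, ?_⟩
  · by_cases h : τ ∈ {τ | ‖hb.1.mk b τ‖ ≤ Nb}
    · rw [indicator_of_mem h]; exact h
    · rw [indicator_of_notMem h, norm_zero]; exact hNb
  · exact measurable_const.max (measurable_const.min hγm)
  · exact abs_le.2 ⟨le_max_left _ _, max_le (by linarith) (min_le_left _ _)⟩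
  · have h1 : ∀ᵐ z ∂((timeInterval T).prod halfLine), γ z = max (-Nγ) (min Nγ (hγ.1.mk γ z)) := by
      rw [Measure.prod_restrict, ← Measure.volume_eq_prod]
      filter_upwards [hγ.1.ae_eq_mk, ae_norm_le_of_memLp_top hγ] with z h2 h3
      rw [← h2]
      obtain ⟨h4, h5⟩ := abs_le.1 h3
      rw [min_eq_right h5, max_eq_right h4]
    filter_upwards [hb.1.ae_eq_mk, ae_norm_le_of_memLp_top hb, Measure.ae_ae_of_ae_prod h1]
      with τ h2 h3 h4
    refine ⟨?_, h4⟩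
    rw [indicator_of_mem (by rw [mem_ofPred_eq, ← h2]; exact h3), h2]

section Mild

variable {p r : ℝ≥0∞} [Fact (1 ≤ p)] [Fact (1 ≤ r)] [ENNReal.HolderTriple 2 p r]
  {b b' : ℝ → Lp ℝ 2 halfLine} {γ γ' : ℝ × ℝ → ℝ} {Nb Nγ T A : ℝ}

/-- The first component of the Volterra integral is computed pointwise by the mild formula. -/
theorem volterraOp_fst_ae (hE : PerturbationExponents p r) (hc : BoundedCoeff b' γ' Nb Nγ)
    (hR : SingularKernel T A (duhamelKernel (p := p) r b' γ')) (hA : 0 ≤ A)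
    (hbγ : ∀ᵐ τ ∂timeInterval T, b τ = b' τ ∧
      (fun y => γ (τ, y)) =ᵐ[halfLine] fun y => γ' (τ, y))
    {z : ℝ → Lp ℝ p halfLine × Lp ℝ p halfLine} (hz : MemLp z ∞ (timeInterval T))
    {f g : ℝ → ℝ → ℝ} (hfg : ∀ᵐ τ ∂timeInterval T, (z τ).1 =ᵐ[halfLine] f τ ∧
      (z τ).2 =ᵐ[halfLine] g τ) {t : ℝ} (ht : t ∈ Icc 0 T) :
    (volterraOp (duhamelKernel r b' γ') z t).1 =ᵐ[halfLine] fun x => ∫ τ in (0)..t,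
      dirichletConv (t - τ) (fun y => b τ y * g τ y + γ (τ, y) * f τ y) x := by
  have hI := hR.intervalIntegrable hA hz ht
  rw [intervalIntegrable_iff_integrableOn_Ioc_of_le ht.1] at hI
  have hzm := hz.1.stronglyMeasurable_mk
  obtain ⟨h₁, hm₁, hh₁⟩ := exists_measurable_representative hE.young_two.e_ne_top
    (hc.stronglyMeasurable_smul (r := r) hE hzm.snd)
  obtain ⟨h₂, hm₂, hh₂⟩ := exists_measurable_representative hE.young_one.p_ne_top
    (hc.stronglyMeasurable_mulLp hE.young_one.p_ne_top hzm.fst)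
  have hK : Measurable (Function.uncurry fun τ => heatKernel (t - τ)) :=
    measurable_heatKernel.comp ((measurable_const.sub measurable_fst).prodMk measurable_snd)
  have hG := (measurable_halfConv_param (c := -1) hK hm₁).add
    (measurable_halfConv_param (c := -1) hK hm₂)
  have hH1 : Integrable (fun τ => (duhamelKernel r b' γ' (t - τ) τ (z τ)).1)
      (volume.restrict (Ioc 0 t)) := hI.fst
  have key := coeFn_integral_Lp_ae_eq hH1 hG ?_
  · unfold volterraOp
    rw [intervalIntegral.integral_of_le ht.1, fst_integral hI]
    refine key.trans (ae_of_all _ fun x => ?_)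
    simp only
    rw [intervalIntegral.integral_of_le ht.1]
    refine integral_congr_ae ?_
    filter_upwards [ae_Ioc_of_ae_timeInterval hz.1.ae_eq_mk ht, ae_Ioc_of_ae_timeInterval hbγ ht,
      ae_Ioc_of_ae_timeInterval hfg ht] with τ e1 e2 e3
    have a1 : (fun y => h₁ (τ, y)) =ᵐ[halfLine] (b' τ • (z τ).2 : Lp ℝ r halfLine) := by
      rw [e1]; exact (hh₁ τ).symm
    have a2 : (fun y => h₂ (τ, y)) =ᵐ[halfLine] mulLp (fun y => γ' (τ, y)) (z τ).1 := by
      rw [e1]; exact (hh₂ τ).symm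
    have a3 : (fun y => b τ y * g τ y + γ (τ, y) * f τ y) =ᵐ[halfLine]
        fun y => (b' τ • (z τ).2 : Lp ℝ r halfLine) y +
          mulLp (fun y => γ' (τ, y)) (z τ).1 y := by
      filter_upwards [Lp.coeFn_lpSMul (r := r) (b' τ) (z τ).2, e2.2, e3.1, e3.2,
        coeFn_mulLp (hc.measurable_slice τ) (fun y => hc.abs_γ_le (τ, y)) (z τ).1]
        with y c1 c2 c3 c4 c5
      rw [c1, c5, Pi.smul_apply', smul_eq_mul, ← c2, ← c3, ← c4, e2.1]
    rw [dirichletConv_eq_halfConv, halfConv_congr_ae a3,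
      halfConv_add (memLp_heatKernel _) hE.young_two.one_le_e hE.young_one.one_le_e (Lp.memLp _)
        (Lp.memLp _), ← halfConv_congr_ae a1, ← halfConv_congr_ae a2]
    rfl
  · filter_upwards [ae_Ioc_of_ae_timeInterval hz.1.ae_eq_mk ht] with τ e1
    have a1 := heatPair_fst_ae hE.young_two (t - τ) (b' τ • (z τ).2 : Lp ℝ r halfLine)
    have a2 := heatPair_fst_ae hE.young_one (t - τ) (mulLp (fun y => γ' (τ, y)) (z τ).1)
    filter_upwards [a1, a2, Lp.coeFn_add
      (heatPair p (t - τ) (b' τ • (z τ).2 : Lp ℝ r halfLine)).1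
      (heatPair p (t - τ) (mulLp (fun y => γ' (τ, y)) (z τ).1)).1] with x c1 c2 c3
    rw [duhamelKernel, Prod.fst_add, c3, Pi.add_apply, c1, c2, e1, halfConv_congr_ae (hh₁ τ),
      halfConv_congr_ae (hh₂ τ)]
    rfl

omit [Fact (1 ≤ r)] in
theorem isWeakDeriv_volterraOp (hE : PerturbationExponents p r)
    (hR : SingularKernel T A (duhamelKernel (p := p) r b' γ')) (hA : 0 ≤ A)
    {z : ℝ → Lp ℝ p halfLine × Lp ℝ p halfLine} (hz : MemLp z ∞ (timeInterval T)) {t : ℝ}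
    (ht : t ∈ Icc 0 T) :
    IsWeakDeriv (volterraOp (duhamelKernel r b' γ') z t).1
      (volterraOp (duhamelKernel r b' γ') z t).2 := by
  have hI := hR.intervalIntegrable hA hz ht
  rw [intervalIntegrable_iff_integrableOn_Ioc_of_le ht.1] at hI
  unfold volterraOp
  rw [intervalIntegral.integral_of_le ht.1]
  exact isWeakDeriv_integral hI fun τ => isWeakDeriv_add
    (isWeakDeriv_heatPair hE.young_two _ _) (isWeakDeriv_heatPair hE.young_one _ _)

/-- Mild solutions are the solutions of a Volterra equation for the pair `(v, ∂ₓv)`. -/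
theorem isMildSolution_iff (hE : PerturbationExponents p r) (hc : BoundedCoeff b' γ' Nb Nγ)
    (hR : SingularKernel T A (duhamelKernel (p := p) r b' γ')) (hA : 0 ≤ A)
    (hbγ : ∀ᵐ τ ∂timeInterval T, b τ = b' τ ∧
      (fun y => γ (τ, y)) =ᵐ[halfLine] fun y => γ' (τ, y))
    {ψ : ℝ → ℝ} {U : ℝ → Lp ℝ p halfLine × Lp ℝ p halfLine} (hU : MemLp U ∞ (timeInterval T))
    (hUψ : ∀ t ∈ Icc 0 T, (U t).1 =ᵐ[halfLine] boundaryHeat ψ t ∧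
      (U t).2 =ᵐ[halfLine] deriv (boundaryHeat ψ t))
    {v₀ : W1p p} (h0 : VanishesAtZero v₀) {w : ℝ → W1p p} (hw : MemLp w ∞ (timeInterval T)) :
    IsMildSolution T ψ b γ v₀ w ↔ ∀ t ∈ Icc 0 T, toPair (w t) =
      (initialPair v₀ t + volterraOp (duhamelKernel r b' γ') U t) +
        volterraOp (duhamelKernel r b' γ') (fun τ => toPair (w τ)) t := by
  have hwp : MemLp (fun τ => toPair (w τ)) ∞ (timeInterval T) :=
    hw.of_le (continuous_toPair.comp_aestronglyMeasurable hw.1)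
      (ae_of_all _ fun τ => norm_toPair_le (w τ))
  set R := duhamelKernel (p := p) r b' γ' with hRdef
  have formula : ∀ t ∈ Icc 0 T,
      (initialPair v₀ t + volterraOp R U t + volterraOp R (fun τ => toPair (w τ)) t).1
      =ᵐ[halfLine] fun x => dirichletSemigroup t (toFun v₀) x
      + (∫ τ in (0)..t, dirichletConv (t - τ)
          (fun y => b τ y * dx (w τ) y + γ (τ, y) * toFun (w τ) y) x)
      + ∫ τ in (0)..t, dirichletConv (t - τ)
          (fun y => b τ y * deriv (boundaryHeat ψ τ) y + γ (τ, y) * boundaryHeat ψ τ y) x := by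
    intro t ht
    have f1 := volterraOp_fst_ae (z := U) (f := boundaryHeat ψ)
      (g := fun τ => deriv (boundaryHeat ψ τ)) hE hc hR hA hbγ hU (by
        filter_upwards [ae_restrict_mem measurableSet_Icc] with τ hτ using hUψ τ hτ) ht
    have f2 := volterraOp_fst_ae (f := fun τ => toFun (w τ)) (g := fun τ => dx (w τ))
      hE hc hR hA hbγ hwp (ae_of_all _ fun τ => ⟨EventuallyEq.rfl, EventuallyEq.rfl⟩) ht
    filter_upwards [f1, f2, initialPair_fst_ae hE.young_one v₀ t,
      Lp.coeFn_add (initialPair v₀ t).1 (volterraOp R U t).1,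
      Lp.coeFn_add ((initialPair v₀ t).1 + (volterraOp R U t).1)
        (volterraOp R (fun τ => toPair (w τ)) t).1] with x c1 c2 c3 c4 c5
    rw [Prod.fst_add, Prod.fst_add, c5, Pi.add_apply, c4, Pi.add_apply, c1, c2, c3]
    ring
  constructor
  · intro h t ht
    have hfst : (toPair (w t)).1 = (initialPair v₀ t + volterraOp R U t +
        volterraOp R (fun τ => toPair (w τ)) t).1 :=
      Lp.ext ((show (toPair (w t)).1 =ᵐ[halfLine] _ from h.eq t ht).trans (formula t ht).symm)
    refine Prod.ext hfst (isWeakDeriv_unique (f := (toPair (w t)).1) (w t).2 ?_)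
    rw [hfst]
    exact isWeakDeriv_add (isWeakDeriv_add (isWeakDeriv_initialPair hE.young_one v₀ h0 t)
      (isWeakDeriv_volterraOp hE hR hA hU ht)) (isWeakDeriv_volterraOp hE hR hA hwp ht)
  · intro h
    refine ⟨hw, fun t ht => ?_⟩
    have := formula t ht
    rw [← h t ht] at this
    exact this

end Mild

/-- Existence, uniqueness and the a priori bound, for `p` and `β` in the form used in the
estimates. -/
theorem exists_mild_solution {T : ℝ} (hT : 0 < T) {β : ℝ≥0} (hβ : 0 < β) {p : ℝ≥0∞}
    [Fact (1 ≤ p)] (hp2 : 2 ≤ p) (hp : p ≠ ⊤) (hpβ : (1 - 2 * (β : ℝ)) * p.toReal < 1) :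
    ∃ C : ℝ, 0 < C ∧ ∀ ψ : ℝ → ℝ, MemCHolder T β ψ → ψ 0 = 0 →
      ∀ b : ℝ → Lp ℝ 2 halfLine, MemLp b ∞ (timeInterval T) →
      ∀ γ : ℝ × ℝ → ℝ, MemLp γ ∞ (timeSpace T) → ∀ v₀ : W1p p, VanishesAtZero v₀ →
        ∃ v : ℝ → W1p p, IsMildSolution T ψ b γ v₀ v ∧
          (∀ w : ℝ → W1p p, IsMildSolution T ψ b γ v₀ w → ∀ t ∈ Icc 0 T, w t = v t) ∧
          ∀ t ∈ Icc 0 T, ‖v t‖ ≤ C * Real.exp (C * coeffNorm T b γ ^ 4) *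
            (‖v₀‖ + coeffNorm T b γ * cHolderNorm T β ψ) := by
  have hE := perturbationExponents hp2 hp
  set r : ℝ≥0∞ := (2⁻¹ + p⁻¹)⁻¹ with hr
  have : ENNReal.HolderTriple 2 p r := hE.holder
  have : Fact (1 ≤ r) := ⟨hE.young_two.one_le_e⟩
  obtain ⟨A, hA, hkernel⟩ := exists_norm_duhamelKernel_le (r := r) hE hT
  obtain ⟨C₁, hC₁, hinit⟩ := exists_norm_initialPair_le hE.young_one
  obtain ⟨C₂, hC₂, hbdry⟩ := exists_boundaryPair hT hβ hp hpβ
  have hΓ : 0 < Real.Gamma (1 / 4) := Real.Gamma_pos_of_pos (by norm_num)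
  set K := C₁ + Real.exp T * (A * Real.Gamma (1 / 4) * C₂) with hK
  have hK0 : 0 < K := by positivity
  set Q := T * (2 * A * Real.Gamma (1 / 4)) ^ 4 with hQ
  refine ⟨4 * Real.exp T * K + Q, by positivity, fun ψ hψ hψ0 b hb γ hγ v₀ h0 => ?_⟩
  obtain ⟨U, hUm, hU⟩ := hbdry ψ hψ hψ0
  obtain ⟨b', γ', hc, hbγ⟩ := exists_boundedCoeff hb hγ
  set M := coeffNorm T b γ with hM
  have hM0 : 0 ≤ M := add_nonneg ENNReal.toReal_nonneg ENNReal.toReal_nonneg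
  have hN0 := cHolderNorm_nonneg T β ψ
  set N := cHolderNorm T β ψ
  set R := duhamelKernel (p := p) r b' γ' with hRdef
  have hAM : 0 ≤ A * M := by positivity
  have hR : SingularKernel T (A * M) R :=
    ⟨duhamelKernel_sub hE hc, hkernel b' γ' _ _ hc, fun z hz =>
      stronglyMeasurable_duhamelKernel hE hc hz⟩
  have hUmem : MemLp U ∞ (timeInterval T) := by
    refine memLp_top_of_bound hUm.aestronglyMeasurable (C₂ * N) ?_
    filter_upwards [ae_restrict_mem measurableSet_Icc] with t ht using (hU t ht).1
  set F : ℝ → Lp ℝ p halfLine × Lp ℝ p halfLine := fun t => initialPair v₀ t + volterraOp R U t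
    with hF
  have hFbound : ∀ t ∈ Icc 0 T, ‖F t‖ ≤ K * (‖v₀‖ + M * N) := by
    intro t ht
    have h1 := (hR.weighted_bound hAM one_pos hUmem.1 (N := C₂ * N) (by
      filter_upwards [ae_restrict_mem measurableSet_Icc] with τ hτ
      have : 1 ≤ Real.exp (1 * τ) := Real.one_le_exp (by linarith [hτ.1])
      exact (hU τ hτ).1.trans (le_mul_of_one_le_left (by positivity) this)) ht).2 (by positivity)
    rw [one_div_one, Real.one_rpow, mul_one, one_mul] at h1
    calc ‖F t‖ ≤ C₁ * ‖v₀‖ + Real.exp t * (A * M * Real.Gamma (1 / 4) * (C₂ * N)) :=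
          (norm_add_le _ _).trans (add_le_add (hinit v₀ t) h1)
      _ ≤ C₁ * ‖v₀‖ + Real.exp T * (A * M * Real.Gamma (1 / 4) * (C₂ * N)) := by
          gcongr; exact ht.2
      _ = C₁ * ‖v₀‖ + (Real.exp T * (A * Real.Gamma (1 / 4) * C₂)) * (M * N) := by ring
      _ ≤ K * ‖v₀‖ + K * (M * N) := by
          gcongr
          · exact le_add_of_nonneg_right (by positivity)
          · exact le_add_of_nonneg_left hC₁.le
      _ = _ := by ring
  have hFmem : MemLp F ∞ (timeInterval T) := by
    refine memLp_top_of_bound ?_ (K * (‖v₀‖ + M * N)) ?_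
    · exact (stronglyMeasurable_initialPair hE.young_one v₀).aestronglyMeasurable.add
        (hR.aestronglyMeasurable_volterraOp hUmem.1)
    · filter_upwards [ae_restrict_mem measurableSet_Icc] with t ht using hFbound t ht
  obtain ⟨u, hu, hueq⟩ := hR.exists_solution hAM hFmem
  have hubound : ∀ t ∈ Icc 0 T, ‖u t‖ ≤ 2 * Real.exp (growthRate (A * M) * T) *
      (K * (‖v₀‖ + M * N)) := fun t ht =>
    hR.norm_le_of_eq hAM (by positivity) hu hFbound hueq ht
  have huweak : ∀ t ∈ Icc 0 T, IsWeakDeriv (u t).1 (u t).2 := by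
    intro t ht
    rw [hueq t ht]
    exact isWeakDeriv_add (isWeakDeriv_add (isWeakDeriv_initialPair hE.young_one v₀ h0 t)
      (isWeakDeriv_volterraOp hE hR hAM hUmem ht)) (isWeakDeriv_volterraOp hE hR hAM hu ht)
  let v : ℝ → W1p p := fun t => if ht : t ∈ Icc 0 T then ofPair (u t) (huweak t ht) else 0
  have hv : ∀ t (ht : t ∈ Icc 0 T), v t = ofPair (u t) (huweak t ht) := fun t ht => dif_pos ht
  have hvpair : ∀ t ∈ Icc 0 T, toPair (v t) = u t := fun t ht => by rw [hv t ht]; rfl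
  have hvnorm : ∀ t ∈ Icc 0 T, ‖v t‖ ≤ 2 * ‖u t‖ := fun t ht => by
    rw [hv t ht]; exact norm_toLp_le (u t)
  have hvae : (fun t => toPair (v t)) =ᵐ[timeInterval T] u := by
    filter_upwards [ae_restrict_mem measurableSet_Icc] with t ht using hvpair t ht
  have hvmem : MemLp v ∞ (timeInterval T) := by
    refine memLp_top_of_bound ?_ (2 * (2 * Real.exp (growthRate (A * M) * T) *
      (K * (‖v₀‖ + M * N)))) ?_
    · rw [← IsEmbedding.subtypeVal.aestronglyMeasurable_comp_iff]
      refine ((WithLp.prod_continuous_toLp p _ _).comp_aestronglyMeasurable hu.1).congr ?_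
      filter_upwards [hvae] with t ht
      rw [← ht]
      rfl
    · filter_upwards [ae_restrict_mem measurableSet_Icc] with t ht
      exact (hvnorm t ht).trans (mul_le_mul_of_nonneg_left (hubound t ht) two_pos.le)
  have hiff := fun (w : ℝ → W1p p) (hw : MemLp w ∞ (timeInterval T)) =>
    isMildSolution_iff (r := r) hE hc hR hAM hbγ hUmem (fun t ht => (hU t ht).2) h0 hw
  refine ⟨v, (hiff v hvmem).2 fun t ht => ?_, fun w hw t ht => ?_, fun t ht => ?_⟩
  · rw [hvpair t ht, hueq t ht, volterraOp_congr_ae hvae ht]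
  · refine toPair_injective ?_
    rw [hvpair t ht]
    have hwp : MemLp (fun τ => toPair (w τ)) ∞ (timeInterval T) :=
      hw.memLp.of_le (continuous_toPair.comp_aestronglyMeasurable hw.memLp.1)
        (ae_of_all _ fun τ => norm_toPair_le (w τ))
    exact hR.eq_of_eq (u := fun τ => toPair (w τ)) hAM hwp hu ((hiff w hw.memLp).1 hw) hueq ht
  · have hexp : growthRate (A * M) * T = T + Q * M ^ 4 := by
      rw [hQ]; unfold growthRate; ring
    have hQ0 : 0 ≤ Q := by positivity
    have hL : 0 ≤ ‖v₀‖ + M * N := by positivity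
    calc ‖v t‖ ≤ 2 * (2 * Real.exp (growthRate (A * M) * T) * (K * (‖v₀‖ + M * N))) :=
          (hvnorm t ht).trans (mul_le_mul_of_nonneg_left (hubound t ht) two_pos.le)
      _ = 4 * Real.exp T * K * Real.exp (Q * M ^ 4) * (‖v₀‖ + M * N) := by
          rw [hexp, Real.exp_add]; ring
      _ ≤ (4 * Real.exp T * K + Q) * Real.exp ((4 * Real.exp T * K + Q) * M ^ 4) *
          (‖v₀‖ + M * N) := by
          gcongr
          · exact le_add_of_nonneg_right hQ0
          · exact le_add_of_nonneg_left (by positivity)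

end HalfLineHeat

end

theorem mainTheorem5 (T : ℝ) (hT : 0 < T) (β : ℝ≥0) (hβ : 1 / 4 < β) (hβ' : β < 1 / 2)
    (p : ℝ≥0∞) [Fact (1 ≤ p)] (hp : 2 ≤ p) (hpβ : p < ENNReal.ofReal (1 / (1 - 2 * (β : ℝ)))) :
    ∃ C : ℝ, 0 < C ∧
      ∀ (ψ : ℝ → ℝ), HalfLineHeat.MemCHolder T β ψ → ψ 0 = 0 →
      ∀ (b : ℝ → Lp ℝ 2 HalfLineHeat.halfLine), MemLp b ∞ (HalfLineHeat.timeInterval T) →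
      ∀ (γ : ℝ × ℝ → ℝ), MemLp γ ∞ (HalfLineHeat.timeSpace T) →
      ∀ (v₀ : HalfLineHeat.W1p p), HalfLineHeat.VanishesAtZero v₀ →
        ∃ v : ℝ → HalfLineHeat.W1p p,
          HalfLineHeat.IsMildSolution T ψ b γ v₀ v ∧
          (∀ w : ℝ → HalfLineHeat.W1p p, HalfLineHeat.IsMildSolution T ψ b γ v₀ w →
            ∀ t ∈ Icc 0 T, w t = v t) ∧
          ∀ t ∈ Icc 0 T,
            ‖v t‖ ≤ C * Real.exp (C * HalfLineHeat.coeffNorm T b γ ^ 4) *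
              (‖v₀‖ + HalfLineHeat.coeffNorm T b γ * HalfLineHeat.cHolderNorm T β ψ) := by
  have hβ0 : 0 < β := lt_trans (by norm_num) hβ
  have hβ1 : (β : ℝ) < 1 / 2 := by exact_mod_cast hβ'
  have hpos : 0 < 1 - 2 * (β : ℝ) := by linarith
  have hp' : p ≠ ⊤ := hpβ.ne_top
  refine HalfLineHeat.exists_mild_solution hT hβ0 hp hp' ?_
  have h := (ENNReal.lt_ofReal_iff_toReal_lt hp').1 hpβ
  rw [lt_div_iff₀ hpos] at h
  linarith
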